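/- **Setting.** Let $d\ge1$, $\alpha\in[0,1]$, $g\in L_1(\mathbb R^d)$ and $n\ge 3$. For $f\in L_1(\mathbb R^d)$ put $\mathfrak p_f=(1-\alpha)f+\alpha[f\star g]$. For $R>1$, $D>0$ and $q,u\in[1,\infty]$ let $\mathbb B_{q,d}(D)$ be the ball of radius $D$ in $L_q(\mathbb R^d)$, let $\mathbb F_g(R)$ be the set of $f\in\mathbb B_{1,d}(R)$ such that $\mathfrak p_f$ is a probability density, and let $\mathbb F_{g,u}(R,D)$ be the set of $f\in\mathbb F_g(R)$ with $\|\mathfrak p_f\|_{u,\infty}<D$, where $\|\lambda\|_{u,\infty}=\inf\{C:\nu_d(|\lambda|>z)\le C^uz^{-u}\ \forall z>0\}$ and $\nu_d$ is Lebesgue measure (for $u=\infty$: $\mathfrak p_f\in\mathbb B_{\infty,d}(D)$). One observes i.i.d. $Z_1,\dots,Z_n$ with density $\mathfrak p_f$, and the risk of an estimator $\hat f$ is $\mathcal R_n^{(p)}[\hat f,f]=(\mathbb E_f\|\hat f-f\|_p^p)^{1/p}$. Write $\check U(t)=\int U(x)e^{-i\sum_j x_jt_j}dx$. Assume: if $\alpha\ne1$,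 there is $\varepsilon>0$ with $|1-\alpha+\alpha\check g(t)|\ge\varepsilon$ for all $t$; if $\alpha=1$, there are $\mu\in(0,\infty)^d$ and $\Upsilon_0>0$ with $|\check g(t)|\ge\Upsilon_0\prod_j(1+t_j^2)^{-\mu_j/2}$ for all $t$. Put $\lambda_j=\mu_j$ if $\alpha=1$ and $\lambda_j=0$ otherwise. Let $K:\mathbb R^d\to\mathbb R$ be continuous, compactly supported, $\int K=1$, with constants $k_1,k_2>0$ such that $\int|\check K(t)|\prod_j(1+t_j^2)^{\lambda_j/2}dt\le k_1$ and $\int|\check K(t)|^2\prod_j(1+t_j^2)^{\lambda_j}dt\le k_2^2$. **Estimator.** Let $\mathcal H=\{e^k:k\in\mathbb Z\}$ and let $\mathbb H$ be either $\mathcal H^d$ or $\mathcal H^d_{\rm isotr}=\{(h,\dots,h):h\in\mathcal H\}$; put $t(\mathbb H)=d-1$ in the first case and $t(\mathbb H)=0$ in the second. Operations and inequalities between vectors are coordinatewise. Let $K_h(t)=\prod_jh_j^{-1}K(t_1/h_1,\dots,t_d/h_d)$, and for $h\in\mathcal H^d$ let $M(\cdot,h)\in L_2(\mathbb R^d)$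 be a Borel function solving $K_h(y)=(1-\alpha)M(y,h)+\alpha\int g(t-y)M(t,h)\,dt$ for all $y\in\mathbb R^d$. Put $\hat f_h(x)=n^{-1}\sum_iM(Z_i-x,h)$, $\hat\sigma^2(x,h)=n^{-1}\sum_iM^2(Z_i-x,h)$, $$M_\infty=\big[(2\pi)^{-d}\{\varepsilon^{-1}\|\check K\|_1 1_{\alpha\ne1}+\Upsilon_0^{-1}k_1 1_{\alpha=1}\}\big]\vee1,\qquad \lambda_n(h)=4\ln M_\infty+6\ln n+(8p+26)\sum_j(1+\lambda_j)|\ln h_j|,$$ $$\hat U_n(x,h)=\sqrt{2\lambda_n(h)\hat\sigma^2(x,h)/n}+\frac{4M_\infty\lambda_n(h)}{3n\prod_jh_j(h_j\wedge1)^{\lambda_j}},\qquad \hat U^*_n(x,h)=\sup_{\eta\in\mathbb H,\,\eta\ge h}\hat U_n(x,\eta),$$ $$\hat{\mathcal R}_h(x)=\sup_{\eta\in\mathbb H}\big[|\hat f_{h\vee\eta}(x)-\hat f_\eta(x)|-4\hat U_n(x,h\vee\eta)-4\hat U_n(x,\eta)\big]_+ .$$ Let $\mathbf h(x)\in\mathbb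 H$ be a bandwidth, measurable jointly in $x$ and the sample, that minimizes $\hat{\mathcal R}_h(x)+8\hat U_n^*(x,h)$ over $h\in\mathbb H$ at every $x$ up to an additive tolerance $\tau(x)$, where $\tau:\mathbb R^d\to[0,\infty)$ is a measurable function with $\|\tau\|_p\le n^{-1/2}$ (exact minimization is the case $\tau=0$). The estimator is $x\mapsto\hat f_{\mathbf h(x)}(x)$. **Bounds.** Let $S_h(x,f)=\int K_h(t-x)f(t)\,dt$ and $$\mathcal B_h(x,f)=2\sup_{\eta\in\mathbb H}|S_{h\vee\eta}(x,f)-S_\eta(x,f)|+|S_h(x,f)-f(x)|,\qquad \mathcal A(h,f,v)=\{x:\mathcal B_h(x,f)\ge v/2\},$$ $$F_n(h)=\frac{\sqrt{\ln n+\sum_j|\ln h_j|}}{\sqrt n\prod_jh_j^{1/2}(h_j\wedge1)^{\lambda_j}},\qquad G_n(h)=\frac{\ln n+\sum_j|\ln h_j|}{n\prod_jh_j(h_j\wedge1)^{\lambda_j}},$$ $$\mathfrak H(v)=\{h\in\mathbb H:G_n(h)\le av\},\qquad \mathfrak H(v,z)=\{h\in\mathfrak H(v):F_n(h)\le avz^{-1/2}\}.$$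 Here $a=\{196[(c_1\sqrt{c_3})\vee(c_2c_3)]\}^{-1}$ with $c_1=M_2\sqrt{2D}$, $c_2=4M_\infty/3$, $c_3=2\max\{4\ln M_\infty,(8p+26)\max_j(1+\lambda_j)\}$ and $M_2=[(2\pi)^{-d}\{\varepsilon^{-1}\|\check K\|_2 1_{\alpha\ne1}+\Upsilon_0^{-1}k_2 1_{\alpha=1}\}]\vee1$. With $z^{-\infty}=0$ put $$\Lambda(v,f)=\inf_{h\in\mathfrak H(v)}\big[\nu_d(\mathcal A(h,f,v))+v^{-2}F_n^2(h)\big],\qquad \Lambda(v,f,u)=\inf_{z\ge2}\inf_{h\in\mathfrak H(v,z)}\big[\nu_d(\mathcal A(h,f,v))+z^{-u}\big],$$ $$\Lambda_p(v,f,u)=\inf_{z\ge2}\inf_{h\in\mathfrak H(v,z)}\Big[\int_{\mathcal A(h,f,v)}\mathcal B_h(x,f)^p\,dx+v^pz^{-u}\Big],\qquad l_{\mathbb H}(v)=v^{p-1}(1+|\ln v|)^{t(\mathbb H)} .$$ **Theorem.** Let $p>1$. There is a constant $\mathbf C_p$ that depends only on $p$ and on $d,\alpha,g,K$ and the constants in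 the two assumptions (in particular not on $R,D,q,u$), and for all $R>1$, $D>0$, $q>1$ and $u\in(p/2,\infty]$ with $u\ge q$ there is a constant $C^{(1)}$ that depends only on these parameters and on $R,D,q,u$, such that for both choices of $\mathbb H$, all $n\ge3$, all $f\in\mathbb F_{g,u}(R,D)\cap\mathbb B_{q,d}(D)$ and all $0<\underline v\le\overline v<\infty$ $$\mathcal R_n^{(p)}[\hat f_{\mathbf h(\cdot)},f]\le C^{(1)}\Big[l_{\mathbb H}(\underline v)+\int_{\underline v}^{\overline v}v^{p-1}\{\Lambda(v,f)\wedge\Lambda(v,f,u)\}\,dv+\Lambda_p(\overline v,f,u)\Big]^{1/p}+\mathbf C_p\,n^{-1/2}.$$ -/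

import Mathlib

open MeasureTheory
open scoped ENNReal NNReal

noncomputable section

namespace ConvModel

/-- The Fourier transform with the convention of probability theory,
`Ǔ(t) = ∫ U(x) exp(-i ∑ⱼ xⱼ tⱼ) dx`. -/
def fourier {d : ℕ} (U : (Fin d → ℝ) → ℝ) (t : Fin d → ℝ) : ℂ :=
  ∫ x : Fin d → ℝ, (U x : ℂ) * Complex.exp (-Complex.I * ((∑ j, x j * t j : ℝ) : ℂ))

/-- The closed ball of radius `R` in `L_s(ℝ^d)`, as a set of functions. -/
def lpBall (d : ℕ) (s : ℝ≥0∞) (R : ℝ) : Set ((Fin d → ℝ) → ℝ) :=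
  {f | MemLp f s volume ∧ eLpNorm f s volume ≤ ENNReal.ofReal R}

/-- The weak-type quasi-norm
`‖f‖_{u,∞} = inf {C : ν_d(|f| > z) ≤ C^u z^{-u} for all z > 0}`, for a finite exponent `u`. -/
def weakNorm {d : ℕ} (u : ℝ) (f : (Fin d → ℝ) → ℝ) : ℝ≥0∞ :=
  sInf {C : ℝ≥0∞ | ∀ z : ℝ, 0 < z →
    volume {x | z < |f x|} ≤ C ^ u * ENNReal.ofReal (z ^ (-u))}

/-- The ball of radius `D` in weak `L_u`; for `u = ∞` it is the ball of `L_∞`. -/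
def weakBall (d : ℕ) (u : ℝ≥0∞) (D : ℝ) : Set ((Fin d → ℝ) → ℝ) :=
  {f | if u = ∞ then f ∈ lpBall d ∞ D
    else AEStronglyMeasurable f volume ∧ weakNorm u.toReal f < ENNReal.ofReal D}

/-- The set of probability densities on `ℝ^d`. -/
def densities (d : ℕ) : Set ((Fin d → ℝ) → ℝ) :=
  {f | Integrable f volume ∧ 0 ≤ᵐ[volume] f ∧ ∫ x, f x = 1}

/-- The known quantities of the convolution structure density model and of the selection rule
(data only, nothing is assumed about them here): the contamination rate `α`, the function `g`, the
kernel `K`, the constants `ε`, `Υ₀`, `μ` that bound the Fourier transform of `g` from below, and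
the constants `k₁`, `k₂` that bound the integrals of the Fourier transform of `K`. -/
structure Model (d : ℕ) where
  α : ℝ
  g : (Fin d → ℝ) → ℝ
  K : (Fin d → ℝ) → ℝ
  ε : ℝ
  Υ₀ : ℝ
  μ : Fin d → ℝ
  k₁ : ℝ
  k₂ : ℝ

namespace Model

variable {d : ℕ} (S : Model d)

/-- The exponents `λⱼ(α)`: they are `μⱼ` if `α = 1`, and `0` if `α < 1`. -/
def lam (j : Fin d) : ℝ := if S.α = 1 then S.μ j else 0

/-- The lower bound on the Fourier transform of `g`. -/
def NoiseAssumption : Prop :=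
  (S.α ≠ 1 → 0 < S.ε ∧
    ∀ t, S.ε ≤ ‖((1 - S.α : ℝ) : ℂ) + ((S.α : ℝ) : ℂ) * fourier S.g t‖) ∧
  (S.α = 1 → (∀ j, 0 < S.μ j) ∧ 0 < S.Υ₀ ∧
    ∀ t, S.Υ₀ * ∏ j, (1 + t j ^ 2) ^ (-(S.μ j) / 2) ≤ ‖fourier S.g t‖)

/-- The integrability condition on the Fourier transform of `K`. -/
def KernelAssumption : Prop :=
  0 < S.k₁ ∧ 0 < S.k₂ ∧
  ∫⁻ t, ENNReal.ofReal (‖fourier S.K t‖ * ∏ j, (1 + t j ^ 2) ^ (S.lam j / 2))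
    ≤ ENNReal.ofReal S.k₁ ∧
  ∫⁻ t, ENNReal.ofReal (‖fourier S.K t‖ ^ 2 * ∏ j, (1 + t j ^ 2) ^ (S.lam j))
    ≤ ENNReal.ofReal (S.k₂ ^ 2)

/-- The function `𝔭 = (1 - α) f + α [f ⋆ g]`, the density of one observation. -/
def obsDensity (f : (Fin d → ℝ) → ℝ) (x : Fin d → ℝ) : ℝ :=
  (1 - S.α) * f x + S.α * ∫ z, f (x - z) * S.g z

/-- The class `𝔽_g(R)`. -/
def classF (R : ℝ) : Set ((Fin d → ℝ) → ℝ) :=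
  {f | f ∈ lpBall d 1 R ∧ S.obsDensity f ∈ densities d}

/-- The class `𝔽_{g,u}(R, D)`. -/
def classFu (u : ℝ≥0∞) (R D : ℝ) : Set ((Fin d → ℝ) → ℝ) :=
  {f | f ∈ S.classF R ∧ S.obsDensity f ∈ weakBall d u D}

/-- The law of the sample `(Z₁, …, Zₙ)` of independent observations with density `𝔭`. -/
def sampleLaw (n : ℕ) (f : (Fin d → ℝ) → ℝ) : Measure (Fin n → Fin d → ℝ) :=
  Measure.pi fun _ => volume.withDensity fun x => ENNReal.ofReal (S.obsDensity f x)

/-- The `L_p`-risk of an estimator, a map from samples to functions on `ℝ^d`. -/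
def risk (p : ℝ) (n : ℕ) (est : (Fin n → Fin d → ℝ) → (Fin d → ℝ) → ℝ)
    (f : (Fin d → ℝ) → ℝ) : ℝ≥0∞ :=
  (∫⁻ Z, eLpNorm (fun x => est Z x - f x) (ENNReal.ofReal p) volume ^ p
    ∂(S.sampleLaw n f)) ^ (1 / p)

end Model

/-- The multi-bandwidths `ℋ^d`, where `ℋ = {e^k : k ∈ ℤ}`. -/
def grid (d : ℕ) : Set (Fin d → ℝ) := {h | ∀ j, ∃ k : ℤ, h j = Real.exp k}

/-- The multi-bandwidths of `ℋ^d` with equal coordinates. -/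
def isoGrid (d : ℕ) : Set (Fin d → ℝ) := {h | ∃ k : ℤ, ∀ j, h j = Real.exp k}

/-- The two collections of multi-bandwidths: all of `ℋ^d`, or the isotropic ones. -/
inductive Family where
  | full : Family
  | isotropic : Family

namespace Family

/-- The collection `ℍ` of multi-bandwidths. -/
def bandwidths (d : ℕ) : Family → Set (Fin d → ℝ)
  | full => grid d
  | isotropic => isoGrid d

/-- The exponent `t(ℍ)`. -/
def logExponent (d : ℕ) : Family → ℕ
  | full => d - 1
  | isotropic => 0

/-- The function `l_ℍ(v) = v^{p-1} (1 + |ln v|)^{t(ℍ)}`. -/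
def ell (d : ℕ) (F : Family) (p v : ℝ) : ℝ :=
  v ^ (p - 1) * (1 + |Real.log v|) ^ F.logExponent d

end Family

namespace Model

variable {d : ℕ} (S : Model d)

/-- The rescaled kernel `K_h(t) = V_h⁻¹ K(t₁/h₁, …, t_d/h_d)`. -/
def scaledK (h t : Fin d → ℝ) : ℝ := (∏ j, h j)⁻¹ * S.K fun j => t j / h j

/-- `m` is a square integrable solution `M(·, h)` of the operator equation
`K_h(y) = (1 - α) M(y, h) + α ∫ g(t - y) M(t, h) dt`. -/
structure IsSolution (h : Fin d → ℝ) (m : (Fin d → ℝ) → ℝ) : Prop where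
  measurable : Measurable m
  memLp : MemLp m 2 volume
  equation : ∀ y, S.scaledK h y = (1 - S.α) * m y + S.α * ∫ t, S.g (t - y) * m t

/-- The constant `M_∞`. -/
def Minf : ℝ :=
  max ((2 * Real.pi) ^ (-(d : ℝ)) *
    (if S.α = 1 then S.Υ₀⁻¹ * S.k₁ else S.ε⁻¹ * ∫ t, ‖fourier S.K t‖)) 1

/-- The constant `M_2`. -/
def Mtwo : ℝ :=
  max ((2 * Real.pi) ^ (-(d : ℝ)) *
    (if S.α = 1 then S.Υ₀⁻¹ * S.k₂ else S.ε⁻¹ * √(∫ t, ‖fourier S.K t‖ ^ 2))) 1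

/-- The quantity `λ_n(h)`. -/
def lamN (p : ℝ) (n : ℕ) (h : Fin d → ℝ) : ℝ :=
  4 * Real.log S.Minf + 6 * Real.log n
    + (8 * p + 26) * ∑ j, (1 + S.lam j) * |Real.log (h j)|

/-! The estimators are built on a family `M y h` of solutions of the operator equation. -/

/-- The kernel-type estimator `f̂_h(x) = n⁻¹ ∑ᵢ M(Zᵢ - x, h)`. -/
def fhat (M : (Fin d → ℝ) → (Fin d → ℝ) → ℝ) {n : ℕ} (Z : Fin n → Fin d → ℝ)
    (x h : Fin d → ℝ) : ℝ :=
  (n : ℝ)⁻¹ * ∑ i, M (Z i - x) h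

/-- The empirical second moment `σ̂²(x, h)`. -/
def sigmaHatSq (M : (Fin d → ℝ) → (Fin d → ℝ) → ℝ) {n : ℕ} (Z : Fin n → Fin d → ℝ)
    (x h : Fin d → ℝ) : ℝ :=
  (n : ℝ)⁻¹ * ∑ i, M (Z i - x) h ^ 2

/-- The empirical majorant `Û_n(x, h)`. -/
def Uhat (p : ℝ) (M : (Fin d → ℝ) → (Fin d → ℝ) → ℝ) {n : ℕ} (Z : Fin n → Fin d → ℝ)
    (x h : Fin d → ℝ) : ℝ :=
  √(2 * S.lamN p n h * sigmaHatSq M Z x h / n)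
    + 4 * S.Minf * S.lamN p n h / (3 * n * ∏ j, h j * min (h j) 1 ^ S.lam j)

/-- `R̂_h(x) = sup_{η ∈ ℍ} [|f̂_{h ∨ η}(x) - f̂_η(x)| - 4 Û_n(x, h ∨ η) - 4 Û_n(x, η)]₊`;
`ENNReal.ofReal` takes the positive part. -/
def Rhat (p : ℝ) (F : Family) (M : (Fin d → ℝ) → (Fin d → ℝ) → ℝ) {n : ℕ}
    (Z : Fin n → Fin d → ℝ) (x h : Fin d → ℝ) : ℝ≥0∞ :=
  ⨆ η ∈ F.bandwidths d, ENNReal.ofReal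
    (|fhat M Z x (h ⊔ η) - fhat M Z x η| - 4 * S.Uhat p M Z x (h ⊔ η) - 4 * S.Uhat p M Z x η)

/-- `Û*_n(x, h) = sup_{η ∈ ℍ, η ≥ h} Û_n(x, η)`. -/
def UhatStar (p : ℝ) (F : Family) (M : (Fin d → ℝ) → (Fin d → ℝ) → ℝ) {n : ℕ}
    (Z : Fin n → Fin d → ℝ) (x h : Fin d → ℝ) : ℝ≥0∞ :=
  ⨆ η ∈ {η ∈ F.bandwidths d | h ≤ η}, ENNReal.ofReal (S.Uhat p M Z x η)

/-- The criterion `R̂_h(x) + 8 Û*_n(x, h)` that the selection rule minimizes over `h ∈ ℍ`. -/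
def criterion (p : ℝ) (F : Family) (M : (Fin d → ℝ) → (Fin d → ℝ) → ℝ) {n : ℕ}
    (Z : Fin n → Fin d → ℝ) (x h : Fin d → ℝ) : ℝ≥0∞ :=
  S.Rhat p F M Z x h + 8 * S.UhatStar p F M Z x h

/-- The measurable data-driven bandwidth `sel Z x` in `ℍ` minimizes the criterion at every point
`x` up to the tolerance `τ x`. For `τ = 0` it is an exact minimizer; the infimum over the infinite
set `ℍ` need not be attained, whereas for `τ > 0` such a bandwidth always exists. -/
structure IsSelection (p : ℝ) (F : Family) (M : (Fin d → ℝ) → (Fin d → ℝ) → ℝ) {n : ℕ}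
    (τ : (Fin d → ℝ) → ℝ) (sel : (Fin n → Fin d → ℝ) → (Fin d → ℝ) → (Fin d → ℝ)) : Prop where
  measurable : Measurable fun w : (Fin n → Fin d → ℝ) × (Fin d → ℝ) => sel w.1 w.2
  mem : ∀ Z x, sel Z x ∈ F.bandwidths d
  minimizes : ∀ Z x, S.criterion p F M Z x (sel Z x)
    ≤ (⨅ h ∈ F.bandwidths d, S.criterion p F M Z x h) + ENNReal.ofReal (τ x)

/-- The smoothed function `S_h(x, f) = ∫ K_h(t - x) f(t) dt`. -/
def smooth (f : (Fin d → ℝ) → ℝ) (h x : Fin d → ℝ) : ℝ := ∫ t, S.scaledK h (t - x) * f t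

/-- `B*_h(x, f) = sup_{η ∈ ℍ} |S_{h ∨ η}(x, f) - S_η(x, f)|`. -/
def biasStar (F : Family) (f : (Fin d → ℝ) → ℝ) (h x : Fin d → ℝ) : ℝ≥0∞ :=
  ⨆ η ∈ F.bandwidths d, ENNReal.ofReal |S.smooth f (h ⊔ η) x - S.smooth f η x|

/-- `B_h(x, f) = |S_h(x, f) - f(x)|`. -/
def bias (f : (Fin d → ℝ) → ℝ) (h x : Fin d → ℝ) : ℝ≥0∞ :=
  ENNReal.ofReal |S.smooth f h x - f x|

/-- `ℬ_h(x, f) = 2 B*_h(x, f) + B_h(x, f)`. -/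
def totalBias (F : Family) (f : (Fin d → ℝ) → ℝ) (h x : Fin d → ℝ) : ℝ≥0∞ :=
  2 * S.biasStar F f h x + S.bias f h x

/-- The level set `𝒜(h, f, v) = {x : ℬ_h(x, f) ≥ v / 2}`. -/
def levelSet (F : Family) (f : (Fin d → ℝ) → ℝ) (h : Fin d → ℝ) (v : ℝ) : Set (Fin d → ℝ) :=
  {x | ENNReal.ofReal (v / 2) ≤ S.totalBias F f h x}

/-- The quantity `F_n(h)`. -/
def Fn (n : ℕ) (h : Fin d → ℝ) : ℝ :=
  √(Real.log n + ∑ j, |Real.log (h j)|) /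
    (√n * ∏ j, h j ^ (1 / 2 : ℝ) * min (h j) 1 ^ S.lam j)

/-- The quantity `G_n(h)`. -/
def Gn (n : ℕ) (h : Fin d → ℝ) : ℝ :=
  (Real.log n + ∑ j, |Real.log (h j)|) / (n * ∏ j, h j * min (h j) 1 ^ S.lam j)

/-- `c₁ = M_2 √(2D)`. -/
def c₁ (D : ℝ) : ℝ := S.Mtwo * √(2 * D)

/-- `c₂ = 4 M_∞ / 3`. -/
def c₂ : ℝ := 4 * S.Minf / 3

/-- `c₃ = 2 max {4 ln M_∞, (8p + 26) maxⱼ (1 + λⱼ(α))}`. -/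
def c₃ (p : ℝ) : ℝ := 2 * max (4 * Real.log S.Minf) ((8 * p + 26) * ⨆ j, (1 + S.lam j))

/-- The constant `a = (196 [(c₁ √c₃) ∨ (c₂ c₃)])⁻¹`. -/
def a (p D : ℝ) : ℝ := (196 * max (S.c₁ D * √(S.c₃ p)) (S.c₂ * S.c₃ p))⁻¹

/-- `ℌ(v) = {h ∈ ℍ : G_n(h) ≤ a v}`. -/
def hSet (p D : ℝ) (F : Family) (n : ℕ) (v : ℝ) : Set (Fin d → ℝ) :=
  {h ∈ F.bandwidths d | S.Gn n h ≤ S.a p D * v}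

/-- `ℌ(v, z) = {h ∈ ℌ(v) : F_n(h) ≤ a v z^{-1/2}}`. -/
def hSetZ (p D : ℝ) (F : Family) (n : ℕ) (v z : ℝ) : Set (Fin d → ℝ) :=
  {h ∈ S.hSet p D F n v | S.Fn n h ≤ S.a p D * v * z ^ (-(1 / 2) : ℝ)}

end Model

/-- `z^{-u}` for `z ≥ 2` and an exponent `u ∈ [1, ∞]`, with `z^{-∞} = 0`. -/
def negPow (z : ℝ) (u : ℝ≥0∞) : ℝ≥0∞ :=
  if u = ∞ then 0 else ENNReal.ofReal (z ^ (-u.toReal))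

namespace Model

variable {d : ℕ} (S : Model d)

/-- `Λ(v, f) = inf_{h ∈ ℌ(v)} [ν_d(𝒜(h, f, v)) + v⁻² F_n²(h)]`. -/
def Lam (p D : ℝ) (F : Family) (n : ℕ) (f : (Fin d → ℝ) → ℝ) (v : ℝ) : ℝ≥0∞ :=
  ⨅ h ∈ S.hSet p D F n v,
    (volume (S.levelSet F f h v) + ENNReal.ofReal ((v ^ 2)⁻¹ * S.Fn n h ^ 2))

/-- `Λ(v, f, u) = inf_{z ≥ 2} inf_{h ∈ ℌ(v, z)} [ν_d(𝒜(h, f, v)) + z^{-u}]`. -/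
def LamU (p D : ℝ) (F : Family) (n : ℕ) (f : (Fin d → ℝ) → ℝ) (u : ℝ≥0∞) (v : ℝ) : ℝ≥0∞ :=
  ⨅ z ∈ Set.Ici (2 : ℝ), ⨅ h ∈ S.hSetZ p D F n v z,
    (volume (S.levelSet F f h v) + negPow z u)

/-- `Λ_p(v, f, u) = inf_{z ≥ 2} inf_{h ∈ ℌ(v, z)} [∫_{𝒜(h, f, v)} ℬ_h(x, f)^p dx + v^p z^{-u}]`. -/
def LamP (p D : ℝ) (F : Family) (n : ℕ) (f : (Fin d → ℝ) → ℝ) (u : ℝ≥0∞) (v : ℝ) : ℝ≥0∞ :=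
  ⨅ z ∈ Set.Ici (2 : ℝ), ⨅ h ∈ S.hSetZ p D F n v z,
    ((∫⁻ x in S.levelSet F f h v, S.totalBias F f h x ^ p) + ENNReal.ofReal (v ^ p) * negPow z u)

end Model

end ConvModel

end

/-! The error splits into a stochastic part, of order n^{-1/2} in L_p uniformly over f, and a
deterministic oracle error, which is integrated level by level.

The function M(·,h) solves the adjoint of the equation linking f to the density of the observations,
so f̂_h(x) is an average of i.i.d. terms with mean S_h(x,f) (`IsSolution.integral_mul_obsDensity`).
On the Fourier side M(·,h) is the transform of K_h divided by the symbol 1-α+αǧ, taken at the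
reflected frequency. The lower bound on the symbol controls the sup norm and the L_2 norm of M(·,h)
(`IsSolution.bounds`).

Bernstein's inequality is needed at all x and all h simultaneously, so its error must be integrable
in x and summable in h. Integrability holds because the moment form `lintegral_bernstein_excess_le`
keeps the variance as a factor, and the second moment of M(Z-x,h) integrates over x to ‖M(·,h)‖_2².
Summability comes from λ_n(h), whose exponential beats every power of h that occurs. The events on
which empirical and true second moments are not comparable are treated alike. The outcome is
`lintegral_noise_rpow_le`, with a constant free of f, R, D, q and u.

Deterministically, the selection rule gives at every point (`ofReal_abs_fhat_sub_le_oracle`): error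
≤ inf_h [ℬ_h + 60 U*_h] + 65 noise + τ, where U* is the majorant with the true second moment in
place of the empirical one. The infimum is taken pointwise in x, so in the layer-cake formula for
its p-th power the bandwidth may change with the level v: for each h, the set where the infimum
exceeds K₀v lies in {ℬ_h > v} ∪ {U*_h > c₀v}.

Levels below v̲: letting h → ∞ removes U*, and the oracle error is at most a maximal function of f
plus |f|. A weak-type inequality for the maximal function, with d-1 logarithms for boxes and none
for cubes, produces l_ℍ(v̲).

Levels between v̲ and v̄: Markov's inequality bounds the measure of {U*_h > c₀v} by a multiple of
F_n²(h)/v², the sum over η ≥ h being geometric (`measure_lt_UStar_le`). If F_n(h) ≤ avz^{-1/2}, the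
part of the density below a multiple of z cannot push U* over the level; the rest has mass
O(z^{1-u}), and Markov's inequality then gives O(z^{-u}) (`measure_lt_UStar_le_negPow`).

Levels t above v̄: a pair (h,z) admissible at v̄ is admissible at t with z(t/v̄)² in place of z. The
resulting tail (t/v̄)^{-2u} is integrable against t^{p-1} because 2u > p. -/

noncomputable section

/-! ### L_2 Fourier transform of a solution of the operator equation -/

section Fourier

open FourierTransform SchwartzMap
open scoped ContDiff

variable {V : Type*} [NormedAddCommGroup V] [InnerProductSpace ℝ V] [FiniteDimensional ℝ V]
  [MeasurableSpace V] [BorelSpace V]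

/-- The L_2 transform agrees with the transform of tempered distributions, which is defined by this
duality. All later computations with the L_2 transform go through this identity. -/
theorem integral_schwartz_mul_fourier_toLp {m : V → ℂ} (hm : MemLp m 2 volume) (φ : 𝓢(V, ℂ)) :
    ∫ w, φ w * (𝓕 (hm.toLp m) : Lp ℂ 2 (volume : Measure V)) w = ∫ t, (𝓕 φ : 𝓢(V, ℂ)) t * m t := by
  have h := congrArg (fun T => T φ) (Lp.fourier_toTemperedDistribution_eq (hm.toLp m))
  simp only [TemperedDistribution.fourier_apply, Lp.toTemperedDistribution_apply] at h
  simp only [smul_eq_mul] at h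
  rw [← h]
  refine integral_congr_ae ?_
  filter_upwards [hm.coeFn_toLp] with t ht
  rw [ht]

/-- Fubini hypothesis for the correlation with g: Cauchy–Schwarz bounds the inner integral by
‖ψ‖_2‖m‖_2 uniformly in the shift, and g is integrable. -/
theorem integrable_mul_translate {g ψ m : V → ℂ} (hg : Integrable g volume)
    (hψ : MemLp ψ 2 volume) (hm : MemLp m 2 volume) (hmm : Measurable m) :
    Integrable (fun q : V × V => g q.1 * (ψ q.2 * m (q.2 + q.1))) (volume.prod volume) := by
  have hmeas : AEStronglyMeasurable (fun q : V × V => g q.1 * (ψ q.2 * m (q.2 + q.1)))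
      (volume.prod volume) := by
    refine hg.aestronglyMeasurable.comp_fst.mul (hψ.aestronglyMeasurable.comp_snd.mul ?_)
    exact (hmm.comp (by fun_prop)).aestronglyMeasurable
  have hs : ∀ s : V, MemLp (fun y => m (y + s)) 2 volume := fun s =>
    hm.comp_measurePreserving (measurePreserving_add_right volume s)
  rw [integrable_prod_iff hmeas]
  constructor
  · refine Filter.Eventually.of_forall fun s => ?_
    exact (hψ.integrable_mul (hs s)).const_mul (g s)
  · have hb : Integrable (fun s => ‖g s‖ * ((eLpNorm ψ 2 volume).toReal * (eLpNorm m 2 volume).toReal))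
        volume := hg.norm.mul_const _
    refine hb.mono hmeas.norm.integral_prod_right' ?_
    refine Filter.Eventually.of_forall fun s => ?_
    rw [Real.norm_of_nonneg (by positivity), Real.norm_of_nonneg (by positivity)]
    simp only [norm_mul]
    rw [integral_const_mul]
    refine mul_le_mul_of_nonneg_left ?_ (norm_nonneg _)
    have h1 : ∫ y, ‖ψ y‖ * ‖m (y + s)‖ = (∫⁻ y, ‖ψ y * m (y + s)‖ₑ).toReal := by
      rw [← integral_norm_eq_lintegral_enorm]
      · simp
      · exact hψ.aestronglyMeasurable.mul (hs s).aestronglyMeasurable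
    rw [h1, ← ENNReal.toReal_mul]
    refine ENNReal.toReal_mono (ENNReal.mul_ne_top hψ.2.ne hm.2.ne) ?_
    have h2 := eLpNorm_smul_le_mul_eLpNorm (p := 2) (q := 2) (r := 1) (hs s).aestronglyMeasurable
      hψ.aestronglyMeasurable (φ := ψ)
    rw [eLpNorm_one_eq_lintegral_enorm] at h2
    have h3 : eLpNorm (fun y => m (y + s)) 2 volume = eLpNorm m 2 volume :=
      eLpNorm_comp_measurePreserving hm.aestronglyMeasurable (measurePreserving_add_right volume s)
    rw [h3] at h2
    exact h2

theorem fourier_modulate (φ : V → ℂ) (s t : V) :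
    𝓕 (fun w => φ w * Complex.exp (2 * Real.pi * inner ℝ s w * Complex.I)) t = 𝓕 φ (t - s) := by
  rw [Real.fourier_eq', Real.fourier_eq']
  refine integral_congr_ae (Filter.Eventually.of_forall fun w => ?_)
  simp only [smul_eq_mul]
  rw [inner_sub_right, real_inner_comm w s, mul_comm (φ w), ← mul_assoc, ← Complex.exp_add]
  congr 2
  push_cast
  ring

theorem fourier_neg_apply (g : V → ℂ) (w : V) :
    𝓕 g (-w) = ∫ s, g s * Complex.exp (2 * Real.pi * inner ℝ s w * Complex.I) := by
  rw [Real.fourier_eq']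
  refine integral_congr_ae (Filter.Eventually.of_forall fun s => ?_)
  simp only [smul_eq_mul]
  rw [mul_comm, inner_neg_right]
  push_cast
  congr 2
  ring

/-- The factor 𝓕g(-w) is a superposition of characters. A character times a test function φ is again
a test function, whose transform is a translate of 𝓕φ, so duality applies for each shift s;
integrating against g(s) gives the correlation of g and m. -/
theorem integral_mul_fourier_toLp_mul_fourier_neg {g m : V → ℂ} (hg : Integrable g volume)
    (hm : MemLp m 2 volume) (hmm : Measurable m) {φ : V → ℂ} (hφ : ContDiff ℝ ∞ φ)
    (hφs : HasCompactSupport φ) :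
    ∫ w, φ w * ((𝓕 (hm.toLp m) : Lp ℂ 2 (volume : Measure V)) w * 𝓕 g (-w))
      = ∫ y, 𝓕 φ y * ∫ t, g (t - y) * m t := by
  set mh : V → ℂ := ((𝓕 (hm.toLp m) : Lp ℂ 2 (volume : Measure V)) : V → ℂ) with hmh
  have hmhL : MemLp mh 2 volume := Lp.memLp _
  have hφL : MemLp φ 2 volume := hφ.continuous.memLp_of_hasCompactSupport hφs
  have hprod : Integrable (fun w => φ w * mh w) volume := hφL.integrable_mul hmhL
  have hmod : ∀ s : V, ∫ w, φ w * mh w * Complex.exp (2 * Real.pi * inner ℝ s w * Complex.I)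
      = ∫ t, 𝓕 φ (t - s) * m t := by
    intro s
    have hs1 : ContDiff ℝ ∞
        (fun w => φ w * Complex.exp (2 * Real.pi * inner ℝ s w * Complex.I)) := by
      refine hφ.mul (ContDiff.cexp ?_)
      have h0 : ContDiff ℝ ∞ (fun w : V => ((inner ℝ s w : ℝ) : ℂ)) :=
        Complex.ofRealCLM.contDiff.comp (contDiff_const.inner ℝ contDiff_id)
      exact (contDiff_const.mul h0).mul contDiff_const
    have hs2 : HasCompactSupport
        (fun w => φ w * Complex.exp (2 * Real.pi * inner ℝ s w * Complex.I)) := hφs.mul_right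
    have h := integral_schwartz_mul_fourier_toLp hm (hs2.toSchwartzMap hs1)
    rw [fourier_coe] at h
    have hco : (hs2.toSchwartzMap hs1 : V → ℂ)
      = fun w => φ w * Complex.exp (2 * Real.pi * inner ℝ s w * Complex.I) := rfl
    rw [hco] at h
    rw [← hmh] at h
    have e1 : ∀ t, 𝓕 (fun w => φ w * Complex.exp (2 * Real.pi * inner ℝ s w * Complex.I)) t
      = 𝓕 φ (t - s) := fourier_modulate φ s
    simp only [e1] at h
    rw [← h]
    congr 1 with w
    ring
  have hexp : AEStronglyMeasurable (fun q : V × V =>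
      Complex.exp (2 * Real.pi * inner ℝ q.2 q.1 * Complex.I)) (volume.prod volume) := by
    refine Continuous.aestronglyMeasurable ?_
    have : Continuous (fun q : V × V => inner ℝ q.2 q.1) := by fun_prop
    fun_prop
  have hint1 : Integrable (fun q : V × V => (φ q.1 * mh q.1 * g q.2)
      * Complex.exp (2 * Real.pi * inner ℝ q.2 q.1 * Complex.I)) (volume.prod volume) := by
    refine (hprod.mul_prod hg).mul_bdd (c := 1) hexp (Filter.Eventually.of_forall fun q => ?_)
    rw [Complex.norm_exp]
    simp
  have hψL : MemLp (𝓕 φ) 2 volume := by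
    have := (𝓕 (hφs.toSchwartzMap hφ) : 𝓢(V, ℂ)).memLp 2 volume
    rw [fourier_coe] at this
    exact this
  have hint2 := integrable_mul_translate hg hψL hm hmm
  calc ∫ w, φ w * (mh w * 𝓕 g (-w))
      = ∫ w, ∫ s, (φ w * mh w * g s) * Complex.exp (2 * Real.pi * inner ℝ s w * Complex.I) := by
        congr 1 with w
        rw [fourier_neg_apply, ← mul_assoc, ← integral_const_mul]
        congr 1 with s
        ring
    _ = ∫ s, ∫ w, (φ w * mh w * g s) * Complex.exp (2 * Real.pi * inner ℝ s w * Complex.I) :=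
        integral_integral_swap hint1
    _ = ∫ s, g s * ∫ t, 𝓕 φ (t - s) * m t := by
        congr 1 with s
        rw [← hmod s, ← integral_const_mul]
        congr 1 with w
        ring
    _ = ∫ s, ∫ y, g s * (𝓕 φ y * m (y + s)) := by
        congr 1 with s
        rw [← integral_add_right_eq_self _ s, ← integral_const_mul]
        simp
    _ = ∫ y, ∫ s, g s * (𝓕 φ y * m (y + s)) := integral_integral_swap hint2
    _ = ∫ y, 𝓕 φ y * ∫ t, g (t - y) * m t := by
        congr 1 with y
        rw [← integral_add_right_eq_self (fun t => g (t - y) * m t) y, ← integral_const_mul]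
        congr 1 with s
        simp only [add_sub_cancel_right, add_comm y s]
        ring

/-- Both sides are locally integrable, so it is enough to integrate them against smooth compactly
supported φ. By duality this becomes the equation for m integrated against 𝓕φ. The frequency is
reflected because g(t - y) enters as a correlation and not as a convolution. -/
theorem fourier_toLp_mul_symbol {g m k : V → ℂ} (hg : Integrable g volume)
    (hm : MemLp m 2 volume) (hmm : Measurable m) (hk : Integrable k volume) (a b : ℂ)
    (heq : ∀ y, k y = a * m y + b * ∫ t, g (t - y) * m t) :
    ∀ᵐ w, (𝓕 (hm.toLp m) : Lp ℂ 2 (volume : Measure V)) w * (a + b * 𝓕 g (-w)) = 𝓕 k w := by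
  set mh : V → ℂ := ((𝓕 (hm.toLp m) : Lp ℂ 2 (volume : Measure V)) : V → ℂ) with hmh
  have hmhL : MemLp mh 2 volume := Lp.memLp _
  have hgc : Continuous (𝓕 g) :=
    VectorFourier.fourierIntegral_continuous Real.continuous_fourierChar
      (by exact continuous_inner) hg
  have hkc : Continuous (𝓕 k) :=
    VectorFourier.fourierIntegral_continuous Real.continuous_fourierChar
      (by exact continuous_inner) hk
  have hmhloc : LocallyIntegrable mh volume := hmhL.locallyIntegrable (by norm_num)
  have hθb : ∀ w, ‖a + b * 𝓕 g (-w)‖ ≤ ‖a‖ + ‖b‖ * ∫ v, ‖g v‖ := fun w => by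
    refine (norm_add_le _ _).trans ?_
    rw [norm_mul]
    gcongr
    exact VectorFourier.norm_fourierIntegral_le_integral_norm _ _ _ _ _
  have hθL : MemLp (fun w => a + b * 𝓕 g (-w)) ∞ volume :=
    memLp_top_of_bound (by fun_prop) _ (Filter.Eventually.of_forall hθb)
  have hL : MemLp (fun w => mh w * (a + b * 𝓕 g (-w))) 2 volume := hθL.mul hmhL
  refine ae_eq_of_integral_contDiff_smul_eq (hL.locallyIntegrable (by norm_num))
    hkc.locallyIntegrable ?_
  intro φr hφr hφsr
  have hφ : ContDiff ℝ ∞ (fun w => (φr w : ℂ)) := Complex.ofRealCLM.contDiff.comp hφr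
  have hφs : HasCompactSupport (fun w => (φr w : ℂ)) := hφsr.comp_left Complex.ofReal_zero
  set φ : V → ℂ := fun w => (φr w : ℂ) with hφdef
  have hφL : MemLp φ 2 volume := hφ.continuous.memLp_of_hasCompactSupport hφs
  have hφ1 : Integrable φ volume := hφ.continuous.integrable_of_hasCompactSupport hφs
  set Φ := hφs.toSchwartzMap hφ with hΦ
  have hcoe : ((𝓕 Φ : 𝓢(V, ℂ)) : V → ℂ) = 𝓕 φ := by rw [fourier_coe]; rfl
  have hψL : MemLp (𝓕 φ) 2 volume := by
    rw [← hcoe]; exact (𝓕 Φ : 𝓢(V, ℂ)).memLp 2 volume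
  have h1 := integral_schwartz_mul_fourier_toLp hm Φ
  rw [hcoe] at h1
  have h2 := integral_mul_fourier_toLp_mul_fourier_neg hg hm hmm hφ hφs
  have hb1 : Integrable (fun w => φ w * mh w) volume := hφL.integrable_mul hmhL
  have hb2 : Integrable (fun w => φ w * (mh w * (a + b * 𝓕 g (-w)))) volume :=
    hφL.integrable_mul hL
  have hc1 : Integrable (fun y => 𝓕 φ y * m y) volume := hψL.integrable_mul hm
  have hc2 : Integrable (fun y => 𝓕 φ y * k y) volume := by
    refine hk.bdd_mul hψL.aestronglyMeasurable (c := ∫ v, ‖φ v‖) (Filter.Eventually.of_forall fun y => ?_)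
    exact VectorFourier.norm_fourierIntegral_le_integral_norm _ _ _ _ _
  have h3 : ∫ y, 𝓕 φ y * k y = ∫ y, φ y * 𝓕 k y :=
    (VectorFourier.integral_fourierIntegral_smul_eq_flip (L := innerₗ V)
      Real.continuous_fourierChar continuous_inner hφ1 hk).trans (by
        rw [flip_innerₗ]; rfl)
  have h4 : b * ∫ y, 𝓕 φ y * ∫ t, g (t - y) * m t = ∫ y, 𝓕 φ y * k y - a * (𝓕 φ y * m y) := by
    rw [← integral_const_mul]
    congr 1 with y
    rw [heq y]
    ring
  have h5 : b * ∫ w, φ w * (mh w * 𝓕 g (-w))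
      = ∫ w, φ w * (mh w * (a + b * 𝓕 g (-w))) - a * (φ w * mh w) := by
    rw [← integral_const_mul]
    congr 1 with y
    ring
  rw [← h2, h5, integral_sub hb2 (hb1.const_mul a), integral_sub hc2 (hc1.const_mul a),
    integral_const_mul, integral_const_mul, ← h1, h3] at h4
  have h6 := sub_left_injective h4
  simpa [hφdef] using h6

/-- This turns an L_1 bound on the L_2 transform into a sup-norm bound on m. It is again checked on
test functions, the duality now being applied to 𝓕⁻φ. -/
theorem ae_eq_fourierInv_of_integrable {m : V → ℂ} (hm : MemLp m 2 volume)
    (hi : Integrable (𝓕 (hm.toLp m) : Lp ℂ 2 (volume : Measure V)) volume) :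
    ∀ᵐ t, m t = 𝓕⁻ ((𝓕 (hm.toLp m) : Lp ℂ 2 (volume : Measure V)) : V → ℂ) t := by
  set mh : V → ℂ := ((𝓕 (hm.toLp m) : Lp ℂ 2 (volume : Measure V)) : V → ℂ) with hmh
  have hc : Continuous (𝓕⁻ mh) := by
    have : Continuous (𝓕 mh) := VectorFourier.fourierIntegral_continuous Real.continuous_fourierChar
      (by exact continuous_inner) hi
    have e : 𝓕⁻ mh = fun t => 𝓕 mh (-t) := by
      ext t; exact Real.fourierInv_eq_fourier_neg mh t
    rw [e]
    exact this.comp continuous_neg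
  refine ae_eq_of_integral_contDiff_smul_eq (hm.locallyIntegrable (by norm_num))
    hc.locallyIntegrable ?_
  intro φr hφr hφsr
  have hφ : ContDiff ℝ ∞ (fun w => (φr w : ℂ)) := Complex.ofRealCLM.contDiff.comp hφr
  have hφs : HasCompactSupport (fun w => (φr w : ℂ)) := hφsr.comp_left Complex.ofReal_zero
  set φ : V → ℂ := fun w => (φr w : ℂ) with hφdef
  have hφ1 : Integrable φ volume := hφ.continuous.integrable_of_hasCompactSupport hφs
  set Φ := hφs.toSchwartzMap hφ with hΦ
  have hcoe : ((𝓕⁻ Φ : 𝓢(V, ℂ)) : V → ℂ) = 𝓕⁻ φ := by rw [fourierInv_coe]; rfl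
  have h1 := integral_schwartz_mul_fourier_toLp hm (𝓕⁻ Φ : 𝓢(V, ℂ))
  rw [hcoe, fourier_fourierInv_eq] at h1
  have h3 : ∫ y, 𝓕 (fun x => φ (-x)) y * mh y = ∫ y, φ (-y) * 𝓕 mh y :=
    (VectorFourier.integral_fourierIntegral_smul_eq_flip (L := innerₗ V)
      Real.continuous_fourierChar continuous_inner hφ1.comp_neg hi).trans (by
        rw [flip_innerₗ]; rfl)
  have h4 : ∫ y, φ (-y) * 𝓕 mh y = ∫ y, φ y * 𝓕⁻ mh y := by
    rw [← integral_neg_eq_self]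
    congr 1 with y
    rw [Real.fourierInv_eq_fourier_neg, neg_neg]
  have h5 : ∀ y, 𝓕⁻ φ y = 𝓕 (fun x => φ (-x)) y := fun y => by
    rw [Real.fourierInv_eq_fourier_comp_neg]
  simp only [h5] at h1
  rw [h3, h4] at h1
  have h6 : ∀ t, Φ t = φ t := fun _ => rfl
  simp only [h6] at h1
  simpa [hφdef] using h1.symm

end Fourier
end

/-! ### Diagonal changes of variables -/

noncomputable section

theorem map_mul_volume_pi {d : ℕ} (c : Fin d → ℝ) (hc : ∀ j, 0 < c j) :
    Measure.map (fun t : Fin d → ℝ => fun j => c j * t j) volume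
      = ENNReal.ofReal (∏ j, c j)⁻¹ • volume := by
  have hdet : (Matrix.diagonal c).det ≠ 0 := by
    rw [Matrix.det_diagonal]; exact (Finset.prod_pos fun j _ => hc j).ne'
  have h := Real.map_matrix_volume_pi_eq_smul_volume_pi hdet
  rw [Matrix.det_diagonal, abs_of_pos (inv_pos.2 (Finset.prod_pos fun j _ => hc j))] at h
  rw [← h]
  congr 1
  ext t j
  simp [Matrix.toLin'_apply, Matrix.mulVec_diagonal]

theorem measurableEmbedding_mul_pi {d : ℕ} (c : Fin d → ℝ) (hc : ∀ j, 0 < c j) :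
    MeasurableEmbedding (fun t : Fin d → ℝ => fun j => c j * t j) :=
  (Homeomorph.piCongrRight fun j => Homeomorph.mulLeft₀ (c j) (hc j).ne').measurableEmbedding

theorem lintegral_comp_mul_pi {d : ℕ} (c : Fin d → ℝ) (hc : ∀ j, 0 < c j)
    (F : (Fin d → ℝ) → ℝ≥0∞) :
    ∫⁻ t : Fin d → ℝ, F (fun j => c j * t j) = ENNReal.ofReal (∏ j, c j)⁻¹ * ∫⁻ t, F t := by
  rw [← (measurableEmbedding_mul_pi c hc).lintegral_map, map_mul_volume_pi c hc,
    lintegral_smul_measure, smul_eq_mul]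

theorem integral_comp_mul_pi {d : ℕ} {E : Type*} [NormedAddCommGroup E] [NormedSpace ℝ E]
    (c : Fin d → ℝ) (hc : ∀ j, 0 < c j) (F : (Fin d → ℝ) → E) :
    ∫ t : Fin d → ℝ, F (fun j => c j * t j) = (∏ j, c j)⁻¹ • ∫ t, F t := by
  rw [← (measurableEmbedding_mul_pi c hc).integral_map, map_mul_volume_pi c hc,
    integral_smul_measure,
    ENNReal.toReal_ofReal (inv_nonneg.2 (Finset.prod_nonneg fun j _ => (hc j).le))]

theorem integrable_comp_mul_pi {d : ℕ} {E : Type*} [NormedAddCommGroup E]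
    (c : Fin d → ℝ) (hc : ∀ j, 0 < c j) {F : (Fin d → ℝ) → E} (hF : Integrable F volume) :
    Integrable (fun t : Fin d → ℝ => F (fun j => c j * t j)) volume := by
  have := (measurableEmbedding_mul_pi c hc).integrable_map_iff (μ := volume) (g := F)
  rw [map_mul_volume_pi c hc] at this
  exact this.1 (hF.smul_measure ENNReal.ofReal_ne_top)

/-! ### Bounds on the solutions M(·, h) -/

namespace ConvModel

section FourierFacts

open FourierTransform WithLp

variable {d : ℕ}

/-- Dictionary between the probabilistic convention on `Fin d → ℝ`, which carries the sup norm, and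
the transform with frequency 2πw on an inner product space, where Plancherel's theorem applies. -/
theorem fourier_euclidean (U : (Fin d → ℝ) → ℝ) (w : EuclideanSpace ℝ (Fin d)) :
    𝓕 (fun v : EuclideanSpace ℝ (Fin d) => (U (ofLp v) : ℂ)) w
      = fourier U (fun j => 2 * Real.pi * w j) := by
  rw [Real.fourier_eq', fourier, ← (PiLp.volume_preserving_ofLp (Fin d)).integral_comp
    (MeasurableEquiv.toLp 2 (Fin d → ℝ)).symm.measurableEmbedding]
  congr 1 with v
  rw [smul_eq_mul, mul_comm]
  congr 2
  rw [PiLp.inner_apply]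
  push_cast
  simp only [RCLike.inner_apply, conj_trivial, Finset.mul_sum, Finset.sum_mul]
  refine Finset.sum_congr rfl fun j _ => ?_
  push_cast
  ring

theorem continuous_fourier {U : (Fin d → ℝ) → ℝ} (hU : Integrable U volume) :
    Continuous (fourier U) := by
  have hU' : Integrable (fun v : EuclideanSpace ℝ (Fin d) => (U (ofLp v) : ℂ)) volume :=
    ((PiLp.volume_preserving_ofLp (Fin d)).integrable_comp_of_integrable hU).ofReal
  have h1 : Continuous (𝓕 (fun v : EuclideanSpace ℝ (Fin d) => (U (ofLp v) : ℂ))) :=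
    VectorFourier.fourierIntegral_continuous Real.continuous_fourierChar
      (by exact continuous_inner) hU'
  have h2 : fourier U = fun t => 𝓕 (fun v : EuclideanSpace ℝ (Fin d) => (U (ofLp v) : ℂ))
      (toLp 2 (fun j => (2 * Real.pi)⁻¹ * t j)) := by
    ext t
    rw [fourier_euclidean]
    congr 1 with j
    simp [← mul_assoc, Real.pi_ne_zero]
  rw [h2]
  exact h1.comp ((PiLp.continuous_toLp 2 _).comp (by fun_prop))

end FourierFacts

namespace Model

variable {d : ℕ} (S : Model d)

/-- The normalizing product `∏ⱼ hⱼ (hⱼ ∧ 1)^{λⱼ}`. -/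
def wt (h : Fin d → ℝ) : ℝ := ∏ j, h j * min (h j) 1 ^ S.lam j

/-- The normalizing product `∏ⱼ hⱼ (hⱼ ∧ 1)^{2 λⱼ}`. -/
def wtSq (h : Fin d → ℝ) : ℝ := ∏ j, h j * (min (h j) 1 ^ S.lam j) ^ 2

/-- The inverse of the constant in the lower bound on the symbol of the operator. -/
def invLower : ℝ := if S.α = 1 then S.Υ₀⁻¹ else S.ε⁻¹

/-- The constant in the bound on the `L₂` norm of solutions. -/
def solConst : ℝ := (2 * Real.pi) ^ (-(d : ℝ)) * S.invLower ^ 2 * S.k₂ ^ 2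

variable {S}

theorem lam_nonneg (hnoise : S.NoiseAssumption) (j : Fin d) : 0 ≤ S.lam j := by
  rw [lam]
  split_ifs with h
  · exact ((hnoise.2 h).1 j).le
  · exact le_rfl

theorem wt_pos {h : Fin d → ℝ} (hh : ∀ j, 0 < h j) : 0 < S.wt h :=
  Finset.prod_pos fun j _ => mul_pos (hh j) (Real.rpow_pos_of_pos (lt_min (hh j) one_pos) _)

theorem wtSq_pos {h : Fin d → ℝ} (hh : ∀ j, 0 < h j) : 0 < S.wtSq h :=
  Finset.prod_pos fun j _ => mul_pos (hh j)
    (pow_pos (Real.rpow_pos_of_pos (lt_min (hh j) one_pos) _) 2)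

theorem invLower_pos (hnoise : S.NoiseAssumption) : 0 < S.invLower := by
  rw [invLower]
  split_ifs with h
  · exact inv_pos.2 (hnoise.2 h).2.1
  · exact inv_pos.2 (hnoise.1 h).1

theorem solConst_pos (hnoise : S.NoiseAssumption) (hkernel : S.KernelAssumption) :
    0 < S.solConst := by
  have := invLower_pos hnoise
  have := hkernel.2.1
  have := Real.pi_pos
  rw [solConst]
  positivity

/-- This merges the two noise assumptions: for α ≠ 1 all λⱼ vanish and the product is 1, so the
single constant `invLower` serves both cases. -/
theorem inv_symbol_le (hnoise : S.NoiseAssumption) (t : Fin d → ℝ) :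
    0 < ‖((1 - S.α : ℝ) : ℂ) + ((S.α : ℝ) : ℂ) * fourier S.g t‖ ∧
    ‖((1 - S.α : ℝ) : ℂ) + ((S.α : ℝ) : ℂ) * fourier S.g t‖⁻¹
      ≤ S.invLower * ∏ j, (1 + t j ^ 2) ^ (S.lam j / 2) := by
  by_cases h : S.α = 1
  · have h1 := (hnoise.2 h).2.2 t
    have h0 := (hnoise.2 h).2.1
    have hp : 0 < ∏ j, (1 + t j ^ 2) ^ (-(S.μ j) / 2) :=
      Finset.prod_pos fun j _ => Real.rpow_pos_of_pos (by positivity) _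
    have e : ∏ j, (1 + t j ^ 2) ^ (S.lam j / 2) = (∏ j, (1 + t j ^ 2) ^ (-(S.μ j) / 2))⁻¹ := by
      rw [← Finset.prod_inv_distrib]
      refine Finset.prod_congr rfl fun j _ => ?_
      rw [← Real.rpow_neg (by positivity), lam, if_pos h]
      congr 1
      ring
    simp only [h, sub_self, Complex.ofReal_zero, Complex.ofReal_one, zero_add, one_mul]
    refine ⟨lt_of_lt_of_le (mul_pos h0 hp) h1, ?_⟩
    rw [e, invLower, if_pos h, ← mul_inv]
    exact inv_anti₀ (mul_pos h0 hp) h1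
  · have h1 := (hnoise.1 h).2 t
    have h0 := (hnoise.1 h).1
    refine ⟨lt_of_lt_of_le h0 h1, ?_⟩
    simp only [lam, invLower, if_neg h, zero_div, Real.rpow_zero, Finset.prod_const_one, mul_one]
    exact inv_anti₀ h0 h1

theorem fourier_scaledK {h : Fin d → ℝ} (hh : ∀ j, 0 < h j) (t : Fin d → ℝ) :
    fourier (S.scaledK h) t = fourier S.K (fun j => h j * t j) := by
  have hp : (∏ j, h j) ≠ 0 := (Finset.prod_pos fun j _ => hh j).ne'
  have h1 := integral_comp_mul_pi (fun j => (h j)⁻¹) (fun j => inv_pos.2 (hh j))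
    (fun y => ((S.K y : ℝ) : ℂ) * Complex.exp (-Complex.I * ((∑ j, y j * (h j * t j) : ℝ) : ℂ)))
  simp only [Finset.prod_inv_distrib, inv_inv, ← div_eq_inv_mul] at h1
  have h2 : ∀ x : Fin d → ℝ, ∑ j, x j / h j * (h j * t j) = ∑ j, x j * t j := fun x =>
    Finset.sum_congr rfl fun j _ => by rw [← mul_assoc, div_mul_cancel₀ _ (hh j).ne']
  simp only [h2] at h1
  unfold fourier
  simp only [scaledK, Complex.ofReal_mul, mul_assoc]
  rw [integral_const_mul, h1, Complex.real_smul, ← mul_assoc, ← Complex.ofReal_mul,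
    inv_mul_cancel₀ hp, Complex.ofReal_one, one_mul]

theorem integrable_scaledK (hKint : Integrable S.K volume) {h : Fin d → ℝ} (hh : ∀ j, 0 < h j) :
    Integrable (S.scaledK h) volume := by
  have := (integrable_comp_mul_pi (fun j => (h j)⁻¹) (fun j => inv_pos.2 (hh j)) hKint).const_mul
    (∏ j, h j)⁻¹
  refine this.congr (Filter.Eventually.of_forall fun t => ?_)
  simp only [scaledK, div_eq_inv_mul]

/-- Coordinatewise 1 + t² ≤ (h ∧ 1)^{-2}(1 + (ht)²). This is the origin of the factors (hⱼ ∧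
1)^{λⱼ}: the polynomial weight is moved to the frequency scale of K_h. -/
theorem prod_weight_le (hnoise : S.NoiseAssumption) {h : Fin d → ℝ} (hh : ∀ j, 0 < h j)
    (t : Fin d → ℝ) :
    ∏ j, (1 + t j ^ 2) ^ (S.lam j / 2)
      ≤ (∏ j, min (h j) 1 ^ S.lam j)⁻¹ * ∏ j, (1 + (h j * t j) ^ 2) ^ (S.lam j / 2) := by
  rw [← Finset.prod_inv_distrib, ← Finset.prod_mul_distrib]
  refine Finset.prod_le_prod (fun j _ => by positivity) fun j _ => ?_
  have hm : 0 < min (h j) 1 := lt_min (hh j) one_pos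
  have e : (min (h j) 1 ^ S.lam j)⁻¹ = ((min (h j) 1 ^ 2)⁻¹) ^ (S.lam j / 2) := by
    rw [Real.inv_rpow (by positivity), ← Real.rpow_natCast, ← Real.rpow_mul hm.le]
    congr 2
    push_cast; ring
  rw [e, ← Real.mul_rpow (by positivity) (by positivity)]
  refine Real.rpow_le_rpow (by positivity) ?_ (div_nonneg (lam_nonneg hnoise j) (by norm_num))
  rw [inv_mul_eq_div, le_div_iff₀ (by positivity)]
  have h1 : min (h j) 1 ^ 2 ≤ 1 := pow_le_one₀ hm.le (min_le_right _ _)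
  have h2 : min (h j) 1 ^ 2 ≤ h j ^ 2 := pow_le_pow_left₀ hm.le (min_le_left _ _) 2
  nlinarith [sq_nonneg (t j)]


open FourierTransform WithLp in
-- Everything needed about a solution is read off its transform `m'`. The inversion formula is
-- conditional because integrability of `m'` follows only later, from the pointwise bound and the
-- first kernel condition.
theorem IsSolution.exists_fourier (hg : Integrable S.g volume) (hKint : Integrable S.K volume)
    (hnoise : S.NoiseAssumption) {h : Fin d → ℝ} (hh : ∀ j, 0 < h j) {m : (Fin d → ℝ) → ℝ}
    (hm : S.IsSolution h m) :
    ∃ m' : EuclideanSpace ℝ (Fin d) → ℂ, MemLp m' 2 volume ∧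
      (eLpNorm m' 2 volume = eLpNorm m 2 volume) ∧
      (Integrable m' volume → ∀ᵐ t, (m t : ℂ) = 𝓕⁻ m' (toLp 2 t)) ∧
      ∀ᵐ w, ‖m' w‖ ≤ S.invLower * (∏ j, min (h j) 1 ^ S.lam j)⁻¹ *
        (‖fourier S.K (fun j => h j * (2 * Real.pi * w j))‖ *
          ∏ j, (1 + (h j * (2 * Real.pi * w j)) ^ 2) ^ (S.lam j / 2)) := by
  have hmp := PiLp.volume_preserving_ofLp (Fin d)
  set me : EuclideanSpace ℝ (Fin d) → ℂ := fun v => (m (ofLp v) : ℂ) with hme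
  have hmeL : MemLp me 2 volume := (hm.memLp.comp_measurePreserving hmp).ofReal
  have hmem : Measurable me := by
    have := hm.measurable.comp hmp.measurable
    exact Complex.measurable_ofReal.comp this
  have hge : Integrable (fun v : EuclideanSpace ℝ (Fin d) => (S.g (ofLp v) : ℂ)) volume :=
    (hmp.integrable_comp_of_integrable hg).ofReal
  have hke : Integrable (fun v : EuclideanSpace ℝ (Fin d) => (S.scaledK h (ofLp v) : ℂ)) volume :=
    (hmp.integrable_comp_of_integrable (integrable_scaledK hKint hh)).ofReal
  refine ⟨((𝓕 (hmeL.toLp me) : Lp ℂ 2 (volume : Measure (EuclideanSpace ℝ (Fin d)))) :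
    EuclideanSpace ℝ (Fin d) → ℂ), Lp.memLp _, ?_, ?_, ?_⟩
  · have h1 := Lp.norm_fourier_eq (hmeL.toLp me)
    rw [Lp.norm_def, Lp.norm_def, ENNReal.toReal_eq_toReal_iff' (Lp.memLp _).2.ne
      (Lp.memLp _).2.ne] at h1
    rw [h1, eLpNorm_congr_ae hmeL.coeFn_toLp]
    have h2 : eLpNorm (fun v : EuclideanSpace ℝ (Fin d) => m (ofLp v)) 2 volume = eLpNorm m 2 volume :=
      eLpNorm_comp_measurePreserving hm.memLp.aestronglyMeasurable hmp
    rw [← h2]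
    refine eLpNorm_congr_norm_ae (Filter.Eventually.of_forall fun v => ?_)
    simp [hme]
  · intro hi
    have h1 := ae_eq_fourierInv_of_integrable hmeL hi
    have h2 := (PiLp.volume_preserving_toLp (Fin d)).quasiMeasurePreserving.ae h1
    filter_upwards [h2] with t ht
    exact ht
  · have h1 := fourier_toLp_mul_symbol hge hmeL hmem hke ((1 - S.α : ℝ) : ℂ) ((S.α : ℝ) : ℂ) ?_
    · filter_upwards [h1] with w hw
      rw [fourier_euclidean, fourier_euclidean, fourier_scaledK hh] at hw
      obtain ⟨hθ, hθ'⟩ := inv_symbol_le hnoise (fun j => 2 * Real.pi * (-w) j)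
      have h3 := congrArg norm hw
      rw [norm_mul] at h3
      rw [eq_div_of_mul_eq hθ.ne' h3, div_eq_mul_inv]
      have h4 : ∏ j, (1 + (2 * Real.pi * (-w) j) ^ 2) ^ (S.lam j / 2)
          = ∏ j, (1 + (2 * Real.pi * w j) ^ 2) ^ (S.lam j / 2) := by
        refine Finset.prod_congr rfl fun j _ => ?_
        congr 2
        simp
      rw [h4] at hθ'
      have h5 := prod_weight_le hnoise hh (fun j => 2 * Real.pi * w j)
      calc _ ≤ ‖fourier S.K (fun j => h j * (2 * Real.pi * w j))‖ * (S.invLower *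
            ((∏ j, min (h j) 1 ^ S.lam j)⁻¹ *
              ∏ j, (1 + (h j * (2 * Real.pi * w j)) ^ 2) ^ (S.lam j / 2))) := by
            have := (invLower_pos hnoise).le
            gcongr
            exact hθ'.trans (by gcongr)
        _ = _ := by ring
    · intro y
      have h2 := hm.equation (ofLp y)
      have h3 : ∫ t, S.g (t - ofLp y) * m t
          = ∫ t : EuclideanSpace ℝ (Fin d), S.g (ofLp (t - y)) * m (ofLp t) := by
        rw [← hmp.integral_comp (MeasurableEquiv.toLp 2 (Fin d → ℝ)).symm.measurableEmbedding]
        rfl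
      rw [h2, h3]
      push_cast
      rw [← integral_complex_ofReal]
      push_cast
      rfl

open WithLp in
theorem lintegral_euclidean_scale {h : Fin d → ℝ} (hh : ∀ j, 0 < h j)
    (F : (Fin d → ℝ) → ℝ≥0∞) :
    ∫⁻ w : EuclideanSpace ℝ (Fin d), F (fun j => h j * (2 * Real.pi * w j))
      = ENNReal.ofReal ((∏ j, h j)⁻¹ * (2 * Real.pi) ^ (-(d : ℝ))) * ∫⁻ t, F t := by
  have hmp := PiLp.volume_preserving_ofLp (Fin d)
  have h2 : 0 < 2 * Real.pi := by positivity
  have e := hmp.lintegral_comp_emb (MeasurableEquiv.toLp 2 (Fin d → ℝ)).symm.measurableEmbedding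
    (fun t => F (fun j => h j * (2 * Real.pi * t j)))
  have e' := lintegral_comp_mul_pi (fun j => h j * (2 * Real.pi))
    (fun j => mul_pos (hh j) h2) F
  simp only [mul_assoc] at e e' ⊢
  rw [e, e']
  congr 2
  rw [Finset.prod_mul_distrib, Finset.prod_const, Finset.card_univ, Fintype.card_fin, mul_inv,
    Real.rpow_neg (by positivity), Real.rpow_natCast]

theorem lintegral_kernel_le (hKint : Integrable S.K volume) (hnoise : S.NoiseAssumption)
    (hkernel : S.KernelAssumption) :
    ENNReal.ofReal ((2 * Real.pi) ^ (-(d : ℝ)) * S.invLower) *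
      ∫⁻ t, ENNReal.ofReal (‖fourier S.K t‖ * ∏ j, (1 + t j ^ 2) ^ (S.lam j / 2))
      ≤ ENNReal.ofReal S.Minf := by
  have hc := (invLower_pos hnoise).le
  have hpi : 0 ≤ (2 * Real.pi) ^ (-(d : ℝ)) := by positivity
  by_cases h : S.α = 1
  · calc _ ≤ ENNReal.ofReal ((2 * Real.pi) ^ (-(d : ℝ)) * S.invLower) * ENNReal.ofReal S.k₁ := by
          gcongr
          exact hkernel.2.2.1
      _ = ENNReal.ofReal ((2 * Real.pi) ^ (-(d : ℝ)) * (S.Υ₀⁻¹ * S.k₁)) := by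
          rw [← ENNReal.ofReal_mul (by positivity), invLower, if_pos h, mul_assoc]
      _ ≤ _ := by
          refine ENNReal.ofReal_le_ofReal ?_
          rw [Minf, if_pos h]
          exact le_max_left _ _
  · have h1 := hkernel.2.2.1
    simp only [lam, if_neg h, zero_div, Real.rpow_zero, Finset.prod_const_one, mul_one] at h1 ⊢
    -- For α ≠ 1 the weights are 1, so the kernel condition says that Ǩ is integrable. Hence the
    -- Bochner integral in `Minf` is the genuine L_1 norm and not the default value 0.
    have hi : Integrable (fun t => ‖fourier S.K t‖) volume := by
      refine ⟨(continuous_fourier hKint).norm.aestronglyMeasurable, ?_⟩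
      refine lt_of_le_of_lt (le_of_eq ?_) (h1.trans_lt ENNReal.ofReal_lt_top)
      simp [ofReal_norm]
    rw [← ofReal_integral_eq_lintegral_ofReal hi
      (Filter.Eventually.of_forall fun _ => norm_nonneg _), ← ENNReal.ofReal_mul (by positivity)]
    refine ENNReal.ofReal_le_ofReal ?_
    rw [Minf, invLower, if_neg h, if_neg h, mul_assoc]
    exact le_max_left _ _

/-- The sup norm is at most the L_1 norm of the transform, and the L_2 norm equals that of the
transform. The rescaling by h yields the products `wt` and `wtSq`. -/
theorem IsSolution.bounds (hg : Integrable S.g volume) (hKint : Integrable S.K volume)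
    (hnoise : S.NoiseAssumption) (hkernel : S.KernelAssumption) {h : Fin d → ℝ}
    (hh : ∀ j, 0 < h j) {m : (Fin d → ℝ) → ℝ} (hm : S.IsSolution h m) :
    (∀ᵐ t, |m t| ≤ S.Minf / S.wt h) ∧
    ∫⁻ t, ENNReal.ofReal (m t ^ 2) ≤ ENNReal.ofReal (S.solConst / S.wtSq h) := by
  obtain ⟨m', hm'L, hnorm, hinv, hbd⟩ := hm.exists_fourier hg hKint hnoise hh
  have hc := (invLower_pos hnoise).le
  have hpi : 0 ≤ (2 * Real.pi) ^ (-(d : ℝ)) := by positivity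
  have hP : 0 < ∏ j, h j := Finset.prod_pos fun j _ => hh j
  have hQ : 0 < ∏ j, min (h j) 1 ^ S.lam j :=
    Finset.prod_pos fun j _ => Real.rpow_pos_of_pos (lt_min (hh j) one_pos) _
  constructor
  · have h1 : ∫⁻ w, ‖m' w‖ₑ ≤ ENNReal.ofReal (S.Minf / S.wt h) := by
      calc ∫⁻ w, ‖m' w‖ₑ ≤ ∫⁻ w : EuclideanSpace ℝ (Fin d),
            ENNReal.ofReal (S.invLower * (∏ j, min (h j) 1 ^ S.lam j)⁻¹) *
            (fun s : Fin d → ℝ => ENNReal.ofReal (‖fourier S.K s‖ *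
              ∏ j, (1 + s j ^ 2) ^ (S.lam j / 2))) (fun j => h j * (2 * Real.pi * w j)) := by
            refine lintegral_mono_ae ?_
            filter_upwards [hbd] with w hw
            rw [← ENNReal.ofReal_mul (by positivity), ← ofReal_norm]
            exact ENNReal.ofReal_le_ofReal hw
        _ = ENNReal.ofReal ((S.wt h)⁻¹) *
            (ENNReal.ofReal ((2 * Real.pi) ^ (-(d : ℝ)) * S.invLower) *
              ∫⁻ t, ENNReal.ofReal (‖fourier S.K t‖ * ∏ j, (1 + t j ^ 2) ^ (S.lam j / 2))) := by
            rw [lintegral_const_mul' _ _ ENNReal.ofReal_ne_top, lintegral_euclidean_scale hh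
              (fun s : Fin d → ℝ => ENNReal.ofReal (‖fourier S.K s‖ *
                ∏ j, (1 + s j ^ 2) ^ (S.lam j / 2))),
              ← mul_assoc, ← mul_assoc, ← ENNReal.ofReal_mul (by positivity),
              ← ENNReal.ofReal_mul (inv_nonneg.2 (wt_pos hh).le)]
            congr 2
            rw [wt, Finset.prod_mul_distrib, mul_inv]
            ring
        _ ≤ ENNReal.ofReal ((S.wt h)⁻¹) * ENNReal.ofReal S.Minf := by
            gcongr
            exact lintegral_kernel_le hKint hnoise hkernel
        _ = _ := by
            rw [← ENNReal.ofReal_mul (inv_nonneg.2 (wt_pos hh).le), div_eq_inv_mul]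
    have hi : Integrable m' volume :=
      ⟨hm'L.aestronglyMeasurable, h1.trans_lt ENNReal.ofReal_lt_top⟩
    filter_upwards [hinv hi] with t ht
    have h2 : ‖(m t : ℂ)‖ ≤ ∫ w, ‖m' w‖ := by
      rw [ht, Real.fourierInv_eq_fourier_neg]
      exact VectorFourier.norm_fourierIntegral_le_integral_norm _ _ _ _ _
    rw [Complex.norm_real, Real.norm_eq_abs] at h2
    refine h2.trans ?_
    rw [integral_norm_eq_lintegral_enorm hi.aestronglyMeasurable]
    refine ENNReal.toReal_le_of_le_ofReal ?_ h1
    exact div_nonneg (zero_le_one.trans (le_max_right _ _)) (wt_pos hh).le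
  · have e1 : ∫⁻ t, ENNReal.ofReal (m t ^ 2) = ∫⁻ w, ‖m' w‖ₑ ^ 2 := by
      have h1 : ∀ (X : Type) [MeasureSpace X] (E : Type) [NormedAddCommGroup E] (f : X → E),
          eLpNorm f 2 volume ^ 2 = ∫⁻ x, ‖f x‖ₑ ^ 2 := by
        intro X _ E _ f
        have := eLpNorm_nnreal_pow_eq_lintegral (p := 2) (f := f) (μ := volume) (by norm_num)
        simpa using this
      rw [← h1, hnorm, h1]
      refine lintegral_congr fun t => ?_
      rw [← ofReal_norm, ← ENNReal.ofReal_pow (norm_nonneg _), Real.norm_eq_abs, sq_abs]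
    rw [e1]
    calc ∫⁻ w, ‖m' w‖ₑ ^ 2 ≤ ∫⁻ w : EuclideanSpace ℝ (Fin d),
            ENNReal.ofReal ((S.invLower * (∏ j, min (h j) 1 ^ S.lam j)⁻¹) ^ 2) *
            (fun s : Fin d → ℝ => ENNReal.ofReal (‖fourier S.K s‖ ^ 2 *
              ∏ j, (1 + s j ^ 2) ^ (S.lam j))) (fun j => h j * (2 * Real.pi * w j)) := by
            refine lintegral_mono_ae ?_
            filter_upwards [hbd] with w hw
            rw [← ENNReal.ofReal_mul (by positivity), ← ofReal_norm,
              ← ENNReal.ofReal_pow (norm_nonneg _)]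
            refine ENNReal.ofReal_le_ofReal ((pow_le_pow_left₀ (norm_nonneg _) hw 2).trans
              (le_of_eq ?_))
            rw [mul_pow, mul_pow (‖_‖), ← Finset.prod_pow]
            congr 2
            refine Finset.prod_congr rfl fun j _ => ?_
            rw [← Real.rpow_natCast, ← Real.rpow_mul (by positivity)]
            congr 1
            push_cast; ring
        _ = ENNReal.ofReal ((2 * Real.pi) ^ (-(d : ℝ)) * S.invLower ^ 2 * (S.wtSq h)⁻¹) *
              ∫⁻ t, ENNReal.ofReal (‖fourier S.K t‖ ^ 2 * ∏ j, (1 + t j ^ 2) ^ (S.lam j)) := by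
            rw [lintegral_const_mul' _ _ ENNReal.ofReal_ne_top, lintegral_euclidean_scale hh
              (fun s : Fin d → ℝ => ENNReal.ofReal (‖fourier S.K s‖ ^ 2 *
                ∏ j, (1 + s j ^ 2) ^ (S.lam j))),
              ← mul_assoc, ← ENNReal.ofReal_mul (by positivity)]
            congr 2
            rw [wtSq, Finset.prod_mul_distrib, mul_inv, Finset.prod_pow]
            ring
        _ ≤ ENNReal.ofReal ((2 * Real.pi) ^ (-(d : ℝ)) * S.invLower ^ 2 * (S.wtSq h)⁻¹) *
              ENNReal.ofReal (S.k₂ ^ 2) := by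
            gcongr
            exact hkernel.2.2.2
        _ = _ := by
            have := (wtSq_pos (S := S) hh).le
            rw [← ENNReal.ofReal_mul (by positivity), solConst, div_eq_mul_inv]
            congr 1
            ring

end Model
end ConvModel
end

/-! ### Unbiasedness of the kernel estimators -/

noncomputable section

namespace ConvModel
namespace Model

variable {d : ℕ} {S : Model d}

/-- Fubini moves the map f ↦ (1-α)f + α f⋆g onto M, and the operator equation at y = w - x turns the
result into K_h. The interchange needs only bounded M and integrable f, g. -/
theorem IsSolution.integral_mul_obsDensity (hg : Integrable S.g volume) {h : Fin d → ℝ}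
    {m : (Fin d → ℝ) → ℝ} (hm : S.IsSolution h m) {B : ℝ} (hB : ∀ᵐ t, |m t| ≤ B)
    {f : (Fin d → ℝ) → ℝ} (hf : Integrable f volume) (x : Fin d → ℝ) :
    ∫ t, m (t - x) * S.obsDensity f t = S.smooth f h x := by
  have hmx : ∀ᵐ t, ‖m (t - x)‖ ≤ B :=
    (measurePreserving_sub_right volume x).quasiMeasurePreserving.ae hB
  have hmm : Measurable fun t => m (t - x) := hm.measurable.comp (by fun_prop)
  have hfm : Integrable (fun t => m (t - x) * f t) volume :=
    hf.bdd_mul hmm.aestronglyMeasurable hmx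
  have hconv := hf.convolution_integrand (ContinuousLinearMap.mul ℝ ℝ) hg
  simp only [ContinuousLinearMap.mul_apply'] at hconv
  have hmx2 : ∀ᵐ q : (Fin d → ℝ) × (Fin d → ℝ) ∂volume.prod volume, ‖m (q.1 - x)‖ ≤ B :=
    Measure.quasiMeasurePreserving_fst.ae hmx
  have hprod : Integrable (fun q : (Fin d → ℝ) × (Fin d → ℝ) =>
      m (q.1 - x) * (f q.2 * S.g (q.1 - q.2))) (volume.prod volume) :=
    hconv.bdd_mul (hmm.comp measurable_fst).aestronglyMeasurable hmx2
  have hcv : ∀ t, ∫ z, f (t - z) * S.g z = ∫ w, f w * S.g (t - w) := fun t => by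
    rw [← integral_sub_left_eq_self _ volume t]
    simp
  have hin : ∀ w, ∫ t, m (t - x) * (f w * S.g (t - w)) = f w * ∫ t, S.g (t - (w - x)) * m t :=
    fun w => by
      rw [← integral_const_mul, ← integral_add_right_eq_self _ x]
      congr 1 with t
      rw [add_sub_cancel_right, show t + x - w = t - (w - x) by abel]
      ring
  have hswap := integral_integral_swap (f := fun t w => m (t - x) * (f w * S.g (t - w))) hprod
  simp only [hin] at hswap
  have hi1 : Integrable (fun t => m (t - x) * ∫ w, f w * S.g (t - w)) volume := by
    have := hprod.integral_prod_left
    simpa only [integral_const_mul] using this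
  have hi2 : Integrable (fun w => f w * ∫ t, S.g (t - (w - x)) * m t) volume := by
    have := hprod.integral_prod_right
    simpa only [hin] using this
  have hi3 : ∫ t, m (t - x) * ∫ w, f w * S.g (t - w)
      = ∫ w, f w * ∫ t, S.g (t - (w - x)) * m t := by
    rw [← hswap]
    congr 1 with t
    rw [integral_const_mul]
  have hi4 : Integrable (fun t => f t * m (t - x)) volume := by
    simpa only [mul_comm] using hfm
  calc ∫ t, m (t - x) * S.obsDensity f t
      = ∫ t, (1 - S.α) * (f t * m (t - x)) + S.α * (m (t - x) * ∫ w, f w * S.g (t - w)) := by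
        congr 1 with t
        rw [obsDensity, hcv]
        ring
    _ = ∫ w, (1 - S.α) * (f w * m (w - x)) + S.α * (f w * ∫ t, S.g (t - (w - x)) * m t) := by
        rw [integral_add (hi4.const_mul _) (hi1.const_mul _), integral_const_mul,
          integral_const_mul, hi3, ← integral_const_mul, ← integral_const_mul,
          ← integral_add (hi4.const_mul _) (hi2.const_mul _)]
    _ = S.smooth f h x := by
        rw [smooth]
        congr 1 with w
        rw [hm.equation]
        ring

end Model
end ConvModel

/-! ### Exponential inequalities with the variance as a factor -/

section Concentration

/-- Third-order Taylor remainder: the constant 2/9 is 4/(3!·3). -/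
theorem exp_le_quadratic {x s : ℝ} (hxs : |x| ≤ s) (hs : s ≤ 1) :
    Real.exp x ≤ 1 + x + x ^ 2 * (1 / 2 + 2 * s / 9) := by
  have h := Real.exp_bound (hxs.trans hs) (n := 3) (by norm_num)
  simp only [Finset.sum_range_succ, Finset.sum_range_zero] at h
  norm_num [Nat.factorial] at h
  have h1 := (abs_le.1 h).2
  have h2 : |x| ^ 3 ≤ x ^ 2 * s := by
    rw [pow_succ, sq_abs]
    exact mul_le_mul_of_nonneg_left hxs (sq_nonneg x)
  nlinarith

theorem rpow_le_rpow_mul_exp {x p : ℝ} (hx : 0 ≤ x) (hp : 0 < p) :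
    x ^ p ≤ p ^ p * Real.exp x := by
  have h1 : x ≤ p * Real.exp (x / p) := by
    have := Real.add_one_le_exp (x / p)
    have h2 : x / p ≤ Real.exp (x / p) := by linarith
    rw [div_le_iff₀ hp] at h2
    linarith
  calc x ^ p ≤ (p * Real.exp (x / p)) ^ p := Real.rpow_le_rpow hx h1 hp.le
    _ = p ^ p * Real.exp x := by
      rw [Real.mul_rpow hp.le (Real.exp_pos _).le, ← Real.exp_mul, div_mul_cancel₀ _ hp.ne']

theorem exp_sub_one_le_mul_exp (x : ℝ) : Real.exp x - 1 ≤ x * Real.exp x := by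
  have h := Real.add_one_le_exp (-x)
  have h2 : Real.exp x * Real.exp (-x) = 1 := by rw [← Real.exp_add]; simp
  nlinarith [Real.exp_pos x]

/-- The Chernoff parameter is √(2λ/V), replaced by 1 when V ≤ 2λ. The bound on s⁻¹ is recorded
because moments of the excess cost a factor s^{-p}. -/
theorem exists_bernstein_parameter {V lam N : ℝ} (hV : 0 ≤ V) (hVN : V ≤ N) (hN : 1 ≤ N)
    (hlam : 1 ≤ lam) :
    ∃ s : ℝ, 0 < s ∧ s ≤ 1 ∧ s⁻¹ ≤ √N ∧
      s ^ 2 * (1 / 2 + 2 * s / 9) * V + lam ≤ s * (√(2 * lam * V) + 4 / 3 * lam) := by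
  rcases le_or_gt V (2 * lam) with h | h
  · refine ⟨1, one_pos, le_rfl, by simpa using hN, ?_⟩
    have h1 : V ≤ √(2 * lam * V) := Real.le_sqrt_of_sq_le (by nlinarith)
    nlinarith
  · have hV0 : 0 < V := by linarith
    set s := √(2 * lam / V) with hs
    have hs0 : 0 < s := Real.sqrt_pos.2 (by positivity)
    have hs2 : s ^ 2 * V = 2 * lam := by
      rw [hs, Real.sq_sqrt (by positivity), div_mul_cancel₀ _ hV0.ne']
    have hs1 : s ≤ 1 := Real.sqrt_le_one.2 (by rw [div_le_one hV0]; exact h.le)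
    have hsq : s * √(2 * lam * V) = 2 * lam := by
      rw [hs, ← Real.sqrt_mul (by positivity)]
      rw [show 2 * lam / V * (2 * lam * V) = (2 * lam) ^ 2 by field_simp]
      exact Real.sqrt_sq (by positivity)
    refine ⟨s, hs0, hs1, ?_, ?_⟩
    · rw [hs, ← Real.sqrt_inv]
      refine Real.sqrt_le_sqrt ?_
      rw [inv_div, div_le_iff₀ (by positivity)]
      nlinarith
    · nlinarith [mul_nonneg hs0.le (zero_le_one.trans hlam)]

variable {X : Type*} [MeasurableSpace X] {P : Measure X} [IsProbabilityMeasure P] {Y : X → ℝ}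

theorem ae_pi_of_ae {ι : Type*} [Fintype ι] {q : X → Prop} (hq : ∀ᵐ x ∂P, q x) :
    ∀ᵐ Z : ι → X ∂Measure.pi (fun _ => P), ∀ i, q (Z i) :=
  Measure.ae_pi_le_pi (Filter.eventually_pi fun _ => hq)

theorem integrable_pow_of_abs_le_one (hY : Measurable Y) (hY1 : ∀ᵐ x ∂P, |Y x| ≤ 1) (k : ℕ) :
    Integrable (fun x => Y x ^ k) P := by
  refine Integrable.of_bound (hY.pow_const k).aestronglyMeasurable 1 ?_
  filter_upwards [hY1] with x hx
  rw [norm_pow, Real.norm_eq_abs]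
  exact pow_le_one₀ (abs_nonneg _) hx

theorem integral_exp_sum_le (n : ℕ) {G : X → ℝ} (hG : Measurable G) {B : ℝ}
    (hGB : ∀ᵐ x ∂P, |G x| ≤ B) {c : ℝ} (hc : ∫ x, Real.exp (G x) ∂P ≤ Real.exp c) :
    Integrable (fun Z : Fin n → X => Real.exp (∑ i, G (Z i))) (Measure.pi fun _ => P) ∧
    ∫ Z : Fin n → X, Real.exp (∑ i, G (Z i)) ∂Measure.pi (fun _ => P) ≤ Real.exp (n * c) := by
  simp only [Real.exp_sum]
  constructor
  · refine Integrable.fintype_prod (f := fun _ x => Real.exp (G x)) fun i => ?_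
    refine Integrable.of_bound hG.exp.aestronglyMeasurable (Real.exp B) ?_
    filter_upwards [hGB] with x hx
    rw [Real.norm_eq_abs, Real.abs_exp]
    exact Real.exp_le_exp.2 ((le_abs_self _).trans hx)
  · rw [integral_fintype_prod_eq_pow (fun x => Real.exp (G x)), Fintype.card_fin, Real.exp_nat_mul]
    exact pow_le_pow_left₀ (integral_nonneg fun _ => (Real.exp_pos _).le) hc n

/-- Stated with |s| ≤ t so that the parameters s and -s obey the same bound. -/
theorem integral_exp_centered_sum_le (hY : Measurable Y) (hY1 : ∀ᵐ x ∂P, |Y x| ≤ 1) (n : ℕ)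
    {s t : ℝ} (hst : |s| ≤ t) (ht : t ≤ 1) :
    Integrable (fun Z : Fin n → X => Real.exp (s * ∑ i, (Y (Z i) - ∫ x, Y x ∂P)))
      (Measure.pi fun _ => P) ∧
    ∫ Z : Fin n → X, Real.exp (s * ∑ i, (Y (Z i) - ∫ x, Y x ∂P)) ∂Measure.pi (fun _ => P)
      ≤ Real.exp (t ^ 2 * (1 / 2 + 2 * t / 9) * (n * ∫ x, Y x ^ 2 ∂P)) := by
  set e := ∫ x, Y x ∂P with he
  have hi1 : Integrable Y P := by simpa using integrable_pow_of_abs_le_one hY hY1 1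
  have hi2 := integrable_pow_of_abs_le_one hY hY1 2
  have ht0 : 0 ≤ t := (abs_nonneg s).trans hst
  have hst2 : s ^ 2 ≤ t ^ 2 := sq_le_sq.2 (by rwa [abs_of_nonneg ht0])
  have hexp : ∫ x, Real.exp (s * (Y x - e)) ∂P
      ≤ Real.exp (t ^ 2 * (1 / 2 + 2 * t / 9) * ∫ x, Y x ^ 2 ∂P) := by
    have h1 : ∫ x, Real.exp (s * Y x) ∂P
        ≤ ∫ x, 1 + s * Y x + t ^ 2 * (1 / 2 + 2 * t / 9) * Y x ^ 2 ∂P := by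
      refine integral_mono_of_nonneg (Filter.Eventually.of_forall fun _ => (Real.exp_pos _).le)
        (((integrable_const _).add (hi1.const_mul _)).add (hi2.const_mul _)) ?_
      filter_upwards [hY1] with x hx
      have h2 : |s * Y x| ≤ t := by
        rw [abs_mul]
        nlinarith [abs_nonneg s, abs_nonneg (Y x)]
      refine (exp_le_quadratic h2 ht).trans ?_
      have : (s * Y x) ^ 2 * (1 / 2 + 2 * t / 9) ≤ t ^ 2 * Y x ^ 2 * (1 / 2 + 2 * t / 9) := by
        rw [mul_pow]
        gcongr
      nlinarith
    have hadd : Integrable (fun x => 1 + s * Y x) P := (integrable_const _).add (hi1.const_mul _)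
    rw [integral_add hadd (hi2.const_mul _), integral_add (integrable_const _) (hi1.const_mul _), integral_const_mul, integral_const_mul,
      integral_const, probReal_univ, one_smul, ← he] at h1
    have h3 : ∀ x, Real.exp (s * (Y x - e)) = Real.exp (-(s * e)) * Real.exp (s * Y x) := fun x => by
      rw [← Real.exp_add]; congr 1; ring
    simp only [h3]
    rw [integral_const_mul]
    set q := t ^ 2 * (1 / 2 + 2 * t / 9) * ∫ x, Y x ^ 2 ∂P
    calc _ ≤ Real.exp (-(s * e)) * Real.exp (s * e + q) := by
          refine mul_le_mul_of_nonneg_left (h1.trans ?_) (Real.exp_pos _).le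
          have := Real.add_one_le_exp (s * e + q)
          linarith
      _ = _ := by rw [← Real.exp_add]; congr 1; ring
  have h := integral_exp_sum_le n (G := fun x => s * (Y x - e)) ((hY.sub_const _).const_mul _)
    (B := |s| * (1 + |e|)) (by
      filter_upwards [hY1] with x hx
      rw [abs_mul]
      refine mul_le_mul_of_nonneg_left ?_ (abs_nonneg _)
      exact (abs_sub _ _).trans (by linarith)) hexp
  simp only [← Finset.mul_sum] at h
  refine ⟨h.1, h.2.trans (le_of_eq ?_)⟩
  congr 1
  ring

/-- The majorant is 2cosh(sy) - 2, which vanishes at 0, so its mean will be proportional to the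
variance. Subtracting 2 is affordable because s|y| ≥ 1 gives e^{s|y|} ≥ 8/3, that is, e^{s|y|} ≤
4(e^{s|y|} - 2). -/
theorem rpow_excess_le {y u s p : ℝ} (hs : 0 < s) (hu : 1 ≤ s * u) (hp : 0 < p) (hy : u < |y|) :
    (|y| - u) ^ p ≤ 4 * (p * s⁻¹) ^ p * Real.exp (-(s * u)) *
      (Real.exp (s * y) + Real.exp (-s * y) - 2) := by
  have h1 : (s * (|y| - u)) ^ p ≤ p ^ p * Real.exp (s * (|y| - u)) :=
    rpow_le_rpow_mul_exp (mul_nonneg hs.le (sub_nonneg.2 hy.le)) hp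
  rw [Real.mul_rpow hs.le (sub_nonneg.2 hy.le)] at h1
  have hsp : 0 < s ^ p := Real.rpow_pos_of_pos hs p
  have h2 : Real.exp (s * |y|) ≤ Real.exp (s * y) + Real.exp (-s * y) := by
    rcases abs_cases y with ⟨h, _⟩ | ⟨h, _⟩ <;> rw [h]
    · have := Real.exp_pos (-s * y); linarith
    · have := Real.exp_pos (s * y); rw [show s * -y = -s * y by ring]; linarith
  have h3 : 1 ≤ s * |y| := hu.trans (mul_le_mul_of_nonneg_left hy.le hs.le)
  have h4 : (8 : ℝ) / 3 ≤ Real.exp (s * |y|) := by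
    have := Real.exp_le_exp.2 h3
    have := Real.exp_one_gt_d9
    linarith
  have h5 : Real.exp (s * (|y| - u)) = Real.exp (-(s * u)) * Real.exp (s * |y|) := by
    rw [← Real.exp_add]; congr 1; ring
  rw [h5] at h1
  have h6 : (p * s⁻¹) ^ p = p ^ p / s ^ p := by
    rw [Real.mul_rpow hp.le (inv_nonneg.2 hs.le), Real.inv_rpow hs.le, div_eq_mul_inv]
  rw [h6]
  have h7 : (|y| - u) ^ p ≤ p ^ p / s ^ p * Real.exp (-(s * u)) * Real.exp (s * |y|) := by
    rw [div_mul_eq_mul_div, div_mul_eq_mul_div, le_div_iff₀ hsp]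
    linarith
  refine h7.trans ?_
  have h8 : Real.exp (s * |y|) ≤ 4 * (Real.exp (s * y) + Real.exp (-s * y) - 2) := by linarith
  have hpp : 0 < p ^ p := Real.rpow_pos_of_pos hp p
  calc p ^ p / s ^ p * Real.exp (-(s * u)) * Real.exp (s * |y|)
      ≤ p ^ p / s ^ p * Real.exp (-(s * u)) * (4 * (Real.exp (s * y) + Real.exp (-s * y) - 2)) := by
        gcongr
    _ = _ := by ring

/-- A moment form of Bernstein's inequality whose right-hand side carries the variance as a
factor. -/
theorem lintegral_bernstein_excess_le (hY : Measurable Y) (hY1 : ∀ᵐ x ∂P, |Y x| ≤ 1) {n : ℕ}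
    (hn : 1 ≤ n) {lam p : ℝ} (hlam : 1 ≤ lam) (hp : 0 < p) :
    ∫⁻ Z : Fin n → X, ENNReal.ofReal (|∑ i, (Y (Z i) - ∫ x, Y x ∂P)|
        - (√(2 * lam * (n * ∫ x, Y x ^ 2 ∂P)) + 4 / 3 * lam)) ^ p ∂Measure.pi (fun _ => P)
      ≤ ENNReal.ofReal (8 * p ^ p * (n : ℝ) ^ (p / 2) * (n * ∫ x, Y x ^ 2 ∂P)
        * Real.exp (-lam)) := by
  set V := n * ∫ x, Y x ^ 2 ∂P with hVdef
  have hn1 : (1 : ℝ) ≤ n := by exact_mod_cast hn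
  have hEY : 0 ≤ ∫ x, Y x ^ 2 ∂P := integral_nonneg fun _ => sq_nonneg _
  have hEY1 : ∫ x, Y x ^ 2 ∂P ≤ 1 := by
    have := integral_mono_of_nonneg (μ := P) (f := fun x => Y x ^ 2) (g := fun _ => (1 : ℝ))
      (Filter.Eventually.of_forall fun _ => sq_nonneg _) (integrable_const _) (by
        filter_upwards [hY1] with x hx
        exact (sq_le_one_iff_abs_le_one _).2 hx)
    simpa using this
  have hV : 0 ≤ V := mul_nonneg (zero_le_one.trans hn1) hEY
  have hVn : V ≤ n := by rw [hVdef]; nlinarith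
  obtain ⟨s, hs0, hs1, hsn, hsu⟩ := exists_bernstein_parameter hV hVn hn1 hlam
  set u := √(2 * lam * V) + 4 / 3 * lam with hu
  set q := s ^ 2 * (1 / 2 + 2 * s / 9) with hq
  have hq0 : 0 ≤ q := by positivity
  have hq1 : q ≤ 1 := by
    rw [hq]
    have : s ^ 2 ≤ 1 := pow_le_one₀ hs0.le hs1
    nlinarith
  obtain ⟨hi1, hb1⟩ := integral_exp_centered_sum_le hY hY1 n (s := s) (t := s)
    (by rw [abs_of_pos hs0]) hs1
  obtain ⟨hi2, hb2⟩ := integral_exp_centered_sum_le hY hY1 n (s := -s) (t := s)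
    (by rw [abs_neg, abs_of_pos hs0]) hs1
  rw [← hVdef, ← hq] at hb1 hb2
  have hsu1 : 1 ≤ s * u := by
    have : 0 ≤ q * V := mul_nonneg hq0 hV
    linarith
  set A := 4 * (p * s⁻¹) ^ p * Real.exp (-(s * u)) with hA
  have hA0 : 0 ≤ A := by positivity
  have hcosh : ∀ y : ℝ, 0 ≤ Real.exp (s * y) + Real.exp (-s * y) - 2 := fun y => by
    have h1 := Real.add_one_le_exp (s * y)
    have h2 := Real.add_one_le_exp (-s * y)
    linarith
  have hadd : Integrable (fun Z : Fin n → X => Real.exp (s * ∑ i, (Y (Z i) - ∫ x, Y x ∂P))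
      + Real.exp (-s * ∑ i, (Y (Z i) - ∫ x, Y x ∂P))) (Measure.pi fun _ => P) := hi1.add hi2
  have hint : Integrable (fun Z : Fin n → X => A *
      (Real.exp (s * ∑ i, (Y (Z i) - ∫ x, Y x ∂P)) + Real.exp (-s * ∑ i, (Y (Z i) - ∫ x, Y x ∂P))
        - 2)) (Measure.pi fun _ => P) :=
    ((hi1.add hi2).sub (integrable_const _)).const_mul _
  calc _ ≤ ∫⁻ Z : Fin n → X, ENNReal.ofReal (A *
      (Real.exp (s * ∑ i, (Y (Z i) - ∫ x, Y x ∂P)) + Real.exp (-s * ∑ i, (Y (Z i) - ∫ x, Y x ∂P))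
        - 2)) ∂Measure.pi (fun _ => P) := by
        refine lintegral_mono fun Z => ?_
        set y := ∑ i, (Y (Z i) - ∫ x, Y x ∂P)
        rcases le_or_gt |y| u with h | h
        · rw [ENNReal.ofReal_of_nonpos (by linarith), ENNReal.zero_rpow_of_pos hp]
          exact zero_le
        · rw [ENNReal.ofReal_rpow_of_pos (by linarith)]
          exact ENNReal.ofReal_le_ofReal (rpow_excess_le hs0 hsu1 hp h)
    _ = ENNReal.ofReal (∫ Z : Fin n → X, A *
      (Real.exp (s * ∑ i, (Y (Z i) - ∫ x, Y x ∂P)) + Real.exp (-s * ∑ i, (Y (Z i) - ∫ x, Y x ∂P))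
        - 2) ∂Measure.pi (fun _ => P)) :=
        (ofReal_integral_eq_lintegral_ofReal hint
          (Filter.Eventually.of_forall fun Z => mul_nonneg hA0 (hcosh _))).symm
    _ ≤ _ := by
        refine ENNReal.ofReal_le_ofReal ?_
        rw [integral_const_mul, integral_sub hadd (integrable_const _),
          integral_add hi1 hi2, integral_const, probReal_univ, one_smul]
        -- Here the variance becomes a factor: e^x - 1 ≤ x e^x with x = qV and q ≤ 1.
        have h1 : Real.exp (q * V) - 1 ≤ V * Real.exp (q * V) := by
          refine (exp_sub_one_le_mul_exp _).trans ?_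
          gcongr
          nlinarith
        have h2 : Real.exp (-(s * u)) * Real.exp (q * V) ≤ Real.exp (-lam) := by
          rw [← Real.exp_add]
          exact Real.exp_le_exp.2 (by linarith)
        have h3 : (p * s⁻¹) ^ p ≤ p ^ p * (n : ℝ) ^ (p / 2) := by
          rw [Real.mul_rpow hp.le (by positivity)]
          refine mul_le_mul_of_nonneg_left ?_ (by positivity)
          calc s⁻¹ ^ p ≤ √n ^ p := Real.rpow_le_rpow (by positivity) hsn hp.le
            _ = _ := by
              rw [Real.sqrt_eq_rpow, ← Real.rpow_mul (by positivity)]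
              congr 1; ring
        calc A * (_ + _ - 2) ≤ A * (2 * (V * Real.exp (q * V))) := by
              refine mul_le_mul_of_nonneg_left ?_ hA0
              linarith
          _ = 8 * (p * s⁻¹) ^ p * V * (Real.exp (-(s * u)) * Real.exp (q * V)) := by rw [hA]; ring
          _ ≤ 8 * (p ^ p * (n : ℝ) ^ (p / 2)) * V * Real.exp (-lam) := by gcongr
          _ = _ := by ring

theorem measure_le_ofReal_integral {Ω : Type*} [MeasurableSpace Ω] {Q : Measure Ω} {G : Ω → ℝ}
    (hG : Integrable G Q) (hG0 : 0 ≤ G) {A : Set Ω} (hA : ∀ ω ∈ A, 1 ≤ G ω) :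
    Q A ≤ ENNReal.ofReal (∫ ω, G ω ∂Q) := by
  rw [ofReal_integral_eq_lintegral_ofReal hG (Filter.Eventually.of_forall hG0)]
  have h := mul_meas_ge_le_lintegral₀ (μ := Q) hG.aemeasurable.ennreal_ofReal 1
  rw [one_mul] at h
  refine (measure_mono fun ω hω => ?_).trans h
  simpa using hA ω hω

/-- For V ≤ 8λ the event is empty. Otherwise V > 1, so the factor V costs nothing, and a Chernoff
bound for -∑Y² gives e^{-7V/16} ≤ e^{-λ}. -/
theorem measure_sum_sq_small_le (hY : Measurable Y) (hY1 : ∀ᵐ x ∂P, |Y x| ≤ 1) (n : ℕ)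
    {lam : ℝ} (hlam : 1 ≤ lam) :
    Measure.pi (fun _ => P) {Z : Fin n → X | 16 * ∑ i, Y (Z i) ^ 2 + 8 * lam
        < n * ∫ x, Y x ^ 2 ∂P}
      ≤ ENNReal.ofReal ((n * ∫ x, Y x ^ 2 ∂P) * Real.exp (-lam)) := by
  set V := n * ∫ x, Y x ^ 2 ∂P with hVdef
  rcases le_or_gt V (8 * lam) with h | h
  · have : {Z : Fin n → X | 16 * ∑ i, Y (Z i) ^ 2 + 8 * lam < V} = ∅ := by
      ext Z
      have : 0 ≤ ∑ i, Y (Z i) ^ 2 := Finset.sum_nonneg fun _ _ => sq_nonneg _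
      simp only [Set.mem_ofPred_eq, Set.mem_empty_iff_false, iff_false, not_lt]
      linarith
    rw [this, measure_empty]
    exact zero_le
  have hi2 := integrable_pow_of_abs_le_one hY hY1 2
  have hexp : ∫ x, Real.exp (-(Y x ^ 2)) ∂P ≤ Real.exp (-(1 / 2) * ∫ x, Y x ^ 2 ∂P) := by
    calc ∫ x, Real.exp (-(Y x ^ 2)) ∂P ≤ ∫ x, 1 + -(1 / 2) * Y x ^ 2 ∂P := by
          refine integral_mono_of_nonneg (Filter.Eventually.of_forall fun _ => (Real.exp_pos _).le)
            ((integrable_const _).add (hi2.const_mul _)) ?_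
          filter_upwards [hY1] with x hx
          have hx2 : Y x ^ 2 ≤ 1 := (sq_le_one_iff_abs_le_one _).2 hx
          have hx0 : 0 ≤ Y x ^ 2 := sq_nonneg _
          generalize Y x ^ 2 = y at hx0 hx2 ⊢
          rw [Real.exp_neg]
          have h1 := Real.add_one_le_exp y
          rw [inv_le_comm₀ (Real.exp_pos _) (by linarith)]
          refine le_trans ?_ h1
          rw [inv_le_comm₀ (by linarith) (by linarith), inv_eq_one_div, div_le_iff₀ (by linarith)]
          nlinarith
      _ ≤ _ := by
          rw [integral_add (integrable_const _) (hi2.const_mul _), integral_const_mul,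
            integral_const, probReal_univ, one_smul]
          have := Real.add_one_le_exp (-(1 / 2) * ∫ x, Y x ^ 2 ∂P)
          linarith
  obtain ⟨h1, h2⟩ := integral_exp_sum_le n (G := fun x => -(Y x ^ 2)) (hY.pow_const 2).neg (B := 1)
    (by
      filter_upwards [hY1] with x hx
      rw [abs_neg, abs_of_nonneg (sq_nonneg _)]
      exact (sq_le_one_iff_abs_le_one _).2 hx) hexp
  refine (measure_le_ofReal_integral (h1.const_mul (Real.exp (V / 16))) (fun Z => by positivity)
    (fun Z hZ => ?_)).trans (ENNReal.ofReal_le_ofReal ?_)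
  · rw [← Real.exp_add, Finset.sum_neg_distrib]
    refine Real.one_le_exp ?_
    simp only [Set.mem_ofPred_eq] at hZ
    linarith
  · rw [integral_const_mul]
    calc _ ≤ Real.exp (V / 16) * Real.exp (n * (-(1 / 2) * ∫ x, Y x ^ 2 ∂P)) := by gcongr
      _ = Real.exp (-(7 / 16) * V) := by rw [← Real.exp_add]; congr 1; rw [hVdef]; ring
      _ ≤ 1 * Real.exp (-lam) := by rw [one_mul]; exact Real.exp_le_exp.2 (by linarith)
      _ ≤ V * Real.exp (-lam) := by gcongr; linarith

/-- Markov's inequality is applied to exp(∑Y²) - 1 and not to the exponential itself, since V may be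
small and the mean of the difference is O(V e^{2V}). On the event the difference is at least E - 1 ≥
E/2. -/
theorem measure_sum_sq_large_le (hY : Measurable Y) (hY1 : ∀ᵐ x ∂P, |Y x| ≤ 1) (n : ℕ)
    {lam : ℝ} (hlam : 1 ≤ lam) :
    Measure.pi (fun _ => P) {Z : Fin n → X | 2 * (n * ∫ x, Y x ^ 2 ∂P) + 2 * lam
        < ∑ i, Y (Z i) ^ 2}
      ≤ ENNReal.ofReal (4 * (n * ∫ x, Y x ^ 2 ∂P) * Real.exp (-lam)) := by
  set V := n * ∫ x, Y x ^ 2 ∂P with hVdef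
  have hV : 0 ≤ V := mul_nonneg (Nat.cast_nonneg n) (integral_nonneg fun _ => sq_nonneg _)
  have hi2 := integrable_pow_of_abs_le_one hY hY1 2
  have hexp : ∫ x, Real.exp (Y x ^ 2) ∂P ≤ Real.exp (2 * ∫ x, Y x ^ 2 ∂P) := by
    calc ∫ x, Real.exp (Y x ^ 2) ∂P ≤ ∫ x, 1 + 2 * Y x ^ 2 ∂P := by
          refine integral_mono_of_nonneg (Filter.Eventually.of_forall fun _ => (Real.exp_pos _).le)
            ((integrable_const _).add (hi2.const_mul _)) ?_
          filter_upwards [hY1] with x hx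
          have hx2 : Y x ^ 2 ≤ 1 := (sq_le_one_iff_abs_le_one _).2 hx
          have hx0 : 0 ≤ Y x ^ 2 := sq_nonneg _
          have := exp_le_quadratic (x := Y x ^ 2) (s := 1) (by rwa [abs_of_nonneg hx0]) le_rfl
          nlinarith
      _ ≤ _ := by
          rw [integral_add (integrable_const _) (hi2.const_mul _), integral_const_mul,
            integral_const, probReal_univ, one_smul]
          have := Real.add_one_le_exp (2 * ∫ x, Y x ^ 2 ∂P)
          linarith
  obtain ⟨h1, h2⟩ := integral_exp_sum_le n (G := fun x => Y x ^ 2) (hY.pow_const 2) (B := 1)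
    (by
      filter_upwards [hY1] with x hx
      rw [abs_of_nonneg (sq_nonneg _)]
      exact (sq_le_one_iff_abs_le_one _).2 hx) hexp
  set E := Real.exp (2 * V + 2 * lam) with hE
  have hE2 : 2 ≤ E := by
    have := Real.add_one_le_exp (2 * V + 2 * lam)
    linarith
  refine (measure_le_ofReal_integral ((h1.sub (integrable_const 1)).const_mul (2 / E))
    (fun Z => ?_) (fun Z hZ => ?_)).trans (ENNReal.ofReal_le_ofReal ?_)
  · have : 0 ≤ ∑ i, Y (Z i) ^ 2 := Finset.sum_nonneg fun _ _ => sq_nonneg _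
    exact mul_nonneg (by positivity) (sub_nonneg.2 (Real.one_le_exp this))
  · simp only [Set.mem_ofPred_eq] at hZ
    have := Real.exp_le_exp.2 hZ.le
    rw [← hE] at this
    rw [div_mul_eq_mul_div, le_div_iff₀ (by linarith)]
    simp only [Pi.sub_apply]
    linarith
  · rw [integral_const_mul]
    have h3 : ∫ Z : Fin n → X, Real.exp (∑ i, Y (Z i) ^ 2) - 1 ∂Measure.pi (fun _ => P)
        ≤ 2 * V * Real.exp (2 * V) := by
      rw [integral_sub h1 (integrable_const _), integral_const, probReal_univ, one_smul]
      have e : n * (2 * ∫ x, Y x ^ 2 ∂P) = 2 * V := by rw [hVdef]; ring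
      rw [e] at h2
      exact (sub_le_sub_right h2 1).trans (exp_sub_one_le_mul_exp _)
    calc _ ≤ 2 / E * (2 * V * Real.exp (2 * V)) := by
          refine mul_le_mul_of_nonneg_left h3 (by positivity)
      _ = 4 * V * Real.exp (-(2 * lam)) := by
          rw [hE, Real.exp_add, Real.exp_neg]
          field_simp
          ring
      _ ≤ _ := by
          gcongr
          linarith

end Concentration
end

noncomputable section

/-! ### Layer-cake formulas with values in [0, ∞] -/

section LayerCake

/-- For finite c this is the layer-cake formula of a Dirac mass; for c = ∞ the right-hand side
dominates every finite value. The infinite value must be allowed since the bias is a supremum. -/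
theorem ENNReal.rpow_eq_lintegral_layer (c : ℝ≥0∞) {r : ℝ} (hr : 0 < r) :
    c ^ r = ENNReal.ofReal r *
      ∫⁻ t in Set.Ioi (0 : ℝ), {t | ENNReal.ofReal t < c}.indicator
        (fun t => ENNReal.ofReal (t ^ (r - 1))) t := by
  have hfin : ∀ a : ℝ, 0 ≤ a → ENNReal.ofReal a ^ r = ENNReal.ofReal r *
      ∫⁻ t in Set.Ioi (0 : ℝ), {t | ENNReal.ofReal t < ENNReal.ofReal a}.indicator
        (fun t => ENNReal.ofReal (t ^ (r - 1))) t := by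
    intro a ha
    have h := lintegral_rpow_eq_lintegral_meas_lt_mul (Measure.dirac ()) (f := fun _ => a)
      (Filter.Eventually.of_forall fun _ => ha) aemeasurable_const hr
    rw [lintegral_dirac, ← ENNReal.ofReal_rpow_of_nonneg ha hr.le] at h
    rw [h]
    congr 1
    refine setLIntegral_congr_fun measurableSet_Ioi fun t ht => ?_
    simp only [Set.indicator, Set.mem_ofPred_eq, ENNReal.ofReal_lt_ofReal_iff_of_nonneg
      (le_of_lt (Set.mem_Ioi.1 ht))]
    split_ifs with h1 <;> simp [h1]
  rcases eq_or_ne c ∞ with rfl | hc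
  · rw [ENNReal.top_rpow_of_pos hr, eq_comm]
    refine ENNReal.eq_top_of_forall_nnreal_le fun y => ?_
    have h1 := hfin ((y : ℝ) ^ (1 / r)) (by positivity)
    have h2 : ENNReal.ofReal ((y : ℝ) ^ (1 / r)) ^ r = y := by
      rw [ENNReal.ofReal_rpow_of_nonneg (by positivity) hr.le, ← Real.rpow_mul y.coe_nonneg,
        one_div_mul_cancel hr.ne', Real.rpow_one, ENNReal.ofReal_coe_nnreal]
    rw [← h2, h1]
    refine mul_le_mul_right (lintegral_mono fun t => ?_) _
    exact Set.indicator_le_indicator_of_subset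
      (fun t _ => ENNReal.ofReal_lt_top) (fun _ => zero_le) t
  · rw [← ENNReal.ofReal_toReal hc]
    exact hfin _ ENNReal.toReal_nonneg

/-- The weight allows the choice W = F with exponent r - 1, which closes the interpolation argument
for maximal functions. -/
theorem lintegral_mul_rpow_eq_layer {X : Type*} [MeasurableSpace X] {μ : Measure X} [SFinite μ]
    {W F : X → ℝ≥0∞} (hW : Measurable W) (hF : Measurable F) {r : ℝ} (hr : 0 < r) :
    ∫⁻ x, W x * F x ^ r ∂μ = ENNReal.ofReal r *
      ∫⁻ t in Set.Ioi (0 : ℝ), (∫⁻ x in {x | ENNReal.ofReal t < F x}, W x ∂μ)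
        * ENNReal.ofReal (t ^ (r - 1)) := by
  have hset : MeasurableSet {q : X × ℝ | ENNReal.ofReal q.2 < F q.1} :=
    measurableSet_lt (by fun_prop) (by fun_prop)
  have hmeas : Measurable (fun q : X × ℝ => W q.1 * {t | ENNReal.ofReal t < F q.1}.indicator
        (fun t => ENNReal.ofReal (t ^ (r - 1))) q.2) := by
    refine (hW.comp measurable_fst).mul ?_
    exact Measurable.indicator (f := fun q : X × ℝ => ENNReal.ofReal (q.2 ^ (r - 1)))
      (by fun_prop) hset
  calc ∫⁻ x, W x * F x ^ r ∂μ = ∫⁻ x, (ENNReal.ofReal r * ∫⁻ t in Set.Ioi (0 : ℝ),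
        W x * {t | ENNReal.ofReal t < F x}.indicator
        (fun t => ENNReal.ofReal (t ^ (r - 1))) t) ∂μ := by
        refine lintegral_congr fun x => ?_
        rw [ENNReal.rpow_eq_lintegral_layer (F x) hr, lintegral_const_mul, mul_left_comm]
        exact Measurable.indicator (by fun_prop)
          (measurableSet_lt (by fun_prop) measurable_const)
    _ = ENNReal.ofReal r * ∫⁻ x, (∫⁻ t in Set.Ioi (0 : ℝ),
        W x * {t | ENNReal.ofReal t < F x}.indicator
        (fun t => ENNReal.ofReal (t ^ (r - 1))) t) ∂μ :=
        lintegral_const_mul' _ _ ENNReal.ofReal_ne_top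
    _ = ENNReal.ofReal r * ∫⁻ t in Set.Ioi (0 : ℝ), (∫⁻ x,
        W x * {t | ENNReal.ofReal t < F x}.indicator
        (fun t => ENNReal.ofReal (t ^ (r - 1))) t ∂μ) := by
        rw [lintegral_lintegral_swap hmeas.aemeasurable]
    _ = _ := by
        congr 1
        refine lintegral_congr fun t => ?_
        rw [← lintegral_indicator (measurableSet_lt measurable_const hF),
          ← lintegral_mul_const' _ _ ENNReal.ofReal_ne_top]
        refine lintegral_congr fun x => ?_
        simp only [Set.indicator, Set.mem_ofPred_eq]
        split_ifs <;> simp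

theorem lintegral_rpow_eq_layer {X : Type*} [MeasurableSpace X] {μ : Measure X} [SFinite μ]
    {F : X → ℝ≥0∞} (hF : Measurable F) {r : ℝ} (hr : 0 < r) :
    ∫⁻ x, F x ^ r ∂μ = ENNReal.ofReal r *
      ∫⁻ t in Set.Ioi (0 : ℝ), μ {x | ENNReal.ofReal t < F x} * ENNReal.ofReal (t ^ (r - 1)) := by
  have h := lintegral_mul_rpow_eq_layer (μ := μ) (W := fun _ => 1) measurable_const hF hr
  simpa using h

end LayerCake

/-! ### Maximal functions over balls -/

section Maximal

/-- The average of `F` over the translate of `B` by `x`. -/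
def avgOver {E : Type*} [Add E] [MeasurableSpace E] (μ : Measure E) (B : Set E) (F : E → ℝ≥0∞)
    (x : E) : ℝ≥0∞ :=
  (μ B)⁻¹ * ∫⁻ s in B, F (x + s) ∂μ

/-- The maximal function of `F` along a family of sets. -/
def maxOver {E ι : Type*} [Add E] [MeasurableSpace E] (μ : Measure E) (B : ι → Set E)
    (F : E → ℝ≥0∞) (x : E) : ℝ≥0∞ :=
  ⨆ i, avgOver μ (B i) F x

theorem avgOver_le_maxOver {E ι : Type*} [Add E] [MeasurableSpace E] (μ : Measure E)
    (B : ι → Set E) (F : E → ℝ≥0∞) (x : E) (i : ι) : avgOver μ (B i) F x ≤ maxOver μ B F x :=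
  le_iSup (fun i => avgOver μ (B i) F x) i

theorem avgOver_mono {E : Type*} [Add E] [MeasurableSpace E] (μ : Measure E)
    (B : Set E) {F G : E → ℝ≥0∞} (h : F ≤ G) (x : E) : avgOver μ B F x ≤ avgOver μ B G x :=
  mul_le_mul_right (lintegral_mono fun s => h (x + s)) _

theorem measurable_maxOver_param {E ι Z : Type*} [Add E] [MeasurableSpace E] [MeasurableAdd₂ E]
    [Countable ι] [MeasurableSpace Z] (μ : Measure E) [SFinite μ] (B : ι → Set E)
    {F : Z × E → ℝ≥0∞} (hF : Measurable F) :
    Measurable (fun q : Z × E => maxOver μ B (fun y => F (q.1, y)) q.2) := by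
  refine Measurable.iSup fun i => Measurable.const_mul ?_ _
  exact Measurable.lintegral_prod_right'
    (f := fun w : (Z × E) × E => F (w.1.1, w.1.2 + w.2)) (by fun_prop)

theorem measurable_maxOver {E ι : Type*} [Add E] [MeasurableSpace E] [MeasurableAdd₂ E]
    [Countable ι] (μ : Measure E) [SFinite μ] (B : ι → Set E)
    {F : E → ℝ≥0∞} (hF : Measurable F) : Measurable (maxOver μ B F) := by
  have := measurable_maxOver_param (Z := Unit) μ B (F := fun q => F q.2) (by fun_prop)
  exact this.comp (measurable_const.prodMk measurable_id : Measurable fun x : E => ((), x))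

open Metric Module

theorem setLIntegral_closedBall_translate {E : Type*} [NormedAddCommGroup E] [MeasurableSpace E]
    [BorelSpace E] {μ : Measure E} [μ.IsAddLeftInvariant] (F : E → ℝ≥0∞) (x : E) (ρ : ℝ) :
    ∫⁻ s in closedBall 0 ρ, F (x + s) ∂μ = ∫⁻ y in closedBall x ρ, F y ∂μ := by
  rw [← lintegral_indicator measurableSet_closedBall, ← lintegral_indicator measurableSet_closedBall,
    ← lintegral_add_left_eq_self ((closedBall x ρ).indicator F) x]
  refine lintegral_congr fun s => ?_
  simp only [Set.indicator, mem_closedBall, dist_eq_norm, add_sub_cancel_left, sub_zero]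

variable {E : Type*} [NormedAddCommGroup E] [NormedSpace ℝ E] [FiniteDimensional ℝ E]
  [MeasurableSpace E] [BorelSpace E] {μ : Measure E} [μ.IsAddHaarMeasure]

/-- The weak type `(1, 1)` inequality for averages over balls. -/
theorem measure_lt_maxOver_closedBall_le {ι : Type*} [Countable ι] [Nonempty ι] {ρ : ι → ℝ} (hρ : ∀ i, 0 < ρ i)
    (F : E → ℝ≥0∞) {t : ℝ≥0∞} (ht : t ≠ 0) (ht' : t ≠ ∞) :
    μ {x | t < maxOver μ (fun i => closedBall 0 (ρ i)) F x}
      ≤ 5 ^ finrank ℝ E * t⁻¹ * ∫⁻ y, F y ∂μ := by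
  -- Vitali's covering lemma needs bounded radii, which finitely many indices provide. The bound
  -- does not depend on the finite set, so it passes to the directed union.
  have key : ∀ s : Finset ι, μ (⋃ i ∈ s, {x | t < avgOver μ (closedBall 0 (ρ i)) F x})
      ≤ 5 ^ finrank ℝ E * t⁻¹ * ∫⁻ y, F y ∂μ := by
    intro s
    set A : Set E := ⋃ i ∈ s, {x | t < avgOver μ (closedBall 0 (ρ i)) F x} with hA
    have hex : ∀ x : E, ∃ i, x ∈ A → i ∈ s ∧ t < avgOver μ (closedBall 0 (ρ i)) F x := by
      intro x
      by_cases hx : x ∈ A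
      · simp only [hA, Set.mem_iUnion, Set.mem_ofPred_eq] at hx
        obtain ⟨i, hi, h⟩ := hx
        exact ⟨i, fun _ => ⟨hi, h⟩⟩
      · exact ⟨Classical.arbitrary ι, fun h => absurd h hx⟩
    choose i hi using hex
    obtain ⟨u, huA, hdisj, hcov⟩ := Vitali.exists_disjoint_subfamily_covering_enlargement_closedBall
      A (fun x => x) (fun x => ρ (i x)) (∑ j ∈ s, ρ j)
      (fun x hx => Finset.single_le_sum (fun j _ => (hρ j).le) (hi x hx).1) 5 (by norm_num)
    have hucount : u.Countable := hdisj.countable_of_nonempty_interior fun x _ => by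
      refine ⟨x, ball_subset_interior_closedBall (mem_ball_self (hρ _))⟩
    have hball : ∀ x ∈ u, μ (closedBall x (ρ (i x))) ≤ t⁻¹ * ∫⁻ y in closedBall x (ρ (i x)), F y ∂μ := by
      intro x hx
      have h1 := (hi x (huA hx)).2
      rw [avgOver, setLIntegral_closedBall_translate] at h1
      have h2 : μ (closedBall (0 : E) (ρ (i x))) = μ (closedBall x (ρ (i x))) :=
        (Measure.addHaar_closedBall_center μ x _).symm
      rw [h2] at h1
      have h3 : μ (closedBall x (ρ (i x))) ≠ 0 := (measure_closedBall_pos μ x (hρ _)).ne'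
      have h4 : μ (closedBall x (ρ (i x))) ≠ ∞ := measure_closedBall_lt_top.ne
      rw [← ENNReal.div_eq_inv_mul, ENNReal.le_div_iff_mul_le (Or.inl ht) (Or.inl ht'), mul_comm]
      have h5 := mul_le_mul_left h1.le (μ (closedBall x (ρ (i x))))
      rwa [mul_comm (_⁻¹ : ℝ≥0∞), mul_assoc, ENNReal.inv_mul_cancel h3 h4, mul_one] at h5
    calc μ A ≤ μ (⋃ x ∈ u, closedBall x (5 * ρ (i x))) := by
          refine measure_mono fun x hx => ?_
          obtain ⟨y, hy, hxy⟩ := hcov x hx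
          exact Set.mem_biUnion hy (hxy (mem_closedBall_self (hρ _).le))
      _ ≤ ∑' x : u, μ (closedBall (x : E) (5 * ρ (i x))) := measure_biUnion_le μ hucount _
      _ ≤ ∑' x : u, 5 ^ finrank ℝ E * t⁻¹ * ∫⁻ y in closedBall (x : E) (ρ (i x)), F y ∂μ := by
          refine ENNReal.tsum_le_tsum fun x => ?_
          rw [Measure.addHaar_closedBall_mul μ (x : E) (by norm_num : (0 : ℝ) ≤ 5) (hρ _).le,
            ← Measure.addHaar_closedBall_center μ (x : E), mul_assoc]
          rw [ENNReal.ofReal_pow (by norm_num)]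
          gcongr
          · norm_num
          · exact hball x x.2
      _ = 5 ^ finrank ℝ E * t⁻¹ * ∫⁻ y in ⋃ x ∈ u, closedBall (x : E) (ρ (i x)), F y ∂μ := by
          rw [ENNReal.tsum_mul_left, lintegral_biUnion hucount
            (fun x _ => measurableSet_closedBall) hdisj]
      _ ≤ _ := by
          gcongr
          exact Measure.restrict_le_self
  have hU : {x | t < maxOver μ (fun i => closedBall 0 (ρ i)) F x}
      = ⋃ s : Finset ι, ⋃ i ∈ s, {x | t < avgOver μ (closedBall 0 (ρ i)) F x} := by
    ext x
    simp only [maxOver, Set.mem_ofPred_eq, lt_iSup_iff, Set.mem_iUnion]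
    constructor
    · rintro ⟨i, h⟩
      exact ⟨{i}, i, by simp, h⟩
    · rintro ⟨s, i, _, h⟩
      exact ⟨i, h⟩
  rw [hU, Directed.measure_iUnion]
  · exact iSup_le key
  · exact directed_of_isDirected_le fun s t hst => Set.biUnion_subset_biUnion_left hst

/-- Cutting F at height t changes each average by at most t, so the weak-type inequality is needed
only for the part of F above t. -/
theorem measure_two_mul_lt_maxOver_closedBall_le {ι : Type*} [Countable ι] [Nonempty ι] {ρ : ι → ℝ}
    (hρ : ∀ i, 0 < ρ i) {F : E → ℝ≥0∞} (hF : Measurable F) {t : ℝ≥0∞} (ht : t ≠ 0) (ht' : t ≠ ∞) :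
    μ {x | 2 * t < maxOver μ (fun i => closedBall 0 (ρ i)) F x}
      ≤ 5 ^ finrank ℝ E * t⁻¹ * ∫⁻ y in {y | t < F y}, F y ∂μ := by
  have hs : MeasurableSet {y | t < F y} := measurableSet_lt measurable_const hF
  rw [← lintegral_indicator hs]
  refine le_trans (measure_mono fun x hx => ?_) (measure_lt_maxOver_closedBall_le hρ _ ht ht')
  simp only [Set.mem_ofPred_eq, maxOver, lt_iSup_iff] at hx ⊢
  obtain ⟨i, hi⟩ := hx
  refine ⟨i, ?_⟩
  have h3 : μ (closedBall (0 : E) (ρ i)) ≠ 0 := (measure_closedBall_pos μ 0 (hρ _)).ne'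
  have h4 : μ (closedBall (0 : E) (ρ i)) ≠ ∞ := measure_closedBall_lt_top.ne
  have h1 : avgOver μ (closedBall 0 (ρ i)) F x
      ≤ t + avgOver μ (closedBall 0 (ρ i)) ({y | t < F y}.indicator F) x := by
    calc avgOver μ (closedBall 0 (ρ i)) F x
        ≤ avgOver μ (closedBall 0 (ρ i)) (fun y => t + {y | t < F y}.indicator F y) x := by
          refine avgOver_mono _ _ (fun y => ?_) _
          simp only [Set.indicator, Set.mem_ofPred_eq]
          split_ifs with h
          · exact le_add_self
          · simpa using h
      _ = _ := by
          rw [avgOver, lintegral_add_left measurable_const, mul_add, lintegral_const,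
            Measure.restrict_apply_univ, mul_comm t, ← mul_assoc, ENNReal.inv_mul_cancel h3 h4,
            one_mul, avgOver]
  rw [two_mul] at hi
  exact lt_of_add_lt_add_left (hi.trans_le h1)

theorem setLIntegral_lt_le_rpow {X : Type*} [MeasurableSpace X] {ν : Measure X} {F : X → ℝ≥0∞}
    (hF : Measurable F) {t : ℝ≥0∞} (ht : t ≠ 0) (ht' : t ≠ ∞) {r : ℝ} (hr : 1 ≤ r) :
    ∫⁻ y in {y | t < F y}, F y ∂ν ≤ t * (t⁻¹ ^ r * ∫⁻ y, F y ^ r ∂ν) := by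
  rw [← lintegral_indicator (measurableSet_lt measurable_const hF), ← mul_assoc,
    ← lintegral_const_mul _ (hF.pow_const r)]
  refine lintegral_mono fun y => ?_
  simp only [Set.indicator, Set.mem_ofPred_eq]
  split_ifs with h
  · have h1 : 1 ≤ t⁻¹ * F y := by
      rw [← ENNReal.inv_mul_cancel ht ht']
      gcongr
    calc F y = t * (t⁻¹ * F y) := by rw [← mul_assoc, ENNReal.mul_inv_cancel ht ht', one_mul]
      _ ≤ t * (t⁻¹ * F y) ^ r := by
          gcongr
          exact ENNReal.le_rpow_self_of_one_le h1 hr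
      _ = _ := by rw [ENNReal.mul_rpow_of_nonneg _ _ (by linarith), mul_assoc]
  · exact zero_le

theorem measure_two_mul_lt_maxOver_closedBall_le_rpow {ι : Type*} [Countable ι] [Nonempty ι] {ρ : ι → ℝ}
    (hρ : ∀ i, 0 < ρ i) {F : E → ℝ≥0∞} (hF : Measurable F) {t : ℝ≥0∞} (ht : t ≠ 0) (ht' : t ≠ ∞)
    {r : ℝ} (hr : 1 ≤ r) :
    μ {x | 2 * t < maxOver μ (fun i => closedBall 0 (ρ i)) F x}
      ≤ 5 ^ finrank ℝ E * (t⁻¹ ^ r * ∫⁻ y, F y ^ r ∂μ) := by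
  refine (measure_two_mul_lt_maxOver_closedBall_le hρ hF ht ht').trans ?_
  rw [mul_assoc]
  refine mul_le_mul_right ?_ _
  calc t⁻¹ * ∫⁻ y in {y | t < F y}, F y ∂μ ≤ t⁻¹ * (t * (t⁻¹ ^ r * ∫⁻ y, F y ^ r ∂μ)) := by
        gcongr
        exact setLIntegral_lt_le_rpow hF ht ht' hr
    _ = _ := by rw [← mul_assoc, ENNReal.inv_mul_cancel ht ht', one_mul]

/-- The strong type `(r, r)` inequality for averages over balls. -/
theorem lintegral_maxOver_closedBall_rpow_le {ι : Type*} [Countable ι] [Nonempty ι] {ρ : ι → ℝ}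
    (hρ : ∀ i, 0 < ρ i) {F : E → ℝ≥0∞} (hF : Measurable F) {r : ℝ} (hr : 1 < r) (hr2 : r ≤ 2) :
    ∫⁻ x, maxOver μ (fun i => closedBall 0 (ρ i)) F x ^ r ∂μ
      ≤ ENNReal.ofReal (8 * 5 ^ finrank ℝ E / (r - 1)) * ∫⁻ x, F x ^ r ∂μ := by
  have hr0 : 0 < r := by linarith
  set G : E → ℝ≥0∞ := fun x => 2⁻¹ * maxOver μ (fun i => closedBall 0 (ρ i)) F x with hG
  have hGm : Measurable G := (measurable_maxOver μ _ hF).const_mul _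
  have h2 : (2 : ℝ≥0∞) * 2⁻¹ = 1 := ENNReal.mul_inv_cancel two_ne_zero ENNReal.ofNat_ne_top
  have hMG : ∀ x, maxOver μ (fun i => closedBall 0 (ρ i)) F x = 2 * G x := fun x => by
    rw [hG, ← mul_assoc, h2, one_mul]
  have hlev : ∀ t : ℝ, 0 < t → μ {x | ENNReal.ofReal t < G x}
      ≤ 5 ^ finrank ℝ E * (ENNReal.ofReal t)⁻¹ * ∫⁻ y in {y | ENNReal.ofReal t < F y}, F y ∂μ := by
    intro t ht
    refine le_trans (measure_mono fun x hx => ?_) (measure_two_mul_lt_maxOver_closedBall_le hρ hF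
      (ENNReal.ofReal_pos.2 ht).ne' ENNReal.ofReal_ne_top)
    simp only [Set.mem_ofPred_eq] at hx ⊢
    rw [hMG]
    exact (ENNReal.mul_lt_mul_iff_right two_ne_zero ENNReal.ofNat_ne_top).2 hx
  -- Marcinkiewicz interpolation. The explicit factor 1/(r - 1) is kept, because its blow-up as r →
  -- 1 produces the logarithms of l_ℍ.
  have hGr : ∫⁻ x, G x ^ r ∂μ ≤ ENNReal.ofReal (r * 5 ^ finrank ℝ E / (r - 1)) * ∫⁻ x, F x ^ r ∂μ := by
    calc ∫⁻ x, G x ^ r ∂μ = ENNReal.ofReal r * ∫⁻ t in Set.Ioi (0 : ℝ),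
          μ {x | ENNReal.ofReal t < G x} * ENNReal.ofReal (t ^ (r - 1)) :=
          lintegral_rpow_eq_layer hGm hr0
      _ ≤ ENNReal.ofReal r * ∫⁻ t in Set.Ioi (0 : ℝ), 5 ^ finrank ℝ E *
          ((∫⁻ y in {y | ENNReal.ofReal t < F y}, F y ∂μ) * ENNReal.ofReal (t ^ (r - 1 - 1))) := by
          gcongr 1
          refine setLIntegral_mono' measurableSet_Ioi fun t ht => ?_
          have ht0 : 0 < t := ht
          have e : ENNReal.ofReal (t ^ (r - 1 - 1))
              = (ENNReal.ofReal t)⁻¹ * ENNReal.ofReal (t ^ (r - 1)) := by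
            rw [← ENNReal.ofReal_inv_of_pos ht0, ← ENNReal.ofReal_mul (by positivity),
              Real.rpow_sub_one ht0.ne' (r - 1)]
            congr 1
            ring
          rw [e]
          calc _ ≤ (5 ^ finrank ℝ E * (ENNReal.ofReal t)⁻¹ *
                ∫⁻ y in {y | ENNReal.ofReal t < F y}, F y ∂μ) * ENNReal.ofReal (t ^ (r - 1)) := by
                gcongr
                exact hlev t ht0
            _ = _ := by ring
      _ = 5 ^ finrank ℝ E * ENNReal.ofReal r * ∫⁻ t in Set.Ioi (0 : ℝ),
          (∫⁻ y in {y | ENNReal.ofReal t < F y}, F y ∂μ) * ENNReal.ofReal (t ^ (r - 1 - 1)) := by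
          rw [lintegral_const_mul' _ _ (by finiteness)]
          ring
      _ = ENNReal.ofReal (r * 5 ^ finrank ℝ E / (r - 1)) * (ENNReal.ofReal (r - 1) *
          ∫⁻ t in Set.Ioi (0 : ℝ),
          (∫⁻ y in {y | ENNReal.ofReal t < F y}, F y ∂μ) * ENNReal.ofReal (t ^ (r - 1 - 1))) := by
          rw [← mul_assoc, ← ENNReal.ofReal_mul (by
            have : 0 < r - 1 := by linarith
            positivity), div_mul_cancel₀ _ (by linarith : r - 1 ≠ 0),
            ENNReal.ofReal_mul hr0.le, ENNReal.ofReal_pow (by norm_num)]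
          congr 1
          rw [mul_comm]
          norm_num
      _ = _ := by
          rw [← lintegral_mul_rpow_eq_layer hF hF (by linarith : 0 < r - 1)]
          congr 1
          refine lintegral_congr fun x => ?_
          conv_lhs => rw [← ENNReal.rpow_one (F x), ENNReal.rpow_one]
          nth_rewrite 1 [← ENNReal.rpow_one (F x)]
          rw [← ENNReal.rpow_add_of_nonneg _ _ zero_le_one (by linarith)]
          congr 1
          ring
  calc ∫⁻ x, maxOver μ (fun i => closedBall 0 (ρ i)) F x ^ r ∂μ = ∫⁻ x, 2 ^ r * G x ^ r ∂μ := by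
        refine lintegral_congr fun x => ?_
        rw [hMG, ENNReal.mul_rpow_of_nonneg _ _ hr0.le]
    _ = 2 ^ r * ∫⁻ x, G x ^ r ∂μ := lintegral_const_mul _ (hGm.pow_const r)
    _ ≤ 4 * (ENNReal.ofReal (r * 5 ^ finrank ℝ E / (r - 1)) * ∫⁻ x, F x ^ r ∂μ) := by
        gcongr
        calc (2 : ℝ≥0∞) ^ r ≤ 2 ^ (2 : ℝ) := ENNReal.rpow_le_rpow_of_exponent_le (by norm_num) hr2
          _ = 4 := by rw [ENNReal.rpow_ofNat]; norm_num
    _ ≤ _ := by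
        rw [← mul_assoc, show (4 : ℝ≥0∞) = ENNReal.ofReal 4 by simp,
          ← ENNReal.ofReal_mul (by norm_num)]
        gcongr
        rw [← mul_div_assoc]
        have : 0 < r - 1 := by linarith
        gcongr ?_ / _
        have : (0 : ℝ) < 5 ^ finrank ℝ E := by positivity
        nlinarith

end Maximal
end

noncomputable section

/-! ### The strong maximal function over boxes -/

section StrongMaximal

open Metric Module

/-- The box with half sides `A e^{kⱼ}` centred at the origin. -/
def expBox {d : ℕ} (A : ℝ) (k : Fin d → ℤ) : Set (Fin d → ℝ) :=
  Set.Icc (fun j => -(A * Real.exp (k j))) fun j => A * Real.exp (k j)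

/-- Splitting off the first coordinate. -/
def splitFirst (d : ℕ) : (Fin (d + 1) → ℝ) ≃ᵐ ℝ × (Fin d → ℝ) :=
  MeasurableEquiv.piFinSuccAbove (fun _ => ℝ) 0

theorem measurePreserving_splitFirst_symm (d : ℕ) :
    MeasurePreserving (splitFirst d).symm (volume.prod volume) volume :=
  (volume_preserving_piFinSuccAbove (fun _ : Fin (d + 1) => ℝ) 0).symm

theorem splitFirst_symm_add {d : ℕ} (q s : ℝ × (Fin d → ℝ)) :
    (splitFirst d).symm (q.1 + s.1, q.2 + s.2) = (splitFirst d).symm q + (splitFirst d).symm s := by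
  ext j
  refine Fin.cases ?_ (fun i => ?_) j <;>
  simp [splitFirst, MeasurableEquiv.piFinSuccAbove]

theorem splitFirst_symm_preimage_expBox {d : ℕ} (A : ℝ) (k : Fin (d + 1) → ℤ) :
    (splitFirst d).symm ⁻¹' expBox A k
      = closedBall 0 (A * Real.exp (k 0)) ×ˢ expBox A (fun j => k j.succ) := by
  ext q
  simp only [expBox, Set.mem_preimage, Set.mem_Icc, Pi.le_def, Fin.forall_fin_succ, Set.mem_prod,
    Real.closedBall_eq_Icc]
  simp only [splitFirst, MeasurableEquiv.piFinSuccAbove]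
  simp
  tauto

theorem measurableSet_expBox {d : ℕ} (A : ℝ) (k : Fin d → ℤ) : MeasurableSet (expBox A k) :=
  measurableSet_Icc

theorem avgOver_expBox_split {d : ℕ} (A : ℝ) (k : Fin (d + 1) → ℤ) {F : (Fin (d + 1) → ℝ) → ℝ≥0∞}
    (hF : Measurable F) (q : ℝ × (Fin d → ℝ)) :
    avgOver volume (expBox A k) F ((splitFirst d).symm q)
      = avgOver volume (closedBall 0 (A * Real.exp (k 0)))
        (fun a => avgOver volume (expBox A fun j => k j.succ)
          (fun b => F ((splitFirst d).symm (a, b))) q.2) q.1 := by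
  have hmp := measurePreserving_splitFirst_symm d
  have hFe : Measurable fun p : ℝ × (Fin d → ℝ) => F ((splitFirst d).symm p) :=
    hF.comp (splitFirst d).symm.measurable
  have h1 : volume (expBox A k) = volume (closedBall (0 : ℝ) (A * Real.exp (k 0)))
      * volume (expBox A fun j => k j.succ) := by
    rw [← hmp.measure_preimage (measurableSet_expBox A k).nullMeasurableSet,
      splitFirst_symm_preimage_expBox, Measure.prod_prod]
  have h2 : ∫⁻ s in expBox A k, F ((splitFirst d).symm q + s)
      = ∫⁻ s in closedBall (0 : ℝ) (A * Real.exp (k 0)), ∫⁻ t in expBox A (fun j => k j.succ),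
        F ((splitFirst d).symm (q.1 + s, q.2 + t)) := by
    rw [← hmp.setLIntegral_comp_preimage_emb (splitFirst d).symm.measurableEmbedding,
      splitFirst_symm_preimage_expBox, ← Measure.prod_restrict, lintegral_prod]
    · simp only [← splitFirst_symm_add]
    · exact (hF.comp (measurable_const.add (splitFirst d).symm.measurable)).aemeasurable
  have hf1 : volume (closedBall (0 : ℝ) (A * Real.exp (k 0))) ≠ ∞ := measure_closedBall_lt_top.ne
  have hf2 : volume (expBox A fun j => k j.succ) ≠ ∞ := isCompact_Icc.measure_lt_top.ne
  rw [avgOver, avgOver, h1, h2, ENNReal.mul_inv (Or.inr hf2) (Or.inl hf1), mul_assoc]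
  congr 1
  simp only [avgOver]
  rw [lintegral_const_mul]
  exact Measurable.lintegral_prod_right'
    (f := fun w : ℝ × (Fin d → ℝ) => F ((splitFirst d).symm (q.1 + w.1, q.2 + w.2))) (by fun_prop)

/-- A box average is an iterated average, so the strong maximal function is dominated by a
one-dimensional maximal function of the strong maximal function in the other coordinates. -/
theorem maxOver_expBox_le {d : ℕ} (A : ℝ) {F : (Fin (d + 1) → ℝ) → ℝ≥0∞}
    (hF : Measurable F) (q : ℝ × (Fin d → ℝ)) :
    maxOver volume (expBox A) F ((splitFirst d).symm q)
      ≤ maxOver volume (fun k : ℤ => closedBall (0 : ℝ) (A * Real.exp k))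
        (fun a => maxOver volume (expBox A) (fun b => F ((splitFirst d).symm (a, b))) q.2) q.1 := by
  refine iSup_le fun k => ?_
  rw [avgOver_expBox_split A k hF q]
  refine le_trans ?_ (avgOver_le_maxOver volume (fun k : ℤ => closedBall (0 : ℝ) (A * Real.exp k))
    _ _ (k 0))
  exact avgOver_mono _ _ (fun a => avgOver_le_maxOver volume (expBox A)
    (fun b => F ((splitFirst d).symm (a, b))) q.2 _) _

/-- Induction on the dimension; each coordinate costs the one-dimensional constant 8·5/(r - 1). -/
theorem lintegral_maxOver_expBox_rpow_le {A : ℝ} (hA : 0 < A) {r : ℝ} (hr : 1 < r) (hr2 : r ≤ 2) :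
    ∀ (d : ℕ) {F : (Fin d → ℝ) → ℝ≥0∞}, Measurable F →
      ∫⁻ x, maxOver volume (expBox A) F x ^ r
        ≤ ENNReal.ofReal (40 / (r - 1)) ^ d * ∫⁻ x, F x ^ r := by
  intro d
  induction d with
  | zero =>
    intro F hF
    rw [pow_zero, one_mul]
    refine lintegral_mono fun x => ENNReal.rpow_le_rpow (iSup_le fun k => ?_) (by linarith)
    have h0 : expBox A k = Set.univ := by
      ext s; simp [expBox]
    have h1 : ∀ s, F (x + s) = F x := fun s => by rw [Subsingleton.elim (x + s) x]
    simp only [avgOver, h0, h1, lintegral_const, Measure.restrict_univ]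
    rw [mul_comm, mul_assoc]
    have : (volume : Measure (Fin 0 → ℝ)) Set.univ = 1 := by simp [volume_pi]
    simp [this]
  | succ d ih =>
    intro F hF
    have hmp := measurePreserving_splitFirst_symm d
    have hFe : Measurable fun p : ℝ × (Fin d → ℝ) => F ((splitFirst d).symm p) :=
      hF.comp (splitFirst d).symm.measurable
    obtain ⟨G, hG⟩ : ∃ G : ℝ × (Fin d → ℝ) → ℝ≥0∞, ∀ q, G q =
        maxOver volume (expBox A) (fun b => F ((splitFirst d).symm (q.1, b))) q.2 :=
      ⟨_, fun _ => rfl⟩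
    have hGm : Measurable G := by
      rw [funext hG]
      exact measurable_maxOver_param volume (expBox A) hFe
    have hGm' : Measurable fun w : (Fin d → ℝ) × ℝ => G (w.2, w.1) := hGm.comp measurable_swap
    have hle : ∀ q, maxOver volume (expBox A) F ((splitFirst d).symm q) ≤
        maxOver volume (fun k : ℤ => closedBall (0 : ℝ) (A * Real.exp k))
          (fun a => G (a, q.2)) q.1 := fun q => by
      simpa only [hG] using maxOver_expBox_le A hF q
    have hH : Measurable fun w : (Fin d → ℝ) × ℝ =>
        maxOver volume (fun k : ℤ => closedBall (0 : ℝ) (A * Real.exp k))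
          (fun a => G (a, w.1)) w.2 :=
      measurable_maxOver_param volume (fun k : ℤ => closedBall (0 : ℝ) (A * Real.exp k)) hGm'
    have hH' : Measurable fun q : ℝ × (Fin d → ℝ) =>
        maxOver volume (fun k : ℤ => closedBall (0 : ℝ) (A * Real.exp k))
          (fun a => G (a, q.2)) q.1 := hH.comp measurable_swap
    calc ∫⁻ x, maxOver volume (expBox A) F x ^ r
        = ∫⁻ q, maxOver volume (expBox A) F ((splitFirst d).symm q) ^ r ∂(volume.prod volume) := by
          rw [hmp.lintegral_comp ((measurable_maxOver volume _ hF).pow_const r)]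
      _ ≤ ∫⁻ q : ℝ × (Fin d → ℝ), maxOver volume
          (fun k : ℤ => closedBall (0 : ℝ) (A * Real.exp k)) (fun a => G (a, q.2)) q.1 ^ r
          ∂(volume.prod volume) :=
          lintegral_mono fun q => ENNReal.rpow_le_rpow (hle q) (by linarith)
      _ = ∫⁻ b : Fin d → ℝ, ∫⁻ a : ℝ, maxOver volume
          (fun k : ℤ => closedBall (0 : ℝ) (A * Real.exp k)) (fun a => G (a, b)) a ^ r := by
          rw [lintegral_prod_symm _ (hH'.pow_const r).aemeasurable]
      _ ≤ ∫⁻ b : Fin d → ℝ, ENNReal.ofReal (40 / (r - 1)) * ∫⁻ a : ℝ, G (a, b) ^ r := by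
          refine lintegral_mono fun b => ?_
          have h := lintegral_maxOver_closedBall_rpow_le (E := ℝ) (μ := volume)
            (ρ := fun k : ℤ => A * Real.exp k) (fun k => mul_pos hA (Real.exp_pos _))
            (F := fun a => G (a, b)) (hGm.comp (measurable_id.prodMk measurable_const)) hr hr2
          rw [finrank_self] at h
          norm_num at h
          exact h
      _ = ENNReal.ofReal (40 / (r - 1)) * ∫⁻ a : ℝ, ∫⁻ b : Fin d → ℝ, G (a, b) ^ r := by
          rw [lintegral_const_mul' _ _ ENNReal.ofReal_ne_top, lintegral_lintegral_swap]
          exact (hGm'.pow_const r).aemeasurable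
      _ ≤ ENNReal.ofReal (40 / (r - 1)) * ∫⁻ a : ℝ, (ENNReal.ofReal (40 / (r - 1)) ^ d *
            ∫⁻ b : Fin d → ℝ, F ((splitFirst d).symm (a, b)) ^ r) := by
          gcongr with a
          simp only [hG]
          exact ih (hFe.comp (measurable_const.prodMk measurable_id))
      _ = ENNReal.ofReal (40 / (r - 1)) ^ (d + 1) *
            ∫⁻ a : ℝ, ∫⁻ b : Fin d → ℝ, F ((splitFirst d).symm (a, b)) ^ r := by
          rw [lintegral_const_mul' _ _ (by finiteness), pow_succ']
          ring
      _ = _ := by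
          rw [← hmp.lintegral_comp (hF.pow_const r), lintegral_prod _
            (hFe.pow_const r).aemeasurable]

/-- The first coordinate is treated by a weak-type bound, whose constant stays bounded as r → 1, and
only the other d coordinates by the strong-type bound. This saves one factor 1/(r - 1), hence one
logarithm. -/
theorem measure_two_mul_lt_maxOver_expBox_le {A : ℝ} (hA : 0 < A) {r : ℝ} (hr : 1 < r)
    (hr2 : r ≤ 2) (d : ℕ) {F : (Fin (d + 1) → ℝ) → ℝ≥0∞} (hF : Measurable F) {t : ℝ≥0∞}
    (ht : t ≠ 0) (ht' : t ≠ ∞) :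
    volume {x | 2 * t < maxOver volume (expBox A) F x}
      ≤ 5 * (t⁻¹ ^ r * (ENNReal.ofReal (40 / (r - 1)) ^ d * ∫⁻ x, F x ^ r)) := by
  have hmp := measurePreserving_splitFirst_symm d
  have hFe : Measurable fun p : ℝ × (Fin d → ℝ) => F ((splitFirst d).symm p) :=
    hF.comp (splitFirst d).symm.measurable
  obtain ⟨G, hG⟩ : ∃ G : ℝ × (Fin d → ℝ) → ℝ≥0∞, ∀ q, G q =
      maxOver volume (expBox A) (fun b => F ((splitFirst d).symm (q.1, b))) q.2 :=
    ⟨_, fun _ => rfl⟩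
  have hGm : Measurable G := by
    rw [funext hG]
    exact measurable_maxOver_param volume (expBox A) hFe
  have hGm' : Measurable fun w : (Fin d → ℝ) × ℝ => G (w.2, w.1) := hGm.comp measurable_swap
  have hle : ∀ q, maxOver volume (expBox A) F ((splitFirst d).symm q) ≤
      maxOver volume (fun k : ℤ => closedBall (0 : ℝ) (A * Real.exp k))
        (fun a => G (a, q.2)) q.1 := fun q => by
    simpa only [hG] using maxOver_expBox_le A hF q
  have hH : Measurable fun w : (Fin d → ℝ) × ℝ =>
      maxOver volume (fun k : ℤ => closedBall (0 : ℝ) (A * Real.exp k))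
        (fun a => G (a, w.1)) w.2 :=
    measurable_maxOver_param volume (fun k : ℤ => closedBall (0 : ℝ) (A * Real.exp k)) hGm'
  have hH' : Measurable fun q : ℝ × (Fin d → ℝ) =>
      maxOver volume (fun k : ℤ => closedBall (0 : ℝ) (A * Real.exp k))
        (fun a => G (a, q.2)) q.1 := hH.comp measurable_swap
  have hms : MeasurableSet {x | 2 * t < maxOver volume (expBox A) F x} :=
    measurableSet_lt measurable_const (measurable_maxOver volume _ hF)
  calc volume {x | 2 * t < maxOver volume (expBox A) F x}
      = (volume.prod volume) ((splitFirst d).symm ⁻¹' {x | 2 * t < maxOver volume (expBox A) F x}) :=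
        (hmp.measure_preimage hms.nullMeasurableSet).symm
    _ ≤ (volume.prod volume) {q : ℝ × (Fin d → ℝ) | 2 * t < maxOver volume
          (fun k : ℤ => closedBall (0 : ℝ) (A * Real.exp k)) (fun a => G (a, q.2)) q.1} :=
        measure_mono fun q hq => lt_of_lt_of_le hq (hle q)
    _ = ∫⁻ b : Fin d → ℝ, volume {a : ℝ | 2 * t < maxOver volume
          (fun k : ℤ => closedBall (0 : ℝ) (A * Real.exp k)) (fun a => G (a, b)) a} := by
        rw [Measure.prod_apply_symm (measurableSet_lt measurable_const hH')]
        rfl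
    _ ≤ ∫⁻ b : Fin d → ℝ, 5 * (t⁻¹ ^ r * ∫⁻ a : ℝ, G (a, b) ^ r) := by
        refine lintegral_mono fun b => ?_
        have h := measure_two_mul_lt_maxOver_closedBall_le_rpow (E := ℝ) (μ := volume)
          (ρ := fun k : ℤ => A * Real.exp k) (fun k => mul_pos hA (Real.exp_pos _))
          (F := fun a => G (a, b)) (hGm.comp (measurable_id.prodMk measurable_const)) ht ht' hr.le
        rw [finrank_self, pow_one] at h
        exact h
    _ = 5 * (t⁻¹ ^ r * ∫⁻ a : ℝ, ∫⁻ b : Fin d → ℝ, G (a, b) ^ r) := by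
        have htr : t⁻¹ ^ r ≠ ∞ := ENNReal.rpow_ne_top_of_nonneg (by linarith)
          (ENNReal.inv_ne_top.2 ht)
        rw [lintegral_const_mul' _ _ (by finiteness), lintegral_const_mul' _ _ htr,
          lintegral_lintegral_swap]
        exact (hGm'.pow_const r).aemeasurable
    _ ≤ 5 * (t⁻¹ ^ r * ∫⁻ a : ℝ, (ENNReal.ofReal (40 / (r - 1)) ^ d *
            ∫⁻ b : Fin d → ℝ, F ((splitFirst d).symm (a, b)) ^ r)) := by
        gcongr with a
        simp only [hG]
        exact lintegral_maxOver_expBox_rpow_le hA hr hr2 d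
          (hFe.comp (measurable_const.prodMk measurable_id))
    _ = _ := by
        rw [lintegral_const_mul' _ _ (by finiteness), ← hmp.lintegral_comp (hF.pow_const r),
          lintegral_prod _ (hFe.pow_const r).aemeasurable]

/-- The exponent depends on the level: r = 1 + (q₀ - 1)/(1 + |ln v|). Then v^{-r} exceeds v^{-1} by
a bounded factor only, while (r - 1)^{-d} becomes a multiple of (1 + |ln v|)^d. -/
theorem measure_lt_maxOver_expBox_le_log {A : ℝ} (hA : 0 < A) (d : ℕ) {q₀ : ℝ} (hq : 1 < q₀)
    (hq2 : q₀ ≤ 2) :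
    ∃ C : ℝ≥0, ∀ {F : (Fin (d + 1) → ℝ) → ℝ≥0∞}, Measurable F → ∀ B : ℝ≥0∞,
      (∀ r : ℝ, 1 < r → r ≤ q₀ → ∫⁻ x, F x ^ r ≤ B) → ∀ v : ℝ, 0 < v →
      volume {x | ENNReal.ofReal v < maxOver volume (expBox A) F x}
        ≤ C * B * ENNReal.ofReal (v⁻¹ * (1 + |Real.log v|) ^ d) := by
  refine ⟨Real.toNNReal (10 * (2 * Real.exp 1) * (40 / (q₀ - 1)) ^ d), ?_⟩
  intro F hF B hB v hv
  have hq0 : 0 < q₀ - 1 := by linarith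
  set l := 1 + |Real.log v| with hl
  have hl1 : 1 ≤ l := by have := abs_nonneg (Real.log v); linarith
  set r := 1 + (q₀ - 1) / l with hr
  have hδ : 0 < (q₀ - 1) / l := by positivity
  have hδ1 : (q₀ - 1) / l ≤ q₀ - 1 := div_le_self hq0.le hl1
  have hr1 : 1 < r := by linarith
  have hr2 : r ≤ q₀ := by linarith
  have hv2 : (0 : ℝ) < v / 2 := by positivity
  have h := measure_two_mul_lt_maxOver_expBox_le hA hr1 (hr2.trans hq2) d hF
    (t := ENNReal.ofReal (v / 2)) (ENNReal.ofReal_pos.2 hv2).ne' ENNReal.ofReal_ne_top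
  have e : 2 * ENNReal.ofReal (v / 2) = ENNReal.ofReal v := by
    rw [show (2 : ℝ≥0∞) = ENNReal.ofReal 2 by simp, ← ENNReal.ofReal_mul (by norm_num)]
    congr 1; ring
  rw [e] at h
  refine h.trans ?_
  have h1 : (v / 2)⁻¹ ^ r ≤ v⁻¹ * (4 * Real.exp 1) := by
    have h2 : (v / 2)⁻¹ = v⁻¹ * 2 := by rw [inv_div]; ring
    rw [h2, Real.mul_rpow (by positivity) (by norm_num), hr, Real.rpow_add (by positivity),
      Real.rpow_one]
    have h3 : (v⁻¹) ^ ((q₀ - 1) / l) ≤ Real.exp 1 := by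
      rw [Real.rpow_def_of_pos (by positivity)]
      refine Real.exp_le_exp.2 ?_
      rw [Real.log_inv, ← mul_div_assoc, div_le_one (by positivity)]
      have h4 : -Real.log v ≤ |Real.log v| := neg_le_abs _
      nlinarith [abs_nonneg (Real.log v)]
    have h5 : (2 : ℝ) ^ (1 + (q₀ - 1) / l) ≤ 4 := by
      calc (2 : ℝ) ^ (1 + (q₀ - 1) / l) ≤ 2 ^ (2 : ℝ) :=
            Real.rpow_le_rpow_of_exponent_le (by norm_num) (by linarith)
        _ = 4 := by norm_num
    calc v⁻¹ * v⁻¹ ^ ((q₀ - 1) / l) * 2 ^ (1 + (q₀ - 1) / l) ≤ v⁻¹ * Real.exp 1 * 4 := by gcongr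
      _ = _ := by ring
  have h6 : (ENNReal.ofReal (v / 2))⁻¹ ^ r = ENNReal.ofReal ((v / 2)⁻¹ ^ r) := by
    rw [← ENNReal.ofReal_inv_of_pos hv2, ENNReal.ofReal_rpow_of_nonneg (by positivity)
      (by linarith)]
  have h7 : 40 / (r - 1) = 40 / (q₀ - 1) * l := by
    rw [show r - 1 = (q₀ - 1) / l by rw [hr]; ring, div_div_eq_mul_div]; ring
  rw [h6, h7, ← ENNReal.ofReal_pow (by positivity)]
  calc 5 * (ENNReal.ofReal ((v / 2)⁻¹ ^ r) * (ENNReal.ofReal ((40 / (q₀ - 1) * l) ^ d) *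
        ∫⁻ x, F x ^ r))
      ≤ 5 * (ENNReal.ofReal (v⁻¹ * (4 * Real.exp 1)) *
        (ENNReal.ofReal ((40 / (q₀ - 1) * l) ^ d) * B)) := by
        gcongr
        exact hB r hr1 hr2
    _ = ENNReal.ofReal (5 * (v⁻¹ * (4 * Real.exp 1) * ((40 / (q₀ - 1) * l) ^ d))) * B := by
        rw [show (5 : ℝ≥0∞) = ENNReal.ofReal 5 by simp, ← mul_assoc (ENNReal.ofReal (v⁻¹ * _)),
          ← ENNReal.ofReal_mul (by positivity), ← mul_assoc, ← ENNReal.ofReal_mul (by positivity)]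
    _ = ENNReal.ofReal (10 * (2 * Real.exp 1) * (40 / (q₀ - 1)) ^ d) *
        ENNReal.ofReal (v⁻¹ * l ^ d) * B := by
        rw [← ENNReal.ofReal_mul (by positivity), mul_pow]
        congr 2
        ring
    _ = _ := by
        rw [ENNReal.ofReal]
        ring

end StrongMaximal
end

noncomputable section

/-! ### Stochastic error at one bandwidth -/

section Noise

theorem ENNReal.tsum_pi_prod {ι : Type*} (g : ι → ℝ≥0∞) :
    ∀ d : ℕ, ∑' k : Fin d → ι, ∏ j, g (k j) = (∑' i, g i) ^ d := by
  intro d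
  induction d with
  | zero => simp
  | succ d ih =>
    rw [← (Fin.consEquiv fun _ => ι).tsum_eq, ENNReal.tsum_prod', pow_succ']
    simp only [Fin.consEquiv_apply, Fin.prod_univ_succ, Fin.cons_zero, Fin.cons_succ,
      ENNReal.tsum_mul_left, ENNReal.tsum_mul_right, ih]

theorem ENNReal.iSup_rpow_le_tsum {ι : Type*} (N : ι → ℝ≥0∞) {p : ℝ} (hp : 0 < p) :
    (⨆ i, N i) ^ p ≤ ∑' i, N i ^ p := by
  rw [← ENNReal.le_rpow_inv_iff hp]
  refine iSup_le fun i => ?_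
  rw [ENNReal.le_rpow_inv_iff hp]
  exact ENNReal.le_tsum i

theorem ENNReal.add_add_rpow_le (x y z : ℝ≥0∞) {p : ℝ} (hp : 0 ≤ p) :
    (x + y + z) ^ p ≤ 3 ^ p * (x ^ p + y ^ p + z ^ p) := by
  have h : x + y + z ≤ 3 * max (max x y) z := by
    calc x + y + z ≤ max (max x y) z + max (max x y) z + max (max x y) z := by
          gcongr
          · exact (le_max_left _ _).trans (le_max_left _ _)
          · exact (le_max_right _ _).trans (le_max_left _ _)
          · exact le_max_right _ _
      _ = _ := by ring
  refine (ENNReal.rpow_le_rpow h hp).trans ?_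
  rw [ENNReal.mul_rpow_of_nonneg _ _ hp]
  gcongr
  rcases max_choice (max x y) z with h1 | h1 <;> rw [h1]
  · rcases max_choice x y with h2 | h2 <;> rw [h2]
    · exact le_add_right le_self_add
    · exact le_add_right le_add_self
  · exact le_add_self

theorem ENNReal.lintegral_ite_const_rpow_le {Ω : Type*} [MeasurableSpace Ω] {Q : Measure Ω}
    {A : Set Ω} (hA : MeasurableSet A) {W : Ω → ℝ≥0∞} {c : ℝ≥0∞} (hW : ∀ᵐ ω ∂Q, W ω ≤ c) {p : ℝ}
    (hp : 0 < p) :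
    ∫⁻ ω, (A.indicator W ω) ^ p ∂Q ≤ c ^ p * Q A := by
  calc ∫⁻ ω, (A.indicator W ω) ^ p ∂Q ≤ ∫⁻ ω, A.indicator (fun _ => c ^ p) ω ∂Q := by
        refine lintegral_mono_ae ?_
        filter_upwards [hW] with ω hω
        by_cases h : ω ∈ A
        · simp only [Set.indicator_of_mem h]
          exact ENNReal.rpow_le_rpow hω hp.le
        · simp [Set.indicator_of_notMem h, ENNReal.zero_rpow_of_pos hp]
    _ = _ := lintegral_indicator_const hA _

/-- The majorant of a centred average with variance bound `s` and sup-norm bound `b`. -/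
def bernsteinBound (lam b : ℝ) (n : ℕ) (s : ℝ) : ℝ := √(2 * lam * s / n) + 4 / 3 * lam * b / n

theorem bernsteinBound_nonneg {lam b : ℝ} (hlam : 0 ≤ lam) (hb : 0 ≤ b) (n : ℕ) (s : ℝ) :
    0 ≤ bernsteinBound lam b n s := by
  unfold bernsteinBound
  positivity

/-- Crude size of the majorant, used on the rare events where empirical and true second moments
disagree; there only the probability of the event matters. -/
theorem bernsteinBound_le {lam b s : ℝ} (hlam : 1 ≤ lam) (hb : 0 ≤ b) {n : ℕ} (hn : 1 ≤ n)
    (hs : s ≤ b ^ 2) : bernsteinBound lam b n s ≤ 3 * lam * (b * (n : ℝ) ^ (-(1 / 2) : ℝ)) := by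
  have hn1 : (1 : ℝ) ≤ n := by exact_mod_cast hn
  have e : (n : ℝ) ^ (-(1 / 2) : ℝ) = (√n)⁻¹ := by
    rw [Real.rpow_neg (by positivity), Real.sqrt_eq_rpow]
  have h1 : √(2 * lam * s / n) ≤ 3 / 2 * lam * b * (√n)⁻¹ := by
    rw [Real.sqrt_div' _ (by positivity), div_eq_mul_inv]
    gcongr
    refine Real.sqrt_le_iff.2 ⟨by positivity, ?_⟩
    have : 2 * lam * s ≤ 2 * lam * b ^ 2 := by gcongr
    nlinarith [sq_nonneg b, mul_nonneg (sq_nonneg b) (by linarith : 0 ≤ lam),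
      mul_nonneg (mul_nonneg (sq_nonneg b) (by linarith : 0 ≤ lam)) (by linarith : 0 ≤ lam - 1)]
  have h2 : (n : ℝ)⁻¹ ≤ (√n)⁻¹ := by
    refine inv_anti₀ (by positivity) ?_
    rw [Real.sqrt_le_left (by positivity)]
    nlinarith
  have h3 : 4 / 3 * lam * b / n ≤ 4 / 3 * lam * b * (√n)⁻¹ := by
    rw [div_eq_mul_inv]
    gcongr
  rw [e, bernsteinBound]
  have : 0 ≤ lam * b * (√n)⁻¹ := by positivity
  nlinarith

theorem bernsteinBound_mul {lam b s : ℝ} (hb : 0 < b) {n : ℕ} (hn : 1 ≤ n) :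
    bernsteinBound lam b n s = b / n * (√(2 * lam * (n * (s / b ^ 2))) + 4 / 3 * lam) := by
  have hn1 : (0 : ℝ) < n := by exact_mod_cast hn
  rw [bernsteinBound, mul_add]
  congr 1
  · rw [← Real.sqrt_sq (by positivity : 0 ≤ b / n), ← Real.sqrt_mul (by positivity)]
    congr 1
    field_simp
  · ring

variable {d : ℕ}

/-- The sum of the three stochastic error terms at one bandwidth: the excess of the centred average
over its majorant, and the majorants on the events where they are not comparable to their empirical
counterparts. -/
def noiseTerm (P : Measure (Fin d → ℝ)) (m : (Fin d → ℝ) → ℝ) (lam b : ℝ) (n : ℕ)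
    (w : (Fin d → ℝ) × (Fin n → Fin d → ℝ)) : ℝ≥0∞ :=
  ENNReal.ofReal (|(n : ℝ)⁻¹ * ∑ i, m (w.2 i - w.1) - ∫ t, m (t - w.1) ∂P|
      - bernsteinBound lam b n (∫ t, m (t - w.1) ^ 2 ∂P))
    + {w : (Fin d → ℝ) × (Fin n → Fin d → ℝ) | 16 * ((n : ℝ)⁻¹ * ∑ i, m (w.2 i - w.1) ^ 2)
          + 8 * lam * b ^ 2 / n < ∫ t, m (t - w.1) ^ 2 ∂P}.indicator
        (fun w => ENNReal.ofReal (bernsteinBound lam b n (∫ t, m (t - w.1) ^ 2 ∂P))) w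
    + {w : (Fin d → ℝ) × (Fin n → Fin d → ℝ) | 2 * (∫ t, m (t - w.1) ^ 2 ∂P)
          + 2 * lam * b ^ 2 / n < (n : ℝ)⁻¹ * ∑ i, m (w.2 i - w.1) ^ 2}.indicator
        (fun w => ENNReal.ofReal (bernsteinBound lam b n ((n : ℝ)⁻¹ * ∑ i, m (w.2 i - w.1) ^ 2))) w

theorem measurable_integral_translate {P : Measure (Fin d → ℝ)} [SFinite P]
    {m : (Fin d → ℝ) → ℝ} (hm : Measurable m) : Measurable fun x => ∫ t, m (t - x) ∂P := by
  have : StronglyMeasurable fun w : (Fin d → ℝ) × (Fin d → ℝ) => m (w.2 - w.1) :=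
    (hm.comp (by fun_prop)).stronglyMeasurable
  exact this.integral_prod_right'.measurable

theorem measurable_sum_translate {m : (Fin d → ℝ) → ℝ} (hm : Measurable m) (n : ℕ) :
    Measurable fun w : (Fin d → ℝ) × (Fin n → Fin d → ℝ) => (n : ℝ)⁻¹ * ∑ i, m (w.2 i - w.1) := by
  refine Measurable.const_mul (Finset.measurable_fun_sum _ fun i _ => hm.comp ?_) _
  fun_prop

theorem measurable_noiseTerm {P : Measure (Fin d → ℝ)} [SFinite P]
    {m : (Fin d → ℝ) → ℝ} (hm : Measurable m) (lam b : ℝ) (n : ℕ) :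
    Measurable (noiseTerm P m lam b n) := by
  have hf : Measurable (Prod.fst : (Fin d → ℝ) × (Fin n → Fin d → ℝ) → Fin d → ℝ) := measurable_fst
  have h1 := (measurable_integral_translate (P := P) hm).comp hf
  have h2 := (measurable_integral_translate (P := P) (hm.pow_const 2)).comp hf
  have h3 := measurable_sum_translate hm n
  have h4 := measurable_sum_translate (hm.pow_const 2) n
  simp only [Function.comp_def] at h1 h2
  have h5 : ∀ {A : (Fin d → ℝ) × (Fin n → Fin d → ℝ) → ℝ}, Measurable A →
      Measurable fun w => bernsteinBound lam b n (A w) := fun hA => by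
    unfold bernsteinBound
    fun_prop
  exact (((h3.sub h1).abs.sub (h5 h2)).ennreal_ofReal.add
    ((h5 h2).ennreal_ofReal.indicator (measurableSet_lt ((h4.const_mul _).add_const _) h2))).add
    ((h5 h4).ennreal_ofReal.indicator (measurableSet_lt ((h2.const_mul _).add_const _) h4))

/-- Apply the three exponential inequalities to Y = m(· - x)/b. Each carries the second moment at x
as a factor, which makes the bound integrable in x. -/
theorem lintegral_noiseTerm_rpow_le {P : Measure (Fin d → ℝ)} [IsProbabilityMeasure P]
    (hP : P ≪ volume) {m : (Fin d → ℝ) → ℝ} (hm : Measurable m) {b : ℝ} (hb : 0 < b)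
    (hmb : ∀ᵐ t, |m t| ≤ b) {n : ℕ} (hn : 1 ≤ n) {lam p : ℝ} (hlam : 1 ≤ lam) (hp : 0 < p)
    (x : Fin d → ℝ) :
    ∫⁻ Z, noiseTerm P m lam b n (x, Z) ^ p ∂Measure.pi (fun _ => P)
      ≤ 3 ^ p * ENNReal.ofReal ((8 * p ^ p + 5 * (3 * lam) ^ p) * b ^ p * (n : ℝ) ^ (-(p / 2)) * n
        * Real.exp (-lam) / b ^ 2) * ENNReal.ofReal (∫ t, m (t - x) ^ 2 ∂P) := by
  have hn0 : (0 : ℝ) < n := by exact_mod_cast hn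
  set Y : (Fin d → ℝ) → ℝ := fun t => m (t - x) / b with hYdef
  have hmx : Measurable fun t => m (t - x) := hm.comp (by fun_prop)
  have hY : Measurable Y := hmx.div_const _
  have hY1 : ∀ᵐ t ∂P, |Y t| ≤ 1 := by
    have h1 : ∀ᵐ t, |m (t - x)| ≤ b :=
      (measurePreserving_sub_right volume x).quasiMeasurePreserving.ae hmb
    filter_upwards [hP.ae_le h1] with t ht
    rw [hYdef, abs_div, abs_of_pos hb, div_le_one hb]
    exact ht
  have hmY : ∀ t, m (t - x) = b * Y t := fun t => by rw [hYdef]; field_simp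
  set s := ∫ t, m (t - x) ^ 2 ∂P with hs
  have hs0 : 0 ≤ s := integral_nonneg fun _ => sq_nonneg _
  have hsY : ∫ t, Y t ^ 2 ∂P = s / b ^ 2 := by
    rw [hs]
    simp only [hmY, mul_pow]
    rw [integral_const_mul]
    field_simp
  have hsb : s ≤ b ^ 2 := by
    have h1 : ∫ t, Y t ^ 2 ∂P ≤ 1 := by
      have := integral_mono_of_nonneg (μ := P) (f := fun t => Y t ^ 2) (g := fun _ => (1 : ℝ))
        (Filter.Eventually.of_forall fun _ => sq_nonneg _) (integrable_const _) (by
          filter_upwards [hY1] with t ht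
          exact (sq_le_one_iff_abs_le_one _).2 ht)
      simpa using this
    rwa [hsY, div_le_one (by positivity)] at h1
  have hmean : ∫ t, m (t - x) ∂P = b * ∫ t, Y t ∂P := by
    simp only [hmY]
    rw [integral_const_mul]
  have hsum : ∀ Z : Fin n → Fin d → ℝ, (n : ℝ)⁻¹ * ∑ i, m (Z i - x) - ∫ t, m (t - x) ∂P
      = b / n * ∑ i, (Y (Z i) - ∫ t, Y t ∂P) := fun Z => by
    rw [hmean, Finset.sum_sub_distrib, Finset.sum_const, Finset.card_univ, Fintype.card_fin,
      nsmul_eq_mul]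
    simp only [hmY, ← Finset.mul_sum]
    field_simp
  have hsumsq : ∀ Z : Fin n → Fin d → ℝ, (n : ℝ)⁻¹ * ∑ i, m (Z i - x) ^ 2
      = b ^ 2 / n * ∑ i, Y (Z i) ^ 2 := fun Z => by
    simp only [hmY, mul_pow, ← Finset.mul_sum]
    ring
  set c := 3 * lam * (b * (n : ℝ) ^ (-(1 / 2) : ℝ)) with hc
  have hc0 : 0 ≤ c := by positivity
  have hcp : c ^ p = (3 * lam) ^ p * b ^ p * (n : ℝ) ^ (-(p / 2)) := by
    rw [hc, Real.mul_rpow (by positivity) (by positivity), Real.mul_rpow hb.le (by positivity),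
      ← Real.rpow_mul hn0.le, mul_assoc]
    congr 3
    ring
  have hslice : Measurable fun Z : Fin n → Fin d → ℝ => (x, Z) := measurable_prodMk_left
  have hsum4 : Measurable fun Z : Fin n → Fin d → ℝ => (n : ℝ)⁻¹ * ∑ i, m (Z i - x) ^ 2 :=
    (measurable_sum_translate (hm.pow_const 2) n).comp hslice
  -- the centred average
  have I1 : ∫⁻ Z : Fin n → Fin d → ℝ, ENNReal.ofReal (|(n : ℝ)⁻¹ * ∑ i, m (Z i - x)
      - ∫ t, m (t - x) ∂P| - bernsteinBound lam b n s) ^ p ∂Measure.pi (fun _ => P)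
      ≤ ENNReal.ofReal (8 * p ^ p * b ^ p * (n : ℝ) ^ (-(p / 2)) * n * Real.exp (-lam) / b ^ 2
        * s) := by
    have h := lintegral_bernstein_excess_le hY hY1 hn hlam hp
    rw [hsY] at h
    calc _ = ∫⁻ Z : Fin n → Fin d → ℝ, ENNReal.ofReal ((b / n) ^ p) *
            ENNReal.ofReal (|∑ i, (Y (Z i) - ∫ t, Y t ∂P)|
        - (√(2 * lam * (n * (s / b ^ 2))) + 4 / 3 * lam)) ^ p ∂Measure.pi (fun _ => P) := by
          refine lintegral_congr fun Z => ?_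
          rw [hsum, bernsteinBound_mul hb hn, abs_mul, abs_of_pos (by positivity : 0 < b / n),
            ← mul_sub, ENNReal.ofReal_mul (by positivity), ENNReal.mul_rpow_of_nonneg _ _ hp.le,
            ENNReal.ofReal_rpow_of_nonneg (by positivity) hp.le]
      _ ≤ ENNReal.ofReal ((b / n) ^ p) * ENNReal.ofReal (8 * p ^ p * (n : ℝ) ^ (p / 2)
            * (n * (s / b ^ 2)) * Real.exp (-lam)) := by
          rw [lintegral_const_mul' _ _ ENNReal.ofReal_ne_top]
          gcongr
      _ = _ := by
          rw [← ENNReal.ofReal_mul (by positivity)]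
          congr 1
          have e : (b / n) ^ p * (n : ℝ) ^ (p / 2) = b ^ p * (n : ℝ) ^ (-(p / 2)) := by
            rw [Real.div_rpow hb.le hn0.le, div_mul_eq_mul_div, mul_div_assoc, ← Real.rpow_sub hn0]
            congr 2
            ring
          calc _ = 8 * p ^ p * ((b / n) ^ p * (n : ℝ) ^ (p / 2)) * (n * (s / b ^ 2))
                  * Real.exp (-lam) := by ring
            _ = _ := by rw [e]; ring
  -- the majorant on the event where the empirical second moment is too small
  have I2 : ∫⁻ Z : Fin n → Fin d → ℝ, ({Z : Fin n → Fin d → ℝ |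
        16 * ((n : ℝ)⁻¹ * ∑ i, m (Z i - x) ^ 2) + 8 * lam * b ^ 2 / n < s}.indicator
        (fun _ => ENNReal.ofReal (bernsteinBound lam b n s)) Z) ^ p ∂Measure.pi (fun _ => P)
      ≤ ENNReal.ofReal ((3 * lam) ^ p * b ^ p * (n : ℝ) ^ (-(p / 2)) * n * Real.exp (-lam) / b ^ 2
        * s) := by
    refine (ENNReal.lintegral_ite_const_rpow_le (c := ENNReal.ofReal c)
      (measurableSet_lt ((hsum4.const_mul _).add_const _) measurable_const)
      (Filter.Eventually.of_forall fun Z => ENNReal.ofReal_le_ofReal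
        (bernsteinBound_le hlam hb.le hn hsb)) hp).trans ?_
    have h := measure_sum_sq_small_le hY hY1 n hlam
    rw [hsY] at h
    have hset : {Z : Fin n → Fin d → ℝ | 16 * ((n : ℝ)⁻¹ * ∑ i, m (Z i - x) ^ 2)
        + 8 * lam * b ^ 2 / n < s} = {Z | 16 * ∑ i, Y (Z i) ^ 2 + 8 * lam < n * (s / b ^ 2)} := by
      ext Z
      simp only [Set.mem_ofPred_eq, hsumsq]
      have e1 : 16 * (b ^ 2 / n * ∑ i, Y (Z i) ^ 2) + 8 * lam * b ^ 2 / n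
        = b ^ 2 / n * (16 * ∑ i, Y (Z i) ^ 2 + 8 * lam) := by ring
      have e2 : s = b ^ 2 / n * (n * (s / b ^ 2)) := by field_simp
      rw [e1]
      conv_lhs => rw [e2]
      exact mul_lt_mul_iff_right₀ (by positivity)
    rw [hset]
    calc _ ≤ ENNReal.ofReal c ^ p * ENNReal.ofReal (n * (s / b ^ 2) * Real.exp (-lam)) := by gcongr
      _ = _ := by
          rw [ENNReal.ofReal_rpow_of_nonneg hc0 hp.le, ← ENNReal.ofReal_mul (by positivity), hcp]
          congr 1
          ring
  -- the empirical majorant on the event where the empirical second moment is too large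
  have I3 : ∫⁻ Z : Fin n → Fin d → ℝ, ({Z : Fin n → Fin d → ℝ |
        2 * s + 2 * lam * b ^ 2 / n < (n : ℝ)⁻¹ * ∑ i, m (Z i - x) ^ 2}.indicator
        (fun Z => ENNReal.ofReal (bernsteinBound lam b n ((n : ℝ)⁻¹ * ∑ i, m (Z i - x) ^ 2))) Z) ^ p
        ∂Measure.pi (fun _ => P)
      ≤ ENNReal.ofReal (4 * (3 * lam) ^ p * b ^ p * (n : ℝ) ^ (-(p / 2)) * n * Real.exp (-lam)
        / b ^ 2 * s) := by
    refine (ENNReal.lintegral_ite_const_rpow_le (c := ENNReal.ofReal c)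
      (measurableSet_lt measurable_const hsum4) ?_ hp).trans ?_
    · filter_upwards [ae_pi_of_ae (ι := Fin n) hY1] with Z hZ
      refine ENNReal.ofReal_le_ofReal (bernsteinBound_le hlam hb.le hn ?_)
      rw [hsumsq]
      have h1 : ∑ i, Y (Z i) ^ 2 ≤ n := by
        calc ∑ i, Y (Z i) ^ 2 ≤ ∑ _i : Fin n, (1 : ℝ) :=
              Finset.sum_le_sum fun i _ => (sq_le_one_iff_abs_le_one _).2 (hZ i)
          _ = n := by simp
      rw [div_mul_eq_mul_div, div_le_iff₀ hn0]
      gcongr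
    have h := measure_sum_sq_large_le hY hY1 n hlam
    rw [hsY] at h
    have hset : {Z : Fin n → Fin d → ℝ | 2 * s + 2 * lam * b ^ 2 / n
        < (n : ℝ)⁻¹ * ∑ i, m (Z i - x) ^ 2}
        = {Z | 2 * (n * (s / b ^ 2)) + 2 * lam < ∑ i, Y (Z i) ^ 2} := by
      ext Z
      simp only [Set.mem_ofPred_eq, hsumsq]
      have e1 : 2 * s + 2 * lam * b ^ 2 / n = b ^ 2 / n * (2 * (n * (s / b ^ 2)) + 2 * lam) := by
        field_simp
      rw [e1]
      exact mul_lt_mul_iff_right₀ (by positivity)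
    rw [hset]
    calc _ ≤ ENNReal.ofReal c ^ p * ENNReal.ofReal (4 * (n * (s / b ^ 2)) * Real.exp (-lam)) := by
          gcongr
      _ = _ := by
          rw [ENNReal.ofReal_rpow_of_nonneg hc0 hp.le, ← ENNReal.ofReal_mul (by positivity), hcp]
          congr 1
          ring
  have hmeas1 : Measurable fun Z : Fin n → Fin d → ℝ => ENNReal.ofReal (|(n : ℝ)⁻¹ *
      ∑ i, m (Z i - x) - ∫ t, m (t - x) ∂P| - bernsteinBound lam b n s) ^ p := by
    have h3 := (measurable_sum_translate hm n).comp hslice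
    exact ((((h3.sub_const _).abs).sub_const _).ennreal_ofReal).pow_const p
  have hmeas2 : Measurable fun Z : Fin n → Fin d → ℝ => ({Z : Fin n → Fin d → ℝ |
        16 * ((n : ℝ)⁻¹ * ∑ i, m (Z i - x) ^ 2) + 8 * lam * b ^ 2 / n < s}.indicator
        (fun _ => ENNReal.ofReal (bernsteinBound lam b n s)) Z) ^ p :=
    (measurable_const.indicator
      (measurableSet_lt ((hsum4.const_mul _).add_const _) measurable_const)).pow_const p
  have hmeas12 : Measurable fun Z : Fin n → Fin d → ℝ => ENNReal.ofReal (|(n : ℝ)⁻¹ *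
      ∑ i, m (Z i - x) - ∫ t, m (t - x) ∂P| - bernsteinBound lam b n s) ^ p
      + ({Z : Fin n → Fin d → ℝ |
        16 * ((n : ℝ)⁻¹ * ∑ i, m (Z i - x) ^ 2) + 8 * lam * b ^ 2 / n < s}.indicator
        (fun _ => ENNReal.ofReal (bernsteinBound lam b n s)) Z) ^ p := hmeas1.add hmeas2
  calc _ ≤ ∫⁻ Z : Fin n → Fin d → ℝ, 3 ^ p * (ENNReal.ofReal (|(n : ℝ)⁻¹ * ∑ i, m (Z i - x)
      - ∫ t, m (t - x) ∂P| - bernsteinBound lam b n s) ^ p + ({Z : Fin n → Fin d → ℝ |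
        16 * ((n : ℝ)⁻¹ * ∑ i, m (Z i - x) ^ 2) + 8 * lam * b ^ 2 / n < s}.indicator
        (fun _ => ENNReal.ofReal (bernsteinBound lam b n s)) Z) ^ p + ({Z : Fin n → Fin d → ℝ |
        2 * s + 2 * lam * b ^ 2 / n < (n : ℝ)⁻¹ * ∑ i, m (Z i - x) ^ 2}.indicator
        (fun Z => ENNReal.ofReal (bernsteinBound lam b n ((n : ℝ)⁻¹ * ∑ i, m (Z i - x) ^ 2))) Z)
        ^ p) ∂Measure.pi (fun _ => P) :=
        lintegral_mono fun Z => ENNReal.add_add_rpow_le _ _ _ hp.le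
    _ ≤ 3 ^ p * (ENNReal.ofReal (8 * p ^ p * b ^ p * (n : ℝ) ^ (-(p / 2)) * n * Real.exp (-lam)
          / b ^ 2 * s) + ENNReal.ofReal ((3 * lam) ^ p * b ^ p * (n : ℝ) ^ (-(p / 2)) * n
          * Real.exp (-lam) / b ^ 2 * s) + ENNReal.ofReal (4 * (3 * lam) ^ p * b ^ p
          * (n : ℝ) ^ (-(p / 2)) * n * Real.exp (-lam) / b ^ 2 * s)) := by
        rw [lintegral_const_mul' _ _ (by finiteness), lintegral_add_left hmeas12,
          lintegral_add_left hmeas1]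
        gcongr
    _ = _ := by
        rw [← ENNReal.ofReal_add (by positivity) (by positivity),
          ← ENNReal.ofReal_add (by positivity) (by positivity), mul_assoc (3 ^ p : ℝ≥0∞),
          ← ENNReal.ofReal_mul (by positivity)]
        congr 2
        ring

/-- By Tonelli and translation invariance the total second moment does not depend on the law of the
observations; hence the noise constant does not depend on f. -/
theorem lintegral_integral_sq_translate {P : Measure (Fin d → ℝ)} [IsProbabilityMeasure P]
    (hP : P ≪ volume) {m : (Fin d → ℝ) → ℝ} (hm : Measurable m) {b : ℝ}
    (hmb : ∀ᵐ t, |m t| ≤ b) :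
    ∫⁻ x, ENNReal.ofReal (∫ t, m (t - x) ^ 2 ∂P) = ∫⁻ t, ENNReal.ofReal (m t ^ 2) := by
  have h1 : ∀ x, ENNReal.ofReal (∫ t, m (t - x) ^ 2 ∂P)
      = ∫⁻ t, ENNReal.ofReal (m (t - x) ^ 2) ∂P := fun x => by
    have hmx : Measurable fun t => m (t - x) := hm.comp (by fun_prop)
    refine ofReal_integral_eq_lintegral_ofReal ?_ (Filter.Eventually.of_forall fun _ => sq_nonneg _)
    refine Integrable.of_bound (hmx.pow_const 2).aestronglyMeasurable (b ^ 2) ?_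
    have h1 : ∀ᵐ t, |m (t - x)| ≤ b :=
      (measurePreserving_sub_right volume x).quasiMeasurePreserving.ae hmb
    filter_upwards [hP.ae_le h1] with t ht
    rw [norm_pow, Real.norm_eq_abs]
    exact pow_le_pow_left₀ (abs_nonneg _) ht 2
  simp only [h1]
  rw [lintegral_lintegral_swap]
  · have h2 : ∀ t, ∫⁻ x, ENNReal.ofReal (m (t - x) ^ 2) = ∫⁻ y, ENNReal.ofReal (m y ^ 2) :=
      fun t => lintegral_sub_left_eq_self (fun y => ENNReal.ofReal (m y ^ 2)) t
    simp [h2]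
  · have : Measurable fun w : (Fin d → ℝ) × (Fin d → ℝ) => ENNReal.ofReal (m (w.2 - w.1) ^ 2) :=
      ((hm.comp (by fun_prop)).pow_const 2).ennreal_ofReal
    exact this.aemeasurable

end Noise
end

/-! ### Empirical against true majorants, and the noise over all bandwidths -/

noncomputable section

/-- With B = λb/n, the root grows at most to 4 times the root at s' plus 4B. The constants 16 and 8
are matched to the linear term: 4 + 4/3 = 4·(4/3). -/
theorem bernsteinBound_le_four_mul {lam b s s' : ℝ} {n : ℕ} (hlam : 0 ≤ lam) (hb : 0 ≤ b)
    (hs' : 0 ≤ s') (h : s ≤ 16 * s' + 8 * lam * b ^ 2 / n) :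
    bernsteinBound lam b n s ≤ 4 * bernsteinBound lam b n s' := by
  have h1 : √(2 * lam * s / n) ≤ 4 * √(2 * lam * s' / n) + 4 * (lam * b / n) := by
    refine Real.sqrt_le_iff.2 ⟨by positivity, ?_⟩
    have e : √(2 * lam * s' / n) ^ 2 = 2 * lam * s' / n := Real.sq_sqrt (by positivity)
    have e0 : 0 ≤ √(2 * lam * s' / n) * (lam * b / n) := by positivity
    calc 2 * lam * s / n ≤ 2 * lam * (16 * s' + 8 * lam * b ^ 2 / n) / n := by gcongr
      _ = 16 * (2 * lam * s' / n) + 16 * (lam * b / n) ^ 2 := by ring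
      _ ≤ _ := by nlinarith
  unfold bernsteinBound
  have e : 4 / 3 * lam * b / n = 4 / 3 * (lam * b / n) := by ring
  rw [e]
  linarith

theorem bernsteinBound_le_three_mul {lam b s s' : ℝ} {n : ℕ} (hlam : 0 ≤ lam) (hb : 0 ≤ b)
    (hs : 0 ≤ s) (h : s' ≤ 2 * s + 2 * lam * b ^ 2 / n) :
    bernsteinBound lam b n s' ≤ 3 * bernsteinBound lam b n s := by
  have h1 : √(2 * lam * s' / n) ≤ 2 * √(2 * lam * s / n) + 2 * (lam * b / n) := by
    refine Real.sqrt_le_iff.2 ⟨by positivity, ?_⟩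
    have e : √(2 * lam * s / n) ^ 2 = 2 * lam * s / n := Real.sq_sqrt (by positivity)
    have e0 : 0 ≤ √(2 * lam * s / n) * (lam * b / n) := by positivity
    have e1 : 0 ≤ 2 * lam * s / n := by positivity
    calc 2 * lam * s' / n ≤ 2 * lam * (2 * s + 2 * lam * b ^ 2 / n) / n := by gcongr
      _ = 2 * (2 * lam * s / n) + 4 * (lam * b / n) ^ 2 := by ring
      _ ≤ _ := by nlinarith
  unfold bernsteinBound
  have e : 4 / 3 * lam * b / n = 4 / 3 * (lam * b / n) := by ring
  have e0 : 0 ≤ lam * b / n := by positivity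
  have e1 : 0 ≤ √(2 * lam * s / n) := by positivity
  rw [e]
  linarith

section Pointwise

variable {d : ℕ} {P : Measure (Fin d → ℝ)} {m : (Fin d → ℝ) → ℝ} {lam b : ℝ} {n : ℕ}

/-- Unless the empirical second moment is too small, four empirical majorants dominate the true one.
In the exceptional case the second summand of `noiseTerm` supplies the true majorant itself. -/
theorem ofReal_excess_le_noiseTerm (hlam : 0 ≤ lam) (hb : 0 ≤ b) (x : Fin d → ℝ)
    (Z : Fin n → Fin d → ℝ) :
    ENNReal.ofReal (|(n : ℝ)⁻¹ * ∑ i, m (Z i - x) - ∫ t, m (t - x) ∂P|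
      - 4 * bernsteinBound lam b n ((n : ℝ)⁻¹ * ∑ i, m (Z i - x) ^ 2))
      ≤ noiseTerm P m lam b n (x, Z) := by
  have hs' : 0 ≤ (n : ℝ)⁻¹ * ∑ i, m (Z i - x) ^ 2 := by positivity
  have h0 := bernsteinBound_nonneg hlam hb n ((n : ℝ)⁻¹ * ∑ i, m (Z i - x) ^ 2)
  refine le_trans ?_ le_self_add
  by_cases h : 16 * ((n : ℝ)⁻¹ * ∑ i, m (Z i - x) ^ 2) + 8 * lam * b ^ 2 / n
      < ∫ t, m (t - x) ^ 2 ∂P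
  · rw [Set.indicator_of_mem (by exact h)]
    refine le_trans (ENNReal.ofReal_le_ofReal ?_) ENNReal.ofReal_add_le
    dsimp only
    linarith
  · refine le_trans (ENNReal.ofReal_le_ofReal ?_) le_self_add
    have := bernsteinBound_le_four_mul hlam hb hs' (not_lt.1 h)
    dsimp only
    linarith

theorem ofReal_empirical_le_noiseTerm (hlam : 0 ≤ lam) (hb : 0 ≤ b) (x : Fin d → ℝ)
    (Z : Fin n → Fin d → ℝ) :
    ENNReal.ofReal (bernsteinBound lam b n ((n : ℝ)⁻¹ * ∑ i, m (Z i - x) ^ 2))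
      ≤ noiseTerm P m lam b n (x, Z)
        + ENNReal.ofReal (3 * bernsteinBound lam b n (∫ t, m (t - x) ^ 2 ∂P)) := by
  have hs : 0 ≤ ∫ t, m (t - x) ^ 2 ∂P := integral_nonneg fun _ => sq_nonneg _
  by_cases h : 2 * (∫ t, m (t - x) ^ 2 ∂P) + 2 * lam * b ^ 2 / n
      < (n : ℝ)⁻¹ * ∑ i, m (Z i - x) ^ 2
  · refine le_trans ?_ le_self_add
    rw [noiseTerm]
    nth_rewrite 2 [Set.indicator_of_mem (by exact h)]
    exact le_add_self
  · refine le_trans (ENNReal.ofReal_le_ofReal ?_) le_add_self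
    exact bernsteinBound_le_three_mul hlam hb hs (not_lt.1 h)

end Pointwise

namespace ConvModel

/-- The vector of bandwidths with logarithms `k`. -/
def expVec {d : ℕ} (k : Fin d → ℤ) : Fin d → ℝ := fun j => Real.exp (k j)

variable {d : ℕ}

theorem expVec_pos (k : Fin d → ℤ) (j : Fin d) : 0 < expVec k j := Real.exp_pos _

theorem expVec_mem_grid (k : Fin d → ℤ) : expVec k ∈ grid d := fun j => ⟨k j, rfl⟩

theorem log_expVec (k : Fin d → ℤ) (j : Fin d) : Real.log (expVec k j) = k j := Real.log_exp _

theorem exists_expVec {h : Fin d → ℝ} (hh : h ∈ grid d) : ∃ k, h = expVec k := by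
  choose k hk using hh
  exact ⟨k, funext hk⟩

theorem expVec_sup (k l : Fin d → ℤ) : expVec k ⊔ expVec l = expVec (k ⊔ l) := by
  funext j
  simp only [expVec, Pi.sup_apply]
  rw [Int.cast_max, Real.exp_monotone.map_max]

theorem one_le_log_natCast {n : ℕ} (hn : 3 ≤ n) : 1 ≤ Real.log n := by
  rw [Real.le_log_iff_exp_le (by positivity)]
  have : (3 : ℝ) ≤ n := by exact_mod_cast hn
  linarith [Real.exp_one_lt_d9]

namespace Model

variable (S : Model d)

theorem one_le_Minf : 1 ≤ S.Minf := le_max_right _ _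

theorem six_log_le_lamN (p : ℝ) (n : ℕ) (h : Fin d → ℝ) : 6 * Real.log n + (8 * p + 26) * ∑ j, (1 + S.lam j) * |Real.log (h j)|
      ≤ S.lamN p n h := by
  have := Real.log_nonneg S.one_le_Minf
  unfold lamN
  linarith

theorem six_le_lamN (hnoise : S.NoiseAssumption) {p : ℝ} (hp : 1 < p) {n : ℕ} (hn : 3 ≤ n)
    (h : Fin d → ℝ) : 6 ≤ S.lamN p n h := by
  refine le_trans ?_ (S.six_log_le_lamN p n h)
  have h1 := one_le_log_natCast hn
  have h2 : 0 ≤ ∑ j, (1 + S.lam j) * |Real.log (h j)| :=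
    Finset.sum_nonneg fun j _ => by have := S.lam_nonneg hnoise j; positivity
  nlinarith

theorem Uhat_eq (p : ℝ) (M : (Fin d → ℝ) → (Fin d → ℝ) → ℝ) {n : ℕ} (Z : Fin n → Fin d → ℝ)
    (x h : Fin d → ℝ) : S.Uhat p M Z x h = bernsteinBound (S.lamN p n h) (S.Minf / S.wt h) n
      ((n : ℝ)⁻¹ * ∑ i, M (Z i - x) h ^ 2) := by
  unfold Uhat bernsteinBound sigmaHatSq wt
  congr 1
  rw [mul_comm (3 : ℝ)]
  simp only [div_eq_mul_inv, mul_inv]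
  ring

/-- The theoretical counterpart `U_n(x, h)` of the empirical majorant. -/
def U (p : ℝ) (P : Measure (Fin d → ℝ)) (M : (Fin d → ℝ) → (Fin d → ℝ) → ℝ) (n : ℕ)
    (x h : Fin d → ℝ) : ℝ :=
  bernsteinBound (S.lamN p n h) (S.Minf / S.wt h) n (∫ t, M (t - x) h ^ 2 ∂P)

/-- The supremum over the bandwidths of the stochastic errors. -/
def noise (p : ℝ) (P : Measure (Fin d → ℝ)) (M : (Fin d → ℝ) → (Fin d → ℝ) → ℝ) (n : ℕ)
    (w : (Fin d → ℝ) × (Fin n → Fin d → ℝ)) : ℝ≥0∞ :=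
  ⨆ k : Fin d → ℤ, noiseTerm P (fun y => M y (expVec k)) (S.lamN p n (expVec k))
    (S.Minf / S.wt (expVec k)) n w

section

variable {S} {p : ℝ} {P : Measure (Fin d → ℝ)} {M : (Fin d → ℝ) → (Fin d → ℝ) → ℝ} {n : ℕ}

theorem ofReal_excess_le_noise (hnoise : S.NoiseAssumption) (hp : 1 < p) (hn : 3 ≤ n)
    (Z : Fin n → Fin d → ℝ) (x : Fin d → ℝ) {h : Fin d → ℝ} (hh : h ∈ grid d) :
    ENNReal.ofReal (|fhat M Z x h - ∫ t, M (t - x) h ∂P| - 4 * S.Uhat p M Z x h)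
      ≤ S.noise p P M n (x, Z) := by
  obtain ⟨k, rfl⟩ := exists_expVec hh
  rw [Uhat_eq]
  refine (ofReal_excess_le_noiseTerm (m := fun y => M y (expVec k)) ?_ ?_ x Z).trans
    (le_iSup (fun k => noiseTerm P (fun y => M y (expVec k)) (S.lamN p n (expVec k))
    (S.Minf / S.wt (expVec k)) n (x, Z)) k)
  · linarith [S.six_le_lamN hnoise hp hn (expVec k)]
  · exact div_nonneg (by linarith [S.one_le_Minf]) (S.wt_pos (expVec_pos k)).le

theorem ofReal_Uhat_le (hnoise : S.NoiseAssumption) (hp : 1 < p) (hn : 3 ≤ n)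
    (Z : Fin n → Fin d → ℝ) (x : Fin d → ℝ) {h : Fin d → ℝ} (hh : h ∈ grid d) :
    ENNReal.ofReal (S.Uhat p M Z x h)
      ≤ S.noise p P M n (x, Z) + ENNReal.ofReal (3 * S.U p P M n x h) := by
  obtain ⟨k, rfl⟩ := exists_expVec hh
  rw [Uhat_eq]
  refine (ofReal_empirical_le_noiseTerm (P := P) (m := fun y => M y (expVec k)) ?_ ?_ x Z).trans
    (add_le_add_left (le_iSup (fun k => noiseTerm P (fun y => M y (expVec k))
      (S.lamN p n (expVec k)) (S.Minf / S.wt (expVec k)) n (x, Z)) k) _)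
  · linarith [S.six_le_lamN hnoise hp hn (expVec k)]
  · exact div_nonneg (by linarith [S.one_le_Minf]) (S.wt_pos (expVec_pos k)).le

theorem measurable_noise [SFinite P] (hM : ∀ h ∈ grid d, S.IsSolution h fun y => M y h) :
    Measurable (S.noise p P M n) :=
  Measurable.iSup fun k => measurable_noiseTerm (hM _ (expVec_mem_grid k)).measurable _ _ _

end

theorem exp_neg_le_wt (hnoise : S.NoiseAssumption) (k : Fin d → ℤ) :
    Real.exp (-∑ j, (1 + S.lam j) * |Real.log (expVec k j)|) ≤ S.wt (expVec k) ∧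
    S.wt (expVec k) ≤ Real.exp (∑ j, (1 + S.lam j) * |Real.log (expVec k j)|) ∧
    Real.exp (-(2 * ∑ j, (1 + S.lam j) * |Real.log (expVec k j)|)) ≤ S.wtSq (expVec k) := by
  have hmin : ∀ j, min (expVec k j) 1 = Real.exp (min (k j : ℝ) 0) := fun j => by
    rw [Real.exp_monotone.map_min, Real.exp_zero]; rfl
  have e : ∀ j, min (expVec k j) 1 ^ S.lam j = Real.exp (min (k j : ℝ) 0 * S.lam j) := fun j => by
    rw [hmin, ← Real.exp_mul]
  have hl := S.lam_nonneg hnoise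
  have h1 : ∀ j, -(|(k j : ℝ)|) ≤ min (k j : ℝ) 0 := fun j =>
    le_min (neg_abs_le _) (by simp)
  have h2 : ∀ j, min (k j : ℝ) 0 ≤ 0 := fun j => min_le_right _ _
  unfold wt wtSq
  simp only [log_expVec, e]
  simp only [expVec, ← Real.exp_add, ← Real.exp_nat_mul, ← Real.exp_sum, Real.exp_le_exp,
    ← Finset.sum_neg_distrib, Finset.mul_sum]
  refine ⟨Finset.sum_le_sum fun j _ => ?_, Finset.sum_le_sum fun j _ => ?_,
    Finset.sum_le_sum fun j _ => ?_⟩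
  · nlinarith [h1 j, hl j, neg_abs_le (k j : ℝ)]
  · nlinarith [h2 j, hl j, le_abs_self (k j : ℝ), abs_nonneg (k j : ℝ)]
  · push_cast
    nlinarith [h1 j, hl j, neg_abs_le (k j : ℝ), abs_nonneg (k j : ℝ)]

/-- Budget of e^{-λ_n(h)}, with L = ∑(1+λⱼ)|ln hⱼ|: half of it absorbs (3λ_n)^p. The other half is
at most e^{-3 ln n - (4p+13)L}, which pays for the factor n and for the norms of M, of size
e^{(p+4)L}, and still leaves e^{-L} ≤ ∏ e^{-|kⱼ|} for the summation over the grid. -/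
theorem noise_constant_le (hnoise : S.NoiseAssumption) (hkernel : S.KernelAssumption) {p : ℝ}
    (hp : 1 < p) {n : ℕ} (hn : 3 ≤ n) (k : Fin d → ℤ) :
    (8 * p ^ p + 5 * (3 * S.lamN p n (expVec k)) ^ p) * (S.Minf / S.wt (expVec k)) ^ p
        * (n : ℝ) ^ (-(p / 2)) * n * Real.exp (-S.lamN p n (expVec k))
        / (S.Minf / S.wt (expVec k)) ^ 2 * (S.solConst / S.wtSq (expVec k))
      ≤ (8 * p ^ p + 5 * (6 ^ p * p ^ p)) * S.Minf ^ p * S.solConst * (n : ℝ) ^ (-(p / 2))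
        * ∏ j, Real.exp (-|(k j : ℝ)|) := by
  obtain ⟨w1, w2, w3⟩ := S.exp_neg_le_wt hnoise k
  have hw := S.wt_pos (expVec_pos k)
  have hwS := S.wtSq_pos (expVec_pos k)
  have hlam := S.six_log_le_lamN p n (expVec k)
  have hlam6 := S.six_le_lamN hnoise hp hn (expVec k)
  have hM := S.one_le_Minf
  have hsol := S.solConst_pos hnoise hkernel
  set w := S.wt (expVec k)
  set wS := S.wtSq (expVec k)
  set lam := S.lamN p n (expVec k)
  set L := ∑ j, (1 + S.lam j) * |Real.log (expVec k j)| with hL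
  have hn0 : (0 : ℝ) < n := by positivity
  have hlogn := one_le_log_natCast hn
  have hkL : ∑ j, |(k j : ℝ)| ≤ L := Finset.sum_le_sum fun j _ => by
    rw [log_expVec]
    nlinarith [S.lam_nonneg hnoise j, abs_nonneg (k j : ℝ)]
  have hk0 : 0 ≤ ∑ j, |(k j : ℝ)| := by positivity
  have hL0 := hk0.trans hkL
  have a1 : (8 * p ^ p + 5 * (3 * lam) ^ p)
      ≤ (8 * p ^ p + 5 * (6 ^ p * p ^ p)) * Real.exp (lam / 2) := by
    have h1 := rpow_le_rpow_mul_exp (x := lam / 2) (p := p) (by linarith) (by linarith)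
    have e1 : (3 * lam) ^ p = 6 ^ p * (lam / 2) ^ p := by
      rw [← Real.mul_rpow (by norm_num) (by linarith)]
      congr 1
      ring
    have h2 : 1 ≤ Real.exp (lam / 2) := Real.one_le_exp (by linarith)
    have h3 : 0 ≤ p ^ p := by positivity
    have h4 : 6 ^ p * (lam / 2) ^ p ≤ 6 ^ p * (p ^ p * Real.exp (lam / 2)) := by gcongr
    rw [e1]
    nlinarith
  have a2 : (S.Minf / w) ^ p / (S.Minf / w) ^ 2 * wS⁻¹ ≤ S.Minf ^ p * Real.exp ((p + 4) * L) := by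
    have h1 : w⁻¹ ≤ Real.exp L := by
      rw [inv_le_comm₀ hw (Real.exp_pos _), ← Real.exp_neg]
      exact w1
    have h2 : wS⁻¹ ≤ Real.exp (2 * L) := by
      rw [inv_le_comm₀ hwS (Real.exp_pos _), ← Real.exp_neg]
      exact w3
    have h3 : (S.Minf / w) ^ p / (S.Minf / w) ^ 2 * wS⁻¹
        = S.Minf ^ p * (S.Minf ^ 2)⁻¹ * (w⁻¹ ^ p * w ^ 2 * wS⁻¹) := by
      rw [div_eq_mul_inv S.Minf, Real.mul_rpow (by linarith) (by positivity)]
      field_simp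
    have h4 : (S.Minf ^ 2)⁻¹ ≤ 1 := inv_le_one_of_one_le₀ (one_le_pow₀ hM)
    have h5 : Real.exp ((p + 4) * L) = Real.exp L ^ p * Real.exp L ^ 2 * Real.exp (2 * L) := by
      rw [← Real.exp_mul, ← Real.exp_nat_mul, ← Real.exp_add, ← Real.exp_add]
      congr 1
      push_cast
      ring
    rw [h3, h5]
    calc _ ≤ S.Minf ^ p * 1 * (Real.exp L ^ p * Real.exp L ^ 2 * Real.exp (2 * L)) := by gcongr
      _ = _ := by ring
  have a3 : n * Real.exp (-lam) * Real.exp (lam / 2) * Real.exp ((p + 4) * L)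
      ≤ ∏ j, Real.exp (-|(k j : ℝ)|) := by
    rw [← Real.exp_sum, Finset.sum_neg_distrib]
    nth_rewrite 1 [← Real.exp_log hn0]
    rw [← Real.exp_add, ← Real.exp_add, ← Real.exp_add, Real.exp_le_exp]
    nlinarith [mul_nonneg (by linarith : 0 ≤ p) hL0]
  have hprod : 0 ≤ ∏ j, Real.exp (-|(k j : ℝ)|) := by positivity
  calc _ = (8 * p ^ p + 5 * (3 * lam) ^ p) * ((S.Minf / w) ^ p / (S.Minf / w) ^ 2 * wS⁻¹)
        * (S.solConst * (n : ℝ) ^ (-(p / 2)) * (n * Real.exp (-lam))) := by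
        rw [div_eq_mul_inv _ wS]; ring
    _ ≤ ((8 * p ^ p + 5 * (6 ^ p * p ^ p)) * Real.exp (lam / 2))
        * (S.Minf ^ p * Real.exp ((p + 4) * L))
        * (S.solConst * (n : ℝ) ^ (-(p / 2)) * (n * Real.exp (-lam))) := by gcongr
    _ = (8 * p ^ p + 5 * (6 ^ p * p ^ p)) * S.Minf ^ p * S.solConst * (n : ℝ) ^ (-(p / 2))
        * (n * Real.exp (-lam) * Real.exp (lam / 2) * Real.exp ((p + 4) * L)) := by ring
    _ ≤ _ := by gcongr

theorem tsum_exp_neg_abs_lt_top : ∑' i : ℤ, ENNReal.ofReal (Real.exp (-|(i : ℝ)|)) < ∞ := by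
  have h : Summable fun i : ℤ => Real.exp (-|(i : ℝ)|) := by
    refine Summable.of_nat_of_neg ?_ ?_ <;>
    · simp only [Int.cast_neg, abs_neg, Int.cast_natCast, Nat.abs_cast]
      exact Real.summable_exp_neg_nat
  rw [← ENNReal.ofReal_tsum_of_nonneg (fun _ => (Real.exp_pos _).le) h]
  exact ENNReal.ofReal_lt_top

/-- The p-th power of a supremum is at most the sum of the p-th powers. The summation runs over the
full grid, which also covers the isotropic family. -/
theorem lintegral_noise_rpow_le (hg : Integrable S.g volume) (hKint : Integrable S.K volume)
    (hnoise : S.NoiseAssumption) (hkernel : S.KernelAssumption) {p : ℝ} (hp : 1 < p) :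
    ∃ C : ℝ≥0, ∀ (P : Measure (Fin d → ℝ)) [IsProbabilityMeasure P], P ≪ volume →
      ∀ n : ℕ, 3 ≤ n → ∀ M : (Fin d → ℝ) → (Fin d → ℝ) → ℝ,
      (∀ h ∈ grid d, S.IsSolution h fun y => M y h) →
      ∫⁻ Z, (∫⁻ x, S.noise p P M n (x, Z) ^ p) ∂Measure.pi (fun _ => P)
        ≤ C * ENNReal.ofReal ((n : ℝ) ^ (-(p / 2))) := by
  set c := (8 * p ^ p + 5 * (6 ^ p * p ^ p)) * S.Minf ^ p * S.solConst with hc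
  have hM := S.one_le_Minf
  have hsol := S.solConst_pos hnoise hkernel
  have hc0 : 0 ≤ c := by positivity
  set T := (∑' i : ℤ, ENNReal.ofReal (Real.exp (-|(i : ℝ)|))) ^ d
  have hT : T ≠ ∞ := (ENNReal.pow_lt_top tsum_exp_neg_abs_lt_top).ne
  refine ⟨(3 ^ p * ENNReal.ofReal c * T).toNNReal, fun P _ hP n hn M hM => ?_⟩
  rw [ENNReal.coe_toNNReal (by finiteness)]
  have hmeas : Measurable fun w : (Fin d → ℝ) × (Fin n → Fin d → ℝ) => S.noise p P M n w ^ p :=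
    (measurable_noise hM).pow_const p
  have hterm : ∀ k : Fin d → ℤ, ∫⁻ x, ∫⁻ Z, noiseTerm P (fun y => M y (expVec k))
      (S.lamN p n (expVec k)) (S.Minf / S.wt (expVec k)) n (x, Z) ^ p ∂Measure.pi (fun _ => P)
      ≤ 3 ^ p * ENNReal.ofReal c * ENNReal.ofReal ((n : ℝ) ^ (-(p / 2)))
        * ∏ j, ENNReal.ofReal (Real.exp (-|(k j : ℝ)|)) := fun k => by
    have hsolk := hM _ (expVec_mem_grid k)
    obtain ⟨b1, b2⟩ := hsolk.bounds hg hKint hnoise hkernel (expVec_pos k)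
    have hb : 0 < S.Minf / S.wt (expVec k) := div_pos (by linarith) (S.wt_pos (expVec_pos k))
    have hlam := S.six_le_lamN hnoise hp hn (expVec k)
    calc _ ≤ ∫⁻ x, 3 ^ p * ENNReal.ofReal ((8 * p ^ p + 5 * (3 * S.lamN p n (expVec k)) ^ p)
            * (S.Minf / S.wt (expVec k)) ^ p * (n : ℝ) ^ (-(p / 2)) * n
            * Real.exp (-S.lamN p n (expVec k)) / (S.Minf / S.wt (expVec k)) ^ 2)
            * ENNReal.ofReal (∫ t, M (t - x) (expVec k) ^ 2 ∂P) :=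
          lintegral_mono fun x => lintegral_noiseTerm_rpow_le hP hsolk.measurable hb b1
            (by omega) (by linarith) (by linarith) x
      _ = 3 ^ p * ENNReal.ofReal ((8 * p ^ p + 5 * (3 * S.lamN p n (expVec k)) ^ p)
            * (S.Minf / S.wt (expVec k)) ^ p * (n : ℝ) ^ (-(p / 2)) * n
            * Real.exp (-S.lamN p n (expVec k)) / (S.Minf / S.wt (expVec k)) ^ 2)
            * ∫⁻ t, ENNReal.ofReal (M t (expVec k) ^ 2) := by
          rw [lintegral_const_mul' _ _ (by finiteness),
            lintegral_integral_sq_translate hP hsolk.measurable b1]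
      _ ≤ 3 ^ p * ENNReal.ofReal ((8 * p ^ p + 5 * (3 * S.lamN p n (expVec k)) ^ p)
            * (S.Minf / S.wt (expVec k)) ^ p * (n : ℝ) ^ (-(p / 2)) * n
            * Real.exp (-S.lamN p n (expVec k)) / (S.Minf / S.wt (expVec k)) ^ 2)
            * ENNReal.ofReal (S.solConst / S.wtSq (expVec k)) := by gcongr
      _ ≤ 3 ^ p * ENNReal.ofReal (c * (n : ℝ) ^ (-(p / 2)) * ∏ j, Real.exp (-|(k j : ℝ)|)) := by
          rw [mul_assoc, ← ENNReal.ofReal_mul (by positivity)]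
          gcongr _ * ENNReal.ofReal ?_
          exact S.noise_constant_le hnoise hkernel hp hn k
      _ = _ := by
          rw [ENNReal.ofReal_mul (by positivity), ENNReal.ofReal_mul (by positivity),
            ENNReal.ofReal_prod_of_nonneg (fun _ _ => (Real.exp_pos _).le)]
          ring
  have hswap := lintegral_lintegral_swap (μ := volume) (ν := Measure.pi fun _ : Fin n => P)
    (f := fun x Z => S.noise p P M n (x, Z) ^ p) hmeas.aemeasurable
  rw [← hswap]
  calc _ ≤ ∫⁻ x, ∫⁻ Z, ∑' k : Fin d → ℤ, noiseTerm P (fun y => M y (expVec k))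
        (S.lamN p n (expVec k)) (S.Minf / S.wt (expVec k)) n (x, Z) ^ p
          ∂Measure.pi (fun _ => P) :=
        lintegral_mono fun x => lintegral_mono fun Z =>
          ENNReal.iSup_rpow_le_tsum _ (by linarith)
    _ = ∑' k : Fin d → ℤ, ∫⁻ x, ∫⁻ Z, noiseTerm P (fun y => M y (expVec k))
        (S.lamN p n (expVec k)) (S.Minf / S.wt (expVec k)) n (x, Z) ^ p
          ∂Measure.pi (fun _ => P) := by
        have hm : ∀ k : Fin d → ℤ, Measurable fun w : (Fin d → ℝ) × (Fin n → Fin d → ℝ) =>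
            noiseTerm P (fun y => M y (expVec k)) (S.lamN p n (expVec k))
              (S.Minf / S.wt (expVec k)) n w ^ p := fun k =>
          (measurable_noiseTerm (hM _ (expVec_mem_grid k)).measurable _ _ _).pow_const p
        rw [← lintegral_tsum fun k => (hm k).lintegral_prod_right'.aemeasurable]
        refine lintegral_congr fun x => ?_
        exact lintegral_tsum fun k => ((hm k).comp measurable_prodMk_left).aemeasurable
    _ ≤ ∑' k : Fin d → ℤ, 3 ^ p * ENNReal.ofReal c * ENNReal.ofReal ((n : ℝ) ^ (-(p / 2)))
        * ∏ j, ENNReal.ofReal (Real.exp (-|(k j : ℝ)|)) := ENNReal.tsum_le_tsum hterm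
    _ = _ := by
        rw [ENNReal.tsum_mul_left, ENNReal.tsum_pi_prod
          (fun i : ℤ => ENNReal.ofReal (Real.exp (-|(i : ℝ)|))) d]
        ring

end Model

end ConvModel

end

/-! ### Level sets of the theoretical majorant -/

noncomputable section

theorem lintegral_lintegral_translate {d : ℕ} (Q : Measure (Fin d → ℝ)) [SFinite Q]
    {F : (Fin d → ℝ) → ℝ≥0∞} (hF : Measurable F) :
    ∫⁻ x, ∫⁻ t, F (t - x) ∂Q = Q Set.univ * ∫⁻ t, F t := by
  have h : Measurable fun w : (Fin d → ℝ) × (Fin d → ℝ) => F (w.2 - w.1) := hF.comp (by fun_prop)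
  rw [lintegral_lintegral_swap (f := fun x t => F (t - x)) h.aemeasurable]
  have h1 : ∀ t, ∫⁻ x, F (t - x) = ∫⁻ x, F x := fun t => lintegral_sub_left_eq_self F t
  simp only [h1, lintegral_const]
  rw [mul_comm]

namespace ConvModel

variable {d : ℕ}

theorem expVec_le_iff {k l : Fin d → ℤ} : expVec k ≤ expVec l ↔ k ≤ l := by
  simp only [Pi.le_def, expVec, Real.exp_le_exp, Int.cast_le]

theorem exists_eq_add_natCast {k l : Fin d → ℤ} (h : k ≤ l) :
    ∃ m : Fin d → ℕ, l = fun j => k j + m j :=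
  ⟨fun j => (l j - k j).toNat, funext fun j => by have := h j; simp [this]⟩

theorem Family.bandwidths_subset (F : Family) : F.bandwidths d ⊆ grid d := by
  cases F with
  | full => exact le_rfl
  | isotropic => exact fun h ⟨k, hk⟩ j => ⟨k, hk j⟩

/-- The quantity `ln n + ∑ⱼ |ln hⱼ|`. -/
def logSize (n : ℕ) (h : Fin d → ℝ) : ℝ := Real.log n + ∑ j, |Real.log (h j)|

theorem one_le_logSize {n : ℕ} (hn : 3 ≤ n) (h : Fin d → ℝ) : 1 ≤ logSize n h := by
  have h1 := one_le_log_natCast hn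
  have h2 : 0 ≤ ∑ j, |Real.log (h j)| := by positivity
  unfold logSize
  linarith

theorem logSize_add_le {n : ℕ} (hn : 3 ≤ n) (k : Fin d → ℤ) (m : Fin d → ℕ) :
    logSize n (expVec fun j => k j + m j) ≤ (1 + ∑ j, (m j : ℝ)) * logSize n (expVec k) := by
  have h1 := one_le_logSize hn (expVec k)
  have h2 : logSize n (expVec fun j => k j + m j) ≤ logSize n (expVec k) + ∑ j, (m j : ℝ) := by
    unfold logSize
    rw [add_assoc, ← Finset.sum_add_distrib]
    gcongr with j
    rw [log_expVec, log_expVec]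
    push_cast
    exact (abs_add_le _ _).trans (by simp)
  have h3 : 0 ≤ ∑ j, (m j : ℝ) := by positivity
  nlinarith

theorem one_add_le_two_mul_exp (x : ℝ) : 1 + x ≤ 2 * Real.exp (-(x / 2)) * Real.exp x := by
  have h := Real.add_one_le_exp (x / 2)
  rw [mul_assoc, ← Real.exp_add]
  have e : -(x / 2) + x = x / 2 := by ring
  rw [e]
  have := Real.exp_pos (x / 2)
  linarith

/-- `∑_m ∏ⱼ e^{-mⱼ/2}` over the vectors `m` of natural numbers. -/
def geomConst (d : ℕ) : ℝ≥0∞ := (∑' i : ℕ, ENNReal.ofReal (Real.exp (-((i : ℝ) / 2)))) ^ d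

theorem geomConst_lt_top (d : ℕ) : geomConst d < ∞ := by
  have h : Summable fun i : ℕ => Real.exp (-((i : ℝ) / 2)) := by
    have := Real.summable_exp_nat_mul_iff.2 (by norm_num : (-(1 / 2) : ℝ) < 0)
    refine this.congr fun i => ?_
    congr 1
    ring
  rw [geomConst, ← ENNReal.ofReal_tsum_of_nonneg (fun _ => (Real.exp_pos _).le) h]
  exact ENNReal.pow_lt_top ENNReal.ofReal_lt_top

theorem tsum_exp_neg_half (d : ℕ) :
    ∑' m : Fin d → ℕ, ENNReal.ofReal (Real.exp (-((∑ j, (m j : ℝ)) / 2))) = geomConst d := by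
  rw [geomConst, ← ENNReal.tsum_pi_prod]
  refine tsum_congr fun m => ?_
  rw [← ENNReal.ofReal_prod_of_nonneg (fun _ _ => (Real.exp_pos _).le), ← Real.exp_sum,
    Finset.sum_neg_distrib, Finset.sum_div]

theorem negPow_scale_le {u : ℝ≥0∞} (hu : 1 ≤ u) {z y x : ℝ} (hz : 0 < z) (hx : 0 ≤ x)
    (hy : z * Real.exp x ≤ y) : negPow y u ≤ ENNReal.ofReal (Real.exp (-x)) * negPow z u := by
  unfold negPow
  split_ifs with h
  · simp
  · have hu1 : 1 ≤ u.toReal := by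
      rw [← ENNReal.toReal_one]
      exact ENNReal.toReal_mono h hu
    rw [← ENNReal.ofReal_mul (Real.exp_pos _).le]
    refine ENNReal.ofReal_le_ofReal ?_
    have hzx : 0 < z * Real.exp x := by positivity
    calc y ^ (-u.toReal) ≤ (z * Real.exp x) ^ (-u.toReal) :=
          Real.rpow_le_rpow_of_nonpos hzx hy (by linarith)
      _ = Real.exp (-(x * u.toReal)) * z ^ (-u.toReal) := by
          rw [Real.mul_rpow hz.le (Real.exp_pos _).le, ← Real.exp_mul, mul_comm]
          congr 2
          ring
      _ ≤ _ := by
          gcongr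
          nlinarith

namespace Model

variable (S : Model d)

theorem wt_add_ge (hnoise : S.NoiseAssumption) (k : Fin d → ℤ) (m : Fin d → ℕ) :
    Real.exp (∑ j, (m j : ℝ)) * S.wt (expVec k) ≤ S.wt (expVec fun j => k j + m j) := by
  unfold wt
  rw [Real.exp_sum, ← Finset.prod_mul_distrib]
  refine Finset.prod_le_prod (fun j _ => by have := expVec_pos k j; positivity) fun j _ => ?_
  have h1 : Real.exp (m j : ℝ) * expVec k j = expVec (fun j => k j + (m j : ℤ)) j := by
    unfold expVec
    rw [← Real.exp_add]
    push_cast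
    rw [add_comm]
  have h2 : expVec k j ≤ expVec (fun j => k j + (m j : ℤ)) j :=
    expVec_le_iff.2 (fun j => by simp) j
  have h3 := expVec_pos k j
  have h4 := S.lam_nonneg hnoise j
  rw [← mul_assoc, h1]
  have := expVec_pos (fun j => k j + (m j : ℤ)) j
  gcongr

theorem wtSq_add_ge (hnoise : S.NoiseAssumption) (k : Fin d → ℤ) (m : Fin d → ℕ) :
    Real.exp (∑ j, (m j : ℝ)) * S.wtSq (expVec k) ≤ S.wtSq (expVec fun j => k j + m j) := by
  unfold wtSq
  rw [Real.exp_sum, ← Finset.prod_mul_distrib]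
  refine Finset.prod_le_prod (fun j _ => by have := expVec_pos k j; positivity) fun j _ => ?_
  have h1 : Real.exp (m j : ℝ) * expVec k j = expVec (fun j => k j + (m j : ℤ)) j := by
    unfold expVec
    rw [← Real.exp_add]
    push_cast
    rw [add_comm]
  have h2 : expVec k j ≤ expVec (fun j => k j + (m j : ℤ)) j :=
    expVec_le_iff.2 (fun j => by simp) j
  have h3 := expVec_pos k j
  have h4 := S.lam_nonneg hnoise j
  rw [← mul_assoc, h1]
  have := expVec_pos (fun j => k j + (m j : ℤ)) j
  gcongr

theorem Fn_sq {n : ℕ} (hn : 3 ≤ n) (k : Fin d → ℤ) :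
    S.Fn n (expVec k) ^ 2 = logSize n (expVec k) / (n * S.wtSq (expVec k)) := by
  have h1 := one_le_logSize hn (expVec k)
  unfold Fn wtSq
  rw [div_pow, mul_pow, ← Finset.prod_pow, Real.sq_sqrt (by unfold logSize at h1; linarith),
    Real.sq_sqrt (by positivity)]
  congr 2
  refine Finset.prod_congr rfl fun j _ => ?_
  rw [mul_pow, ← Real.sqrt_eq_rpow, Real.sq_sqrt (expVec_pos k j).le]

theorem Gn_eq (n : ℕ) (h : Fin d → ℝ) : S.Gn n h = logSize n h / (n * S.wt h) := rfl

theorem Gn_nonneg {n : ℕ} (hn : 3 ≤ n) (k : Fin d → ℤ) : 0 ≤ S.Gn n (expVec k) := by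
  rw [Gn_eq]
  have h1 := one_le_logSize hn (expVec k)
  have := S.wt_pos (expVec_pos k)
  positivity

theorem Fn_nonneg (n : ℕ) (k : Fin d → ℤ) : 0 ≤ S.Fn n (expVec k) := by
  unfold Fn
  have := fun j => expVec_pos k j
  have h2 : ∀ j, 0 < min (expVec k j) 1 := fun j => lt_min (this j) one_pos
  have : 0 ≤ ∏ j, expVec k j ^ (1 / 2 : ℝ) * min (expVec k j) 1 ^ S.lam j :=
    Finset.prod_nonneg fun j _ => mul_nonneg (Real.rpow_nonneg (this j).le _)
      (Real.rpow_nonneg (h2 j).le _)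
  positivity

/-- Multiplying h by e^m enlarges the logarithmic numerator by at most 1 + |m| and the denominator
by at least e^{|m|}. The remaining e^{-|m|/2} makes sums over all η ≥ h geometric. -/
theorem div_add_le {a b n w w' x : ℝ} (ha : 0 ≤ a) (hn : 0 < n) (hw : 0 < w)
    (hb : b ≤ (1 + x) * a) (hw' : Real.exp x * w ≤ w') :
    b / (n * w') ≤ 2 * Real.exp (-(x / 2)) * (a / (n * w)) := by
  have h0 : 0 < Real.exp x * w := by positivity
  have h1 : b ≤ 2 * Real.exp (-(x / 2)) * Real.exp x * a :=
    hb.trans (by gcongr; exact one_add_le_two_mul_exp x)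
  calc b / (n * w') ≤ 2 * Real.exp (-(x / 2)) * Real.exp x * a / (n * w') := by
        have := h0.trans_le hw'
        gcongr
    _ ≤ 2 * Real.exp (-(x / 2)) * Real.exp x * a / (n * (Real.exp x * w)) := by gcongr
    _ = _ := by field_simp

theorem Fn_sq_add_le (hnoise : S.NoiseAssumption) {n : ℕ} (hn : 3 ≤ n) (k : Fin d → ℤ)
    (m : Fin d → ℕ) : S.Fn n (expVec fun j => k j + m j) ^ 2
      ≤ 2 * Real.exp (-((∑ j, (m j : ℝ)) / 2)) * S.Fn n (expVec k) ^ 2 := by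
  rw [S.Fn_sq hn, S.Fn_sq hn]
  exact div_add_le (by linarith [one_le_logSize hn (expVec k)]) (by positivity)
    (S.wtSq_pos (expVec_pos k)) (logSize_add_le hn k m) (S.wtSq_add_ge hnoise k m)

theorem Gn_add_le (hnoise : S.NoiseAssumption) {n : ℕ} (hn : 3 ≤ n) (k : Fin d → ℤ)
    (m : Fin d → ℕ) : S.Gn n (expVec fun j => k j + m j) ≤ 2 * S.Gn n (expVec k) := by
  have h := div_add_le (n := n) (by linarith [one_le_logSize hn (expVec k)]) (by positivity)
    (S.wt_pos (expVec_pos k)) (logSize_add_le hn k m) (S.wt_add_ge hnoise k m)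
  rw [← Gn_eq, ← Gn_eq] at h
  refine h.trans ?_
  have h1 : Real.exp (-((∑ j, (m j : ℝ)) / 2)) ≤ 1 :=
    Real.exp_le_one_iff.2 (by have : 0 ≤ ∑ j, (m j : ℝ) := by positivity
                              linarith)
  have := S.Gn_nonneg hn k
  gcongr
  linarith

/-- A constant that bounds the ratio of `λ_n(h)` and `ln n + ∑ⱼ |ln hⱼ|`. -/
def lamConst (p : ℝ) : ℝ := 4 * Real.log S.Minf + 6 + (8 * p + 26) * ∑ j, (1 + S.lam j)

theorem lamConst_pos (hnoise : S.NoiseAssumption) {p : ℝ} (hp : 1 < p) : 0 < S.lamConst p := by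
  have := Real.log_nonneg S.one_le_Minf
  have h2 : 0 ≤ ∑ j, (1 + S.lam j) :=
    Finset.sum_nonneg fun j _ => by linarith [S.lam_nonneg hnoise j]
  unfold lamConst
  positivity

theorem lamN_le (hnoise : S.NoiseAssumption) {p : ℝ} (hp : 1 < p) {n : ℕ} (hn : 3 ≤ n)
    (h : Fin d → ℝ) : S.lamN p n h ≤ S.lamConst p * logSize n h := by
  have h0 := Real.log_nonneg S.one_le_Minf
  have h1 := one_le_log_natCast hn
  have h2 : 0 ≤ ∑ j, (1 + S.lam j) :=
    Finset.sum_nonneg fun j _ => by linarith [S.lam_nonneg hnoise j]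
  have h3 : 0 ≤ ∑ j, |Real.log (h j)| := by positivity
  have h4 : ∑ j, (1 + S.lam j) * |Real.log (h j)|
      ≤ (∑ j, (1 + S.lam j)) * ∑ j, |Real.log (h j)| := by
    rw [Finset.sum_mul]
    refine Finset.sum_le_sum fun j _ => ?_
    have := S.lam_nonneg hnoise j
    gcongr
    exact Finset.single_le_sum (f := fun j => |Real.log (h j)|) (fun _ _ => abs_nonneg _)
      (Finset.mem_univ j)
  have h5 : (8 * p + 26) * ∑ j, (1 + S.lam j) * |Real.log (h j)|
      ≤ (8 * p + 26) * ((∑ j, (1 + S.lam j)) * ∑ j, |Real.log (h j)|) := by gcongr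
  have h6 : 0 ≤ (8 * p + 26) * ∑ j, (1 + S.lam j) := by positivity
  unfold lamN lamConst logSize
  nlinarith [mul_nonneg h0 (by linarith : 0 ≤ Real.log n - 1), mul_nonneg h0 h3,
    mul_nonneg h6 (by linarith : 0 ≤ Real.log n)]

/-- The supremum `U*_n(x, h)` of the theoretical majorants. -/
def UStar (p : ℝ) (F : Family) (P : Measure (Fin d → ℝ)) (M : (Fin d → ℝ) → (Fin d → ℝ) → ℝ)
    (n : ℕ) (h x : Fin d → ℝ) : ℝ≥0∞ :=
  ⨆ η ∈ {η ∈ F.bandwidths d | h ≤ η}, ENNReal.ofReal (S.U p P M n x η)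

/-- The constant in front of `G_n(h)` in the bounds for `U*_n(x, h)`. -/
def linConst (p : ℝ) : ℝ := 8 / 3 * S.lamConst p * S.Minf

/-- The linear part of the majorant at any η ≥ h is at most `linConst`·G_n(h), so an exceedance
beyond that amount must come from the variance term. The 8/3 in `linConst` is 4/3 times the 2 of
`Gn_add_le`. -/
theorem lt_sqrt_of_lt_U (hnoise : S.NoiseAssumption) {p : ℝ} (hp : 1 < p) {n : ℕ} (hn : 3 ≤ n)
    {P : Measure (Fin d → ℝ)} {M : (Fin d → ℝ) → (Fin d → ℝ) → ℝ} {k : Fin d → ℤ} (m : Fin d → ℕ)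
    {s : ℝ} {x : Fin d → ℝ}
    (h : s + S.linConst p * S.Gn n (expVec k) < S.U p P M n x (expVec fun j => k j + m j)) :
    s < √(2 * S.lamN p n (expVec fun j => k j + m j)
      * (∫ t, M (t - x) (expVec fun j => k j + m j) ^ 2 ∂P) / n) := by
  set l : Fin d → ℤ := fun j => k j + m j with hl
  have h1 : 4 / 3 * S.lamN p n (expVec l) * (S.Minf / S.wt (expVec l)) / n
      ≤ S.linConst p * S.Gn n (expVec k) := by
    have hw := S.wt_pos (expVec_pos l)
    have hM := S.one_le_Minf
    have hG := S.Gn_add_le hnoise hn k m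
    have hc := S.lamConst_pos hnoise hp
    calc _ ≤ 4 / 3 * (S.lamConst p * logSize n (expVec l)) * (S.Minf / S.wt (expVec l)) / n := by
          gcongr
          exact S.lamN_le hnoise hp hn _
      _ = 4 / 3 * S.lamConst p * S.Minf * S.Gn n (expVec l) := by
          rw [Gn_eq]
          field_simp
      _ ≤ 4 / 3 * S.lamConst p * S.Minf * (2 * S.Gn n (expVec k)) := by gcongr
      _ = _ := by unfold linConst; ring
  unfold U bernsteinBound at h
  linarith

/-- Markov's inequality in x, then Tonelli. The measure Q is general because it will also be the law
restricted to a set where the density is large; then its mass enters as an additional small factor.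
-/
theorem measure_lt_variance_le (hg : Integrable S.g volume) (hKint : Integrable S.K volume)
    (hnoise : S.NoiseAssumption) (hkernel : S.KernelAssumption) {p : ℝ} (hp : 1 < p) {n : ℕ}
    (hn : 3 ≤ n) (Q : Measure (Fin d → ℝ)) [SFinite Q] {M : (Fin d → ℝ) → (Fin d → ℝ) → ℝ}
    (hM : ∀ h ∈ grid d, S.IsSolution h fun y => M y h) (k : Fin d → ℤ) {s : ℝ} (hs : 0 < s) :
    volume {x | ENNReal.ofReal (s ^ 2) < ENNReal.ofReal (2 * S.lamN p n (expVec k) / n)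
        * ∫⁻ t, ENNReal.ofReal (M (t - x) (expVec k) ^ 2) ∂Q}
      ≤ ENNReal.ofReal (2 * S.lamConst p * S.solConst * (S.Fn n (expVec k) ^ 2 / s ^ 2))
        * Q Set.univ := by
  have hsolk := hM _ (expVec_mem_grid k)
  have hb := (hsolk.bounds hg hKint hnoise hkernel (expVec_pos k)).2
  have hmm : Measurable fun t => ENNReal.ofReal (M t (expVec k) ^ 2) :=
    (hsolk.measurable.pow_const 2).ennreal_ofReal
  have hlam6 := S.six_le_lamN hnoise hp hn (expVec k)
  have hlam := S.lamN_le hnoise hp hn (expVec k)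
  have hsol := S.solConst_pos hnoise hkernel
  have hw := S.wtSq_pos (expVec_pos k)
  have hmeas : Measurable fun x => ∫⁻ t, ENNReal.ofReal (M (t - x) (expVec k) ^ 2) ∂Q := by
    have h : Measurable fun w : (Fin d → ℝ) × (Fin d → ℝ) =>
        ENNReal.ofReal (M (w.2 - w.1) (expVec k) ^ 2) :=
      hmm.comp (by fun_prop : Measurable fun w : (Fin d → ℝ) × (Fin d → ℝ) => w.2 - w.1)
    exact h.lintegral_prod_right'
  have hs2 : ENNReal.ofReal (s ^ 2) ≠ 0 := by simp [hs.ne']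
  refine (measure_mono ?_).trans ((meas_ge_le_lintegral_div
    (hmeas.const_mul (ENNReal.ofReal (2 * S.lamN p n (expVec k) / n))).aemeasurable hs2
    ENNReal.ofReal_ne_top).trans ?_)
  · intro x hx
    rw [Set.mem_ofPred_eq] at hx ⊢
    exact hx.le
  calc _ = ENNReal.ofReal (2 * S.lamN p n (expVec k) / n)
        * (Q Set.univ * ∫⁻ t, ENNReal.ofReal (M t (expVec k) ^ 2)) / ENNReal.ofReal (s ^ 2) := by
        rw [lintegral_const_mul _ hmeas, lintegral_lintegral_translate Q hmm]
    _ ≤ ENNReal.ofReal (2 * (S.lamConst p * logSize n (expVec k)) / n)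
        * (Q Set.univ * ENNReal.ofReal (S.solConst / S.wtSq (expVec k)))
          / ENNReal.ofReal (s ^ 2) := by gcongr
    _ = _ := by
        have hl := one_le_logSize hn (expVec k)
        have hc := S.lamConst_pos hnoise hp
        rw [S.Fn_sq hn, mul_comm (Q Set.univ), ← mul_assoc, ← ENNReal.ofReal_mul (by positivity),
          ENNReal.mul_div_right_comm, ← ENNReal.ofReal_div_of_pos (by positivity)]
        congr 2
        field_simp

theorem setOf_lt_UStar_subset (hnoise : S.NoiseAssumption) {p : ℝ} (hp : 1 < p) {n : ℕ}
    (hn : 3 ≤ n) {P : Measure (Fin d → ℝ)} [IsProbabilityMeasure P] (hP : P ≪ volume)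
    (hg : Integrable S.g volume) (hKint : Integrable S.K volume) (hkernel : S.KernelAssumption)
    {M : (Fin d → ℝ) → (Fin d → ℝ) → ℝ} (hM : ∀ h ∈ grid d, S.IsSolution h fun y => M y h)
    (F : Family) (k : Fin d → ℤ) {s : ℝ} (hs : 0 < s) :
    {x | ENNReal.ofReal (s + S.linConst p * S.Gn n (expVec k)) < S.UStar p F P M n (expVec k) x}
      ⊆ ⋃ m : Fin d → ℕ, {x | ENNReal.ofReal (s ^ 2)
        < ENNReal.ofReal (2 * S.lamN p n (expVec fun j => k j + m j) / n)
          * ∫⁻ t, ENNReal.ofReal (M (t - x) (expVec fun j => k j + m j) ^ 2) ∂P} := by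
  intro x hx
  rw [Set.mem_ofPred_eq, UStar, lt_iSup_iff] at hx
  obtain ⟨η, hx⟩ := hx
  rw [lt_iSup_iff] at hx
  obtain ⟨⟨hηF, hη⟩, hx⟩ := hx
  obtain ⟨l, rfl⟩ := exists_expVec (F.bandwidths_subset hηF)
  obtain ⟨m, rfl⟩ := exists_eq_add_natCast (expVec_le_iff.1 hη)
  refine Set.mem_iUnion.2 ⟨m, ?_⟩
  rw [Set.mem_ofPred_eq]
  have h1 := S.lt_sqrt_of_lt_U hnoise hp hn m
    (lt_of_not_ge fun h => hx.not_ge (ENNReal.ofReal_le_ofReal h))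
  set l : Fin d → ℤ := fun j => k j + m j with hl
  have hsolk := hM _ (expVec_mem_grid l)
  have hb := (hsolk.bounds hg hKint hnoise hkernel (expVec_pos l)).1
  have hlam6 := S.six_le_lamN hnoise hp hn (expVec l)
  have hvar : ENNReal.ofReal (∫ t, M (t - x) (expVec l) ^ 2 ∂P)
      = ∫⁻ t, ENNReal.ofReal (M (t - x) (expVec l) ^ 2) ∂P := by
    have hmx : Measurable fun t => M (t - x) (expVec l) := hsolk.measurable.comp (by fun_prop)
    refine ofReal_integral_eq_lintegral_ofReal ?_ (Filter.Eventually.of_forall fun _ => sq_nonneg _)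
    refine Integrable.of_bound (hmx.pow_const 2).aestronglyMeasurable
      ((S.Minf / S.wt (expVec l)) ^ 2) ?_
    have h1 : ∀ᵐ t, |M (t - x) (expVec l)| ≤ S.Minf / S.wt (expVec l) :=
      (measurePreserving_sub_right volume x).quasiMeasurePreserving.ae hb
    filter_upwards [hP.ae_le h1] with t ht
    rw [Real.norm_eq_abs, abs_pow]
    gcongr
  rw [← hvar, ← ENNReal.ofReal_mul (by positivity)]
  refine (ENNReal.ofReal_lt_ofReal_iff_of_nonneg (by positivity)).2 ?_
  rw [Real.lt_sqrt hs.le] at h1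
  refine h1.trans_eq ?_
  ring

theorem measure_lt_UStar_le (hnoise : S.NoiseAssumption) {p : ℝ} (hp : 1 < p) {n : ℕ}
    (hn : 3 ≤ n) {P : Measure (Fin d → ℝ)} [IsProbabilityMeasure P] (hP : P ≪ volume)
    (hg : Integrable S.g volume) (hKint : Integrable S.K volume) (hkernel : S.KernelAssumption)
    {M : (Fin d → ℝ) → (Fin d → ℝ) → ℝ} (hM : ∀ h ∈ grid d, S.IsSolution h fun y => M y h)
    (F : Family) (k : Fin d → ℤ) {s : ℝ} (hs : 0 < s) :
    volume {x | ENNReal.ofReal (s + S.linConst p * S.Gn n (expVec k))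
        < S.UStar p F P M n (expVec k) x}
      ≤ ENNReal.ofReal (4 * S.lamConst p * S.solConst) * geomConst d
        * ENNReal.ofReal (S.Fn n (expVec k) ^ 2 / s ^ 2) := by
  have hc := S.lamConst_pos hnoise hp
  have hsol := S.solConst_pos hnoise hkernel
  refine (measure_mono (S.setOf_lt_UStar_subset hnoise hp hn hP hg hKint hkernel hM F k hs)).trans
    ((measure_iUnion_le _).trans ?_)
  rw [mul_right_comm, ← tsum_exp_neg_half, ← ENNReal.tsum_mul_left]
  refine ENNReal.tsum_le_tsum fun m => ?_
  refine (S.measure_lt_variance_le hg hKint hnoise hkernel hp hn P hM _ hs).trans ?_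
  rw [measure_univ, mul_one, ← ENNReal.ofReal_mul (by positivity),
    ← ENNReal.ofReal_mul (by positivity)]
  refine ENNReal.ofReal_le_ofReal ?_
  have h := S.Fn_sq_add_le hnoise hn k m
  calc _ ≤ 2 * S.lamConst p * S.solConst * (2 * Real.exp (-((∑ j, (m j : ℝ)) / 2))
        * S.Fn n (expVec k) ^ 2 / s ^ 2) := by gcongr
    _ = _ := by ring

/-- The variance is split according to the height of the density. Where the density is low, the
variance is at most height times ‖M‖_2², below the level for every x. Markov's inequality is spent
only on the high part, whose mass is controlled by the tail hypothesis. -/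
theorem measure_lt_UStar_le_negPow (hnoise : S.NoiseAssumption) {p : ℝ} (hp : 1 < p) {n : ℕ}
    (hn : 3 ≤ n) {ρ : (Fin d → ℝ) → ℝ≥0∞} (hρ : Measurable ρ)
    [IsProbabilityMeasure (volume.withDensity ρ)]
    (hg : Integrable S.g volume) (hKint : Integrable S.K volume) (hkernel : S.KernelAssumption)
    {M : (Fin d → ℝ) → (Fin d → ℝ) → ℝ} (hM : ∀ h ∈ grid d, S.IsSolution h fun y => M y h)
    {u Cw : ℝ≥0∞} (hu : 1 ≤ u) {κ : ℝ} (hκ : 1 ≤ κ)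
    (htail : ∀ z : ℝ, 1 ≤ z → volume.withDensity ρ {t | ENNReal.ofReal (κ * z) < ρ t}
      ≤ Cw * ENNReal.ofReal z * negPow z u)
    (F : Family) (k : Fin d → ℤ) {s z : ℝ} (hs : 0 < s) (hz : 1 ≤ z)
    (hF : S.Fn n (expVec k) ^ 2 ≤ s ^ 2 / z) :
    volume {x | ENNReal.ofReal (√(1 + 4 * S.lamConst p * S.solConst * κ) * s
        + S.linConst p * S.Gn n (expVec k)) < S.UStar p F (volume.withDensity ρ) M n (expVec k) x}
      ≤ ENNReal.ofReal (4 * S.lamConst p * S.solConst) * geomConst d * Cw * negPow z u := by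
  have hc := S.lamConst_pos hnoise hp
  have hsol := S.solConst_pos hnoise hkernel
  set P := volume.withDensity ρ with hPdef
  have hP : P ≪ volume := withDensity_absolutelyContinuous _ _
  set κ₁ := √(1 + 4 * S.lamConst p * S.solConst * κ) with hκ₁
  have hκ₁sq : κ₁ ^ 2 = 1 + 4 * S.lamConst p * S.solConst * κ := Real.sq_sqrt (by positivity)
  have hκ₁0 : 0 < κ₁ := Real.sqrt_pos.2 (by positivity)
  set x2 : (Fin d → ℕ) → ℝ := fun m => (∑ j, (m j : ℝ)) / 2 with hx2
  -- The truncation height grows with η = e^m h at the rate e^{|m|/2} at which F_n² decays, so the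
  -- low part contributes the same order s² for each m.
  set A : (Fin d → ℕ) → Set (Fin d → ℝ) :=
    fun m => {t | ENNReal.ofReal (κ * (z * Real.exp (x2 m))) < ρ t} with hA
  have hAm : ∀ m, MeasurableSet (A m) := fun m => measurableSet_lt measurable_const hρ
  have hx20 : ∀ m, 0 ≤ x2 m := fun m => by positivity
  have hFm : ∀ m, S.Fn n (expVec fun j => k j + (m j : ℤ)) ^ 2
      ≤ 2 * Real.exp (-x2 m) * (s ^ 2 / z) := fun m =>
    (S.Fn_sq_add_le hnoise hn k m).trans (by gcongr)
  have hsub : {x | ENNReal.ofReal (κ₁ * s + S.linConst p * S.Gn n (expVec k))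
      < S.UStar p F P M n (expVec k) x} ⊆ ⋃ m : Fin d → ℕ, {x | ENNReal.ofReal (s ^ 2)
        < ENNReal.ofReal (2 * S.lamN p n (expVec fun j => k j + (m j : ℤ)) / n)
          * ∫⁻ t, ENNReal.ofReal (M (t - x) (expVec fun j => k j + (m j : ℤ)) ^ 2)
            ∂(P.restrict (A m))} := by
    refine (S.setOf_lt_UStar_subset hnoise hp hn hP hg hKint hkernel hM F k
      (mul_pos hκ₁0 hs)).trans (Set.iUnion_mono fun m x hx => ?_)
    rw [Set.mem_ofPred_eq] at hx ⊢
    set l : Fin d → ℤ := fun j => k j + m j with hl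
    have hsolk := hM _ (expVec_mem_grid l)
    have hb := (hsolk.bounds hg hKint hnoise hkernel (expVec_pos l)).2
    have hw := S.wtSq_pos (expVec_pos l)
    set G : (Fin d → ℝ) → ℝ≥0∞ := fun t => ENNReal.ofReal (M (t - x) (expVec l) ^ 2) with hG
    have hGm : Measurable G :=
      ((hsolk.measurable.comp (by fun_prop : Measurable fun t => t - x)).pow_const 2).ennreal_ofReal
    have hGint : ∫⁻ t, G t ≤ ENNReal.ofReal (S.solConst / S.wtSq (expVec l)) := by
      rw [hG, lintegral_sub_right_eq_self (fun t => ENNReal.ofReal (M t (expVec l) ^ 2)) x]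
      exact hb
    have hcompl : ∫⁻ t in (A m)ᶜ, G t ∂P
        ≤ ENNReal.ofReal (κ * (z * Real.exp (x2 m))) * ∫⁻ t, G t := by
      rw [hPdef, setLIntegral_withDensity_eq_setLIntegral_mul _ hρ hGm (hAm m).compl]
      calc _ ≤ ∫⁻ t in (A m)ᶜ, ENNReal.ofReal (κ * (z * Real.exp (x2 m))) * G t := by
            refine setLIntegral_mono' (hAm m).compl fun t ht => ?_
            have ht' : ρ t ≤ ENNReal.ofReal (κ * (z * Real.exp (x2 m))) := not_lt.1 ht
            exact mul_le_mul_left ht' _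
        _ ≤ ∫⁻ t, ENNReal.ofReal (κ * (z * Real.exp (x2 m))) * G t := setLIntegral_le_lintegral _ _
        _ = _ := lintegral_const_mul _ hGm
    have hlarge : ENNReal.ofReal (2 * S.lamN p n (expVec l) / n) * ∫⁻ t in (A m)ᶜ, G t ∂P
        ≤ ENNReal.ofReal ((κ₁ ^ 2 - 1) * s ^ 2) := by
      have hlogs := one_le_logSize hn (expVec l)
      calc _ ≤ ENNReal.ofReal (2 * (S.lamConst p * logSize n (expVec l)) / n)
            * (ENNReal.ofReal (κ * (z * Real.exp (x2 m)))
              * ENNReal.ofReal (S.solConst / S.wtSq (expVec l))) := by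
            gcongr
            · exact S.lamN_le hnoise hp hn _
            · exact hcompl.trans (by gcongr)
        _ = ENNReal.ofReal (2 * S.lamConst p * S.solConst * κ * z * Real.exp (x2 m)
              * S.Fn n (expVec l) ^ 2) := by
            rw [← ENNReal.ofReal_mul (by positivity), ← ENNReal.ofReal_mul (by positivity),
              S.Fn_sq hn]
            congr 1
            field_simp
        _ ≤ ENNReal.ofReal (2 * S.lamConst p * S.solConst * κ * z * Real.exp (x2 m)
              * (2 * Real.exp (-x2 m) * (s ^ 2 / z))) := by
            gcongr
            exact hFm m
        _ = _ := by
            congr 1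
            rw [hκ₁sq, Real.exp_neg]
            field_simp
            ring
    rw [← lintegral_add_compl G (hAm m), mul_add] at hx
    have e : (κ₁ * s) ^ 2 = s ^ 2 + (κ₁ ^ 2 - 1) * s ^ 2 := by ring
    have h0 : 0 ≤ κ₁ ^ 2 - 1 := by
      rw [hκ₁sq, add_sub_cancel_left]
      positivity
    rw [e, ENNReal.ofReal_add (by positivity) (by positivity)] at hx
    by_contra hcon
    exact hx.not_ge (add_le_add (not_lt.1 hcon) hlarge)
  refine (measure_mono hsub).trans ((measure_iUnion_le _).trans ?_)
  rw [mul_assoc, mul_right_comm, ← tsum_exp_neg_half, ← ENNReal.tsum_mul_left]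
  refine ENNReal.tsum_le_tsum fun m => ?_
  refine (S.measure_lt_variance_le hg hKint hnoise hkernel hp hn (P.restrict (A m)) hM _ hs).trans ?_
  rw [Measure.restrict_apply_univ]
  have hz0 : 0 < z := by linarith
  have hzm : z * Real.exp (x2 m) ≤ z * Real.exp (x2 m) := le_rfl
  have h1z : 1 ≤ z * Real.exp (x2 m) :=
    one_le_mul_of_one_le_of_one_le hz (Real.one_le_exp (hx20 m))
  -- The decay of F_n² and the tail each give e^{-|m|/2}, the factor z e^{|m|/2} in the tail bound
  -- takes one back, and 1/z cancels z. What remains is e^{-|m|/2} z^{-u}, summable in m.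
  calc _ ≤ ENNReal.ofReal (2 * S.lamConst p * S.solConst
          * (2 * Real.exp (-x2 m) * (s ^ 2 / z) / s ^ 2))
        * (Cw * ENNReal.ofReal (z * Real.exp (x2 m))
          * (ENNReal.ofReal (Real.exp (-x2 m)) * negPow z u)) := by
        gcongr
        · exact hFm m
        · exact (htail _ h1z).trans (by gcongr; exact negPow_scale_le hu hz0 (hx20 m) hzm)
    _ = (ENNReal.ofReal (2 * S.lamConst p * S.solConst
          * (2 * Real.exp (-x2 m) * (s ^ 2 / z) / s ^ 2))
        * ENNReal.ofReal (z * Real.exp (x2 m)) * ENNReal.ofReal (Real.exp (-x2 m)))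
          * (Cw * negPow z u) := by ring
    _ = ENNReal.ofReal (4 * S.lamConst p * S.solConst * Real.exp (-x2 m)) * (Cw * negPow z u) := by
        rw [← ENNReal.ofReal_mul (by positivity), ← ENNReal.ofReal_mul (by positivity)]
        congr 2
        rw [Real.exp_neg]
        field_simp
        ring
    _ = _ := by
        rw [ENNReal.ofReal_mul (by positivity)]
        ring

end Model

end ConvModel

end

/-! ### Tails of densities in weak L_u -/

noncomputable section

theorem lintegral_Ioc_zero_rpow {y s : ℝ} (hy : 0 < y) (hs : -1 < s) :
    ∫⁻ t in Set.Ioc 0 y, ENNReal.ofReal (t ^ s) = ENNReal.ofReal (y ^ (s + 1) / (s + 1)) := by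
  have hint : IntegrableOn (fun t : ℝ => t ^ s) (Set.Ioc 0 y) := by
    rw [← intervalIntegrable_iff_integrableOn_Ioc_of_le hy.le]
    exact intervalIntegral.intervalIntegrable_rpow' hs
  rw [← ofReal_integral_eq_lintegral_ofReal hint, ← intervalIntegral.integral_of_le hy.le,
    integral_rpow (Or.inl hs), Real.zero_rpow (by linarith), sub_zero]
  filter_upwards [ae_restrict_mem measurableSet_Ioc] with t ht
  exact Real.rpow_nonneg ht.1.le _

theorem lintegral_Ioi_rpow {y s : ℝ} (hy : 0 < y) (hs : s < -1) :
    ∫⁻ t in Set.Ioi y, ENNReal.ofReal (t ^ s) = ENNReal.ofReal (-y ^ (s + 1) / (s + 1)) := by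
  rw [← ofReal_integral_eq_lintegral_ofReal (integrableOn_Ioi_rpow_of_lt hs hy),
    integral_Ioi_rpow_of_lt hs hy]
  filter_upwards [ae_restrict_mem measurableSet_Ioi] with t ht
  exact Real.rpow_nonneg (hy.trans ht).le _

/-- Layer cake on the restriction to {F > y}: levels below y contribute y^r times the measure of
that set, levels above y the convergent tail integral. -/
theorem setLIntegral_rpow_le_of_tail {X : Type*} [MeasurableSpace X] {μ : Measure X} [SFinite μ]
    {F : X → ℝ≥0∞} (hF : Measurable F) {r w y : ℝ} (hr : 0 < r) (hw : r < w) (hy : 0 < y)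
    {B : ℝ≥0∞} (h : ∀ t, y ≤ t → μ {x | ENNReal.ofReal t < F x}
      ≤ B * ENNReal.ofReal ((t / y) ^ (-w))) :
    ∫⁻ x in {x | ENNReal.ofReal y < F x}, F x ^ r ∂μ
      ≤ B * ENNReal.ofReal (y ^ r * (1 + r / (w - r))) := by
  set A := {x | ENNReal.ofReal y < F x}
  have hAB : μ A ≤ B := by
    have := h y le_rfl
    rwa [div_self hy.ne', Real.one_rpow, ENNReal.ofReal_one, mul_one] at this
  have hsplit : Set.Ioi (0 : ℝ) = Set.Ioc 0 y ∪ Set.Ioi y := (Set.Ioc_union_Ioi_eq_Ioi hy.le).symm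
  have h1 : ∫⁻ t in Set.Ioc 0 y, (μ.restrict A) {x | ENNReal.ofReal t < F x}
      * ENNReal.ofReal (t ^ (r - 1)) ≤ B * ENNReal.ofReal (y ^ r / r) := by
    calc _ ≤ ∫⁻ t in Set.Ioc 0 y, B * ENNReal.ofReal (t ^ (r - 1)) := by
          refine lintegral_mono fun t => ?_
          gcongr
          refine (measure_mono (Set.subset_univ _)).trans ?_
          rwa [Measure.restrict_apply_univ]
      _ = B * ENNReal.ofReal (y ^ r / r) := by
          rw [lintegral_const_mul _ (by fun_prop), lintegral_Ioc_zero_rpow hy (by linarith)]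
          simp
  have h2 : ∫⁻ t in Set.Ioi y, (μ.restrict A) {x | ENNReal.ofReal t < F x}
      * ENNReal.ofReal (t ^ (r - 1)) ≤ B * ENNReal.ofReal (y ^ r / (w - r)) := by
    calc _ ≤ ∫⁻ t in Set.Ioi y, B * ENNReal.ofReal (y ^ w) * ENNReal.ofReal (t ^ (r - 1 - w)) := by
          refine setLIntegral_mono' measurableSet_Ioi fun t ht => ?_
          have ht : y < t := ht
          have ht0 : 0 < t := hy.trans ht
          calc _ ≤ B * ENNReal.ofReal ((t / y) ^ (-w)) * ENNReal.ofReal (t ^ (r - 1)) := by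
                gcongr
                exact (Measure.restrict_apply_le A _).trans (h t ht.le)
            _ = _ := by
                rw [mul_assoc, mul_assoc, ← ENNReal.ofReal_mul (by positivity),
                  ← ENNReal.ofReal_mul (by positivity)]
                congr 2
                rw [Real.div_rpow ht0.le hy.le, Real.rpow_neg hy.le, Real.rpow_sub ht0 (r - 1) w,
                  Real.rpow_neg ht0.le]
                field_simp
      _ = B * ENNReal.ofReal (y ^ r / (w - r)) := by
          rw [lintegral_const_mul _ (by fun_prop), lintegral_Ioi_rpow hy (by linarith), mul_assoc,
            ← ENNReal.ofReal_mul (by positivity)]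
          congr 2
          have e : r - 1 - w + 1 = r - w := by ring
          have hd : r - w ≠ 0 := by linarith
          have hd' : w - r ≠ 0 := by linarith
          rw [e, Real.rpow_sub hy]
          have := Real.rpow_pos_of_pos hy w
          field_simp
          ring
  have hd : 0 < w - r := by linarith
  rw [lintegral_rpow_eq_layer hF hr, hsplit,
    lintegral_union measurableSet_Ioi (Set.Ioc_disjoint_Ioi le_rfl)]
  calc _ ≤ ENNReal.ofReal r * (B * ENNReal.ofReal (y ^ r / r) + B * ENNReal.ofReal (y ^ r / (w - r)))
        := by gcongr
    _ = B * (ENNReal.ofReal r * (ENNReal.ofReal (y ^ r / r) + ENNReal.ofReal (y ^ r / (w - r)))) := by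
        ring
    _ = _ := by
        rw [← ENNReal.ofReal_add (by positivity) (by positivity), ← ENNReal.ofReal_mul hr.le]
        congr 2
        field_simp

namespace ConvModel

variable {d : ℕ}

theorem negPow_mul_le {u : ℝ≥0∞} {w z y : ℝ} (hw : ENNReal.ofReal w ≤ u) (hz : 0 < z)
    (hy : 1 ≤ y) : negPow (z * y) u ≤ ENNReal.ofReal (y ^ (-w)) * negPow z u := by
  unfold negPow
  split_ifs with h
  · simp
  · have hw' : w ≤ u.toReal := (ENNReal.ofReal_le_iff_le_toReal h).1 hw
    rw [← ENNReal.ofReal_mul (by positivity), Real.mul_rpow hz.le (by linarith), mul_comm]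
    gcongr

/-- The tail of a density in a ball of weak `L_u`. -/
theorem exists_tail_le {u : ℝ≥0∞} (hu : 1 < u) (D : ℝ) :
    ∃ (κ : ℝ) (Cw : ℝ≥0), 1 ≤ κ ∧ ∀ (b : (Fin d → ℝ) → ℝ) (ρ : (Fin d → ℝ) → ℝ≥0∞),
      b ∈ weakBall d u D → Measurable ρ → (∀ᵐ x, ρ x = ENNReal.ofReal (b x)) →
      ∀ z : ℝ, 1 ≤ z → volume.withDensity ρ {t | ENNReal.ofReal (κ * z) < ρ t}
        ≤ Cw * ENNReal.ofReal z * negPow z u := by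
  by_cases hu' : u = ∞
  -- For u = ∞ the density is at most D almost everywhere, so the tail beyond κ = max 1 D is null
  -- and the constant 0 is enough.
  · refine ⟨max 1 D, 0, le_max_left _ _, fun b ρ hb hρ hbρ z hz => ?_⟩
    rw [weakBall, Set.mem_ofPred_eq, if_pos hu'] at hb
    have h1 : ∀ᵐ x, ‖b x‖ₑ ≤ ENNReal.ofReal D := by
      have h2 : ∀ᵐ x, ‖b x‖ₑ ≤ eLpNorm b ∞ volume := by
        rw [eLpNorm_exponent_top]
        exact ae_le_eLpNormEssSup
      filter_upwards [h2] with x hx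
      exact hx.trans hb.2
    have h3 : volume {t | ENNReal.ofReal (max 1 D * z) < ρ t} = 0 := by
      rw [measure_eq_zero_iff_ae_notMem]
      filter_upwards [h1, hbρ] with x hx hx'
      rw [not_lt, hx']
      calc ENNReal.ofReal (b x) ≤ ‖b x‖ₑ := by
            rw [← ofReal_norm, Real.norm_eq_abs]
            exact ENNReal.ofReal_le_ofReal (le_abs_self _)
        _ ≤ ENNReal.ofReal D := hx
        _ ≤ _ := ENNReal.ofReal_le_ofReal (by
            have := le_max_right 1 D
            have := le_max_left 1 D
            nlinarith)
    rw [withDensity_absolutelyContinuous volume ρ h3]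
    exact zero_le
  · have hu1 : 1 < u.toReal := by
      rw [← ENNReal.toReal_one]
      exact (ENNReal.toReal_lt_toReal ENNReal.one_ne_top hu').2 hu
    set w := u.toReal
    refine ⟨1, (ENNReal.ofReal D ^ w * ENNReal.ofReal (1 + 1 / (w - 1))).toNNReal, le_rfl,
      fun b ρ hb hρ hbρ z hz => ?_⟩
    have hz0 : 0 < z := by linarith
    rw [weakBall, Set.mem_ofPred_eq, if_neg hu'] at hb
    -- The weak norm is an infimum that need not be attained; the strict inequality in the class
    -- yields an admissible constant c < D.
    obtain ⟨c, hc, hcD⟩ := sInf_lt_iff.1 hb.2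
    rw [Set.mem_ofPred_eq] at hc
    have h1 : ∀ t, z ≤ t → volume {x | ENNReal.ofReal t < ρ x}
        ≤ (ENNReal.ofReal D ^ w * ENNReal.ofReal (z ^ (-w))) * ENNReal.ofReal ((t / z) ^ (-w)) := by
      intro t ht
      have ht0 : 0 < t := by linarith
      rw [mul_assoc, ← ENNReal.ofReal_mul (by positivity), ← Real.mul_rpow hz0.le (by positivity),
        mul_div_cancel₀ _ hz0.ne']
      calc volume {x | ENNReal.ofReal t < ρ x} ≤ volume {x | t < |b x|} := by
            refine measure_mono_ae ?_
            filter_upwards [hbρ] with x hx hx'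
            have hx' : ENNReal.ofReal t < ρ x := hx'
            rw [hx] at hx'
            have := lt_of_not_ge fun h => hx'.not_ge (ENNReal.ofReal_le_ofReal h)
            exact this.trans_le (le_abs_self _)
        _ ≤ c ^ w * ENNReal.ofReal (t ^ (-w)) := hc t ht0
        _ ≤ _ := by gcongr
    have h2 := setLIntegral_rpow_le_of_tail hρ one_pos hu1 hz0 h1
    simp only [ENNReal.rpow_one, Real.rpow_one] at h2
    rw [one_mul, withDensity_apply _ (measurableSet_lt measurable_const hρ),
      ENNReal.coe_toNNReal (by finiteness), negPow, if_neg hu']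
    refine h2.trans_eq ?_
    rw [ENNReal.ofReal_mul hz0.le]
    ring

/-! ### The pointwise oracle inequality -/

theorem Family.sup_mem {F : Family} {h η : Fin d → ℝ} (hh : h ∈ F.bandwidths d)
    (hη : η ∈ F.bandwidths d) : h ⊔ η ∈ F.bandwidths d := by
  cases F with
  | full =>
    obtain ⟨k, rfl⟩ := exists_expVec hh
    obtain ⟨l, rfl⟩ := exists_expVec hη
    rw [expVec_sup]
    exact expVec_mem_grid _
  | isotropic =>
    obtain ⟨k, hk⟩ := hh
    obtain ⟨l, hl⟩ := hη
    refine ⟨max k l, fun j => ?_⟩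
    rw [Pi.sup_apply, hk, hl, Int.cast_max, Real.exp_monotone.map_max]

namespace Model

variable {S : Model d} {p : ℝ} {P : Measure (Fin d → ℝ)} {M : (Fin d → ℝ) → (Fin d → ℝ) → ℝ}
  {n : ℕ} {F : Family} {f : (Fin d → ℝ) → ℝ}

theorem ofReal_Uhat_le_UhatStar (Z : Fin n → Fin d → ℝ) (x : Fin d → ℝ) {h η : Fin d → ℝ}
    (hη : η ∈ F.bandwidths d) (hh : h ≤ η) :
    ENNReal.ofReal (S.Uhat p M Z x η) ≤ S.UhatStar p F M Z x h :=
  le_iSup₂ (f := fun η (_ : η ∈ {η ∈ F.bandwidths d | h ≤ η}) =>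
    ENNReal.ofReal (S.Uhat p M Z x η)) η ⟨hη, hh⟩

theorem ofReal_abs_sub_le_Rhat (Z : Fin n → Fin d → ℝ) (x h : Fin d → ℝ) {η : Fin d → ℝ}
    (hη : η ∈ F.bandwidths d) :
    ENNReal.ofReal |fhat M Z x (h ⊔ η) - fhat M Z x η| ≤ S.Rhat p F M Z x h
      + 4 * ENNReal.ofReal (S.Uhat p M Z x (h ⊔ η)) + 4 * ENNReal.ofReal (S.Uhat p M Z x η) := by
  have h1 : ENNReal.ofReal (|fhat M Z x (h ⊔ η) - fhat M Z x η| - 4 * S.Uhat p M Z x (h ⊔ η)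
      - 4 * S.Uhat p M Z x η) ≤ S.Rhat p F M Z x h :=
    le_iSup₂ (f := fun η (_ : η ∈ F.bandwidths d) => ENNReal.ofReal (|fhat M Z x (h ⊔ η)
      - fhat M Z x η| - 4 * S.Uhat p M Z x (h ⊔ η) - 4 * S.Uhat p M Z x η)) η hη
  have e : ∀ y : ℝ, 4 * ENNReal.ofReal y = ENNReal.ofReal (4 * y) := fun y => by
    rw [ENNReal.ofReal_mul (by norm_num)]
    norm_num
  rw [e, e]
  refine le_trans ?_ (add_le_add_left (add_le_add_left h1 _) _)
  refine le_trans (ENNReal.ofReal_le_ofReal ?_)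
    (ENNReal.ofReal_add_le.trans (add_le_add_left ENNReal.ofReal_add_le _))
  linarith

/-- The two subtracted terms 4Û_n absorb the deviations of the two estimators from their means up to
the noise, and the difference of the means is what `biasStar` measures. -/
theorem Rhat_le (hnoise : S.NoiseAssumption) (hp : 1 < p) (hn : 3 ≤ n)
    (hmean : ∀ h ∈ grid d, ∀ x, ∫ t, M (t - x) h ∂P = S.smooth f h x)
    (Z : Fin n → Fin d → ℝ) (x : Fin d → ℝ) {h : Fin d → ℝ} (hh : h ∈ F.bandwidths d) :
    S.Rhat p F M Z x h ≤ 2 * S.noise p P M n (x, Z) + S.biasStar F f h x := by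
  refine iSup₂_le fun η hη => ?_
  have hη' := F.bandwidths_subset hη
  have hs' := F.bandwidths_subset (Family.sup_mem hh hη)
  have h1 := ofReal_excess_le_noise (P := P) (M := M) hnoise hp hn Z x hη'
  have h2 := ofReal_excess_le_noise (P := P) (M := M) hnoise hp hn Z x hs'
  have h3 : ENNReal.ofReal |S.smooth f (h ⊔ η) x - S.smooth f η x| ≤ S.biasStar F f h x :=
    le_iSup₂ (f := fun η (_ : η ∈ F.bandwidths d) =>
      ENNReal.ofReal |S.smooth f (h ⊔ η) x - S.smooth f η x|) η hη
  rw [hmean _ hη'] at h1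
  rw [hmean _ hs'] at h2
  rw [two_mul]
  refine le_trans ?_ (add_le_add (add_le_add h2 h1) h3)
  refine le_trans (ENNReal.ofReal_le_ofReal ?_)
    (ENNReal.ofReal_add_le.trans (add_le_add_left ENNReal.ofReal_add_le _))
  have e : fhat M Z x (h ⊔ η) - fhat M Z x η = (fhat M Z x (h ⊔ η) - S.smooth f (h ⊔ η) x)
    - (fhat M Z x η - S.smooth f η x) + (S.smooth f (h ⊔ η) x - S.smooth f η x) := by ring
  have := abs_add_le ((fhat M Z x (h ⊔ η) - S.smooth f (h ⊔ η) x)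
    - (fhat M Z x η - S.smooth f η x)) (S.smooth f (h ⊔ η) x - S.smooth f η x)
  have := abs_sub (fhat M Z x (h ⊔ η) - S.smooth f (h ⊔ η) x) (fhat M Z x η - S.smooth f η x)
  rw [e]
  linarith

theorem UhatStar_le (hnoise : S.NoiseAssumption) (hp : 1 < p) (hn : 3 ≤ n)
    (Z : Fin n → Fin d → ℝ) (x h : Fin d → ℝ) :
    S.UhatStar p F M Z x h ≤ S.noise p P M n (x, Z) + 3 * S.UStar p F P M n h x := by
  refine iSup₂_le fun η hη => ?_
  refine (ofReal_Uhat_le (P := P) hnoise hp hn Z x (F.bandwidths_subset hη.1)).trans ?_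
  gcongr
  rw [ENNReal.ofReal_mul (by norm_num), ENNReal.ofReal_ofNat]
  gcongr
  exact le_iSup₂ (f := fun η (_ : η ∈ {η ∈ F.bandwidths d | h ≤ η}) =>
    ENNReal.ofReal (S.U p P M n x η)) η hη

/-- Goldenshluger–Lepski argument: f̂_{h∨g} and f̂_h are inserted between f̂_g and f, where g is the
selected bandwidth. The first difference is governed by R̂_h, the second by R̂_g, and Û*_g occurs 4
+ 4 = 8 times, exactly the weight in the criterion, so near-minimality replaces g by h. In total
Û*_h occurs 12 + 8 = 20 times, and each is at most the noise plus 3U*_h; hence the 60. -/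
theorem ofReal_abs_fhat_sub_le (hnoise : S.NoiseAssumption) (hp : 1 < p) (hn : 3 ≤ n)
    (hmean : ∀ h ∈ grid d, ∀ x, ∫ t, M (t - x) h ∂P = S.smooth f h x)
    {τ : (Fin d → ℝ) → ℝ} {sel : (Fin n → Fin d → ℝ) → (Fin d → ℝ) → (Fin d → ℝ)}
    (hsel : S.IsSelection p F M τ sel) (Z : Fin n → Fin d → ℝ) (x : Fin d → ℝ) {h : Fin d → ℝ}
    (hh : h ∈ F.bandwidths d) :
    ENNReal.ofReal |fhat M Z x (sel Z x) - f x| ≤ S.totalBias F f h x + 60 * S.UStar p F P M n h x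
      + (65 * S.noise p P M n (x, Z) + ENNReal.ofReal (τ x)) := by
  set g := sel Z x with hgdef
  have hg : g ∈ F.bandwidths d := hsel.mem Z x
  set ζ := S.noise p P M n (x, Z) with hζ
  set V := S.UStar p F P M n h x
  have r1 := ofReal_abs_sub_le_Rhat (S := S) (p := p) (F := F) (M := M) Z x h hg
  have r2 := ofReal_abs_sub_le_Rhat (S := S) (p := p) (F := F) (M := M) Z x g hh
  rw [sup_comm g h] at r2
  have hs := Family.sup_mem hh hg
  have u1 := ofReal_Uhat_le_UhatStar (S := S) (p := p) (M := M) Z x hs le_sup_left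
  have u2 := ofReal_Uhat_le_UhatStar (S := S) (p := p) (M := M) Z x hs le_sup_right
  have u3 := ofReal_Uhat_le_UhatStar (S := S) (p := p) (M := M) Z x hh le_rfl
  have u4 := ofReal_Uhat_le_UhatStar (S := S) (p := p) (M := M) Z x hg le_rfl
  have hcrit : S.criterion p F M Z x g ≤ S.criterion p F M Z x h + ENNReal.ofReal (τ x) :=
    (hsel.minimizes Z x).trans (by gcongr; exact iInf₂_le h hh)
  have hR := Rhat_le (P := P) (F := F) hnoise hp hn hmean Z x hh
  have hU := UhatStar_le (P := P) (F := F) (M := M) hnoise hp hn Z x h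
  have hex := ofReal_excess_le_noise (P := P) (M := M) hnoise hp hn Z x (F.bandwidths_subset hh)
  rw [hmean _ (F.bandwidths_subset hh)] at hex
  have hlast : ENNReal.ofReal |fhat M Z x h - f x|
      ≤ ζ + 4 * S.UhatStar p F M Z x h + S.bias f h x := by
    have h4 : ENNReal.ofReal (4 * S.Uhat p M Z x h) ≤ 4 * S.UhatStar p F M Z x h := by
      rw [ENNReal.ofReal_mul (by norm_num), ENNReal.ofReal_ofNat]
      gcongr
    refine le_trans ?_ (add_le_add_left (add_le_add hex h4) _)
    refine le_trans (ENNReal.ofReal_le_ofReal ?_)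
      (ENNReal.ofReal_add_le.trans (add_le_add_left ENNReal.ofReal_add_le _))
    have := abs_sub_le (fhat M Z x h) (S.smooth f h x) (f x)
    linarith
  have htri : ENNReal.ofReal |fhat M Z x g - f x| ≤ ENNReal.ofReal |fhat M Z x (h ⊔ g)
      - fhat M Z x g| + ENNReal.ofReal |fhat M Z x (h ⊔ g) - fhat M Z x h|
      + ENNReal.ofReal |fhat M Z x h - f x| := by
    refine le_trans (ENNReal.ofReal_le_ofReal ?_)
      (ENNReal.ofReal_add_le.trans (add_le_add_left ENNReal.ofReal_add_le _))
    have := abs_sub_le (fhat M Z x g) (fhat M Z x (h ⊔ g)) (fhat M Z x h)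
    have := abs_sub_le (fhat M Z x g) (fhat M Z x h) (f x)
    rw [abs_sub_comm (fhat M Z x (h ⊔ g)) (fhat M Z x g)]
    linarith
  unfold criterion at hcrit
  unfold totalBias
  calc _ ≤ (S.Rhat p F M Z x h + 4 * S.UhatStar p F M Z x h + 4 * S.UhatStar p F M Z x g)
        + (S.Rhat p F M Z x g + 4 * S.UhatStar p F M Z x g + 4 * S.UhatStar p F M Z x h)
        + (ζ + 4 * S.UhatStar p F M Z x h + S.bias f h x) := by
        refine htri.trans (add_le_add (add_le_add (r1.trans ?_) (r2.trans ?_)) hlast) <;> gcongr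
    _ = (S.Rhat p F M Z x h + 12 * S.UhatStar p F M Z x h + ζ + S.bias f h x)
        + (S.Rhat p F M Z x g + 8 * S.UhatStar p F M Z x g) := by ring
    _ ≤ (S.Rhat p F M Z x h + 12 * S.UhatStar p F M Z x h + ζ + S.bias f h x)
        + (S.Rhat p F M Z x h + 8 * S.UhatStar p F M Z x h + ENNReal.ofReal (τ x)) := by gcongr
    _ = 2 * S.Rhat p F M Z x h + 20 * S.UhatStar p F M Z x h + ζ + S.bias f h x
        + ENNReal.ofReal (τ x) := by ring
    _ ≤ 2 * (2 * ζ + S.biasStar F f h x) + 20 * (ζ + 3 * V) + ζ + S.bias f h x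
        + ENNReal.ofReal (τ x) := by gcongr
    _ = 2 * S.biasStar F f h x + S.bias f h x + 60 * V + (25 * ζ + ENNReal.ofReal (τ x)) := by ring
    _ ≤ _ := by gcongr; norm_num

/-- The oracle error `inf_h [ℬ_h(x, f) + 60 U*_n(x, h)]`. -/
def oracle (S : Model d) (p : ℝ) (F : Family) (P : Measure (Fin d → ℝ))
    (M : (Fin d → ℝ) → (Fin d → ℝ) → ℝ) (n : ℕ) (f : (Fin d → ℝ) → ℝ) (x : Fin d → ℝ) : ℝ≥0∞ :=
  ⨅ h ∈ F.bandwidths d, (S.totalBias F f h x + 60 * S.UStar p F P M n h x)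

theorem ofReal_abs_fhat_sub_le_oracle (hnoise : S.NoiseAssumption) (hp : 1 < p) (hn : 3 ≤ n)
    (hmean : ∀ h ∈ grid d, ∀ x, ∫ t, M (t - x) h ∂P = S.smooth f h x)
    {τ : (Fin d → ℝ) → ℝ} {sel : (Fin n → Fin d → ℝ) → (Fin d → ℝ) → (Fin d → ℝ)}
    (hsel : S.IsSelection p F M τ sel) (Z : Fin n → Fin d → ℝ) (x : Fin d → ℝ) :
    ENNReal.ofReal |fhat M Z x (sel Z x) - f x| ≤ S.oracle p F P M n f x
      + 65 * S.noise p P M n (x, Z) + ENNReal.ofReal (τ x) := by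
  -- With noise and tolerance moved to the left, the remaining right-hand side is an infimum, which
  -- need not be attained.
  rw [add_assoc, ← tsub_le_iff_right]
  refine le_iInf₂ fun h hh => ?_
  rw [tsub_le_iff_right]
  exact ofReal_abs_fhat_sub_le hnoise hp hn hmean hsel Z x hh

end Model

end ConvModel

end

/-! ### Tools for small levels: logarithmic integrals and domination by maximal functions -/

noncomputable section

theorem exists_one_add_pow_le_exp (t : ℕ) {δ : ℝ} (hδ : 0 < δ) :
    ∃ c : ℝ, 0 < c ∧ ∀ x : ℝ, 0 ≤ x → (1 + x) ^ t ≤ c * Real.exp (δ * x) := by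
  set ε := δ / (t + 1) with hε
  have hε0 : 0 < ε := by positivity
  refine ⟨(1 + ε⁻¹) ^ t, by positivity, fun x hx => ?_⟩
  have h1 : 1 + x ≤ (1 + ε⁻¹) * Real.exp (ε * x) := by
    have h2 := Real.add_one_le_exp (ε * x)
    have h3 : 1 ≤ Real.exp (ε * x) := Real.one_le_exp (by positivity)
    have h4 : x ≤ ε⁻¹ * Real.exp (ε * x) := by
      rw [inv_mul_eq_div, le_div_iff₀ hε0]
      linarith
    linarith
  calc (1 + x) ^ t ≤ ((1 + ε⁻¹) * Real.exp (ε * x)) ^ t := by gcongr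
    _ = (1 + ε⁻¹) ^ t * Real.exp (t * (ε * x)) := by rw [mul_pow, ← Real.exp_nat_mul]
    _ ≤ _ := by
        gcongr ?_ * Real.exp ?_
        have : t * ε ≤ δ := by
          rw [hε, mul_div_assoc', div_le_iff₀ (by positivity)]
          nlinarith
        nlinarith

/-- The logarithm at v is at most the one at y times 1 + ln(y/v), and the t-th power of the latter
is O((y/v)^δ) with δ = (p - 1)/2. Half of the exponent p - 1 pays for this and the other half keeps
the integral convergent at 0. -/
theorem exists_lintegral_Ioc_log_le {p : ℝ} (hp : 1 < p) (t : ℕ) :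
    ∃ C : ℝ≥0, ∀ y : ℝ, 0 < y → ∫⁻ v in Set.Ioc 0 y,
      ENNReal.ofReal (v⁻¹ * (1 + |Real.log v|) ^ t) * ENNReal.ofReal (v ^ (p - 1))
        ≤ C * ENNReal.ofReal (y ^ (p - 1) * (1 + |Real.log y|) ^ t) := by
  set δ := (p - 1) / 2 with hδ
  have hδ0 : 0 < δ := by linarith
  obtain ⟨c, hc, hct⟩ := exists_one_add_pow_le_exp t hδ0
  refine ⟨(c / δ).toNNReal, fun y hy => ?_⟩
  calc _ ≤ ∫⁻ v in Set.Ioc 0 y, ENNReal.ofReal (c * (1 + |Real.log y|) ^ t * y ^ δ)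
          * ENNReal.ofReal (v ^ (δ - 1)) := by
        refine setLIntegral_mono' measurableSet_Ioc fun v hv => ?_
        have hv0 : 0 < v := hv.1
        have hx : 0 ≤ Real.log (y / v) :=
          Real.log_nonneg ((one_le_div hv0).2 hv.2)
        have e1 : Real.log v = Real.log y - Real.log (y / v) := by
          rw [Real.log_div hy.ne' hv0.ne']
          ring
        have h1 : 1 + |Real.log v| ≤ (1 + |Real.log y|) * (1 + Real.log (y / v)) := by
          have h2 : |Real.log v| ≤ |Real.log y| + Real.log (y / v) := by
            rw [e1]
            refine (abs_sub _ _).trans_eq ?_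
            rw [abs_of_nonneg hx]
          nlinarith [abs_nonneg (Real.log y), mul_nonneg (abs_nonneg (Real.log y)) hx]
        have h3 : (1 + |Real.log v|) ^ t ≤ (1 + |Real.log y|) ^ t * (c * (y / v) ^ δ) := by
          calc _ ≤ ((1 + |Real.log y|) * (1 + Real.log (y / v))) ^ t := by gcongr
            _ = (1 + |Real.log y|) ^ t * (1 + Real.log (y / v)) ^ t := mul_pow _ _ _
            _ ≤ _ := by
                gcongr
                refine (hct _ hx).trans_eq ?_
                rw [Real.rpow_def_of_pos (by positivity), mul_comm δ]
        rw [← ENNReal.ofReal_mul (by positivity), ← ENNReal.ofReal_mul (by positivity)]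
        refine ENNReal.ofReal_le_ofReal ?_
        have e2 : v ^ (p - 1) = v ^ δ * v ^ δ := by
          rw [← Real.rpow_add hv0]
          congr 1
          rw [hδ]
          ring
        have hvδ := Real.rpow_pos_of_pos hv0 δ
        calc _ ≤ v⁻¹ * ((1 + |Real.log y|) ^ t * (c * (y / v) ^ δ)) * v ^ (p - 1) := by gcongr
          _ = _ := by
              rw [e2, Real.div_rpow hy.le hv0.le, Real.rpow_sub hv0, Real.rpow_one]
              field_simp
    _ = ENNReal.ofReal (c * (1 + |Real.log y|) ^ t * y ^ δ) * ENNReal.ofReal (y ^ δ / δ) := by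
        rw [lintegral_const_mul _ (by fun_prop), lintegral_Ioc_zero_rpow hy (by linarith)]
        simp
    _ ≤ _ := by
        rw [← ENNReal.ofReal_mul (by positivity), ← ENNReal.ofReal.eq_1,
          ← ENNReal.ofReal_mul (by positivity)]
        refine ENNReal.ofReal_le_ofReal (le_of_eq ?_)
        have e2 : y ^ (p - 1) = y ^ δ * y ^ δ := by
          rw [← Real.rpow_add hy]
          congr 1
          rw [hδ]
          ring
        rw [e2]
        ring

theorem lintegral_rpow_eq_layer_of_aemeasurable {X : Type*} [MeasurableSpace X] {μ : Measure X}
    [SFinite μ] {F : X → ℝ≥0∞} (hF : AEMeasurable F μ) {r : ℝ} (hr : 0 < r) :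
    ∫⁻ x, F x ^ r ∂μ = ENNReal.ofReal r
      * ∫⁻ t in Set.Ioi 0, μ {x | ENNReal.ofReal t < F x} * ENNReal.ofReal (t ^ (r - 1)) := by
  have h : ∀ t : ℝ, μ {x | ENNReal.ofReal t < F x} = μ {x | ENNReal.ofReal t < hF.mk F x} :=
    fun t => measure_congr (by
      filter_upwards [hF.ae_eq_mk] with x hx
      change (ENNReal.ofReal t < F x) = (ENNReal.ofReal t < hF.mk F x)
      rw [hx])
  simp only [h]
  rw [← lintegral_rpow_eq_layer hF.measurable_mk hr]
  refine lintegral_congr_ae ?_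
  filter_upwards [hF.ae_eq_mk] with x hx
  rw [hx]

namespace ConvModel

variable {d : ℕ}

theorem countable_bandwidths (F : Family) : (F.bandwidths d).Countable :=
  (Set.countable_range (expVec (d := d))).mono fun h hh => by
    obtain ⟨k, hk⟩ := exists_expVec (F.bandwidths_subset hh)
    exact ⟨k, hk.symm⟩

/-- Moments of order between `1` and `min q 2` of a function in `L_1 ∩ L_q`. -/
theorem exists_moment_bound {q : ℝ≥0∞} (hq : 1 < q) (R D : ℝ) :
    ∃ (q₀ : ℝ) (B : ℝ≥0), 1 < q₀ ∧ q₀ ≤ 2 ∧ ∀ f ∈ lpBall d 1 R ∩ lpBall d q D,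
      ∀ r, 1 ≤ r → r ≤ q₀ → ∫⁻ x, ‖f x‖ₑ ^ r ≤ B := by
  have hpow : ∀ (y : ℝ≥0∞) (r q₁ : ℝ), 1 ≤ r → r ≤ q₁ → y ^ r ≤ y + y ^ q₁ := by
    intro y r q₁ h1 h2
    rcases le_total y 1 with hy | hy
    · calc y ^ r ≤ y ^ (1 : ℝ) := ENNReal.rpow_le_rpow_of_exponent_ge hy h1
        _ = y := ENNReal.rpow_one y
        _ ≤ _ := le_self_add
    · exact (ENNReal.rpow_le_rpow_of_exponent_le hy h2).trans le_add_self
  have hL1 : ∀ f ∈ lpBall d 1 R, ∫⁻ x, ‖f x‖ₑ ≤ ENNReal.ofReal R := fun f hf => by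
    have := hf.2
    rwa [eLpNorm_one_eq_lintegral_enorm] at this
  by_cases hq' : q = ∞
  · refine ⟨2, (ENNReal.ofReal R + ENNReal.ofReal D * ENNReal.ofReal R).toNNReal, by norm_num,
      le_rfl, fun f hf r h1 h2 => ?_⟩
    rw [ENNReal.coe_toNNReal (by finiteness)]
    have hfD := hf.2.2
    rw [hq', eLpNorm_exponent_top] at hfD
    have hae : ∀ᵐ x, ‖f x‖ₑ ≤ ENNReal.ofReal D := by
      filter_upwards [ae_le_eLpNormEssSup (f := f) (μ := volume)] with x hx
      exact hx.trans hfD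
    have hm := hf.1.1.aestronglyMeasurable.enorm
    calc ∫⁻ x, ‖f x‖ₑ ^ r ≤ ∫⁻ x, (‖f x‖ₑ + ENNReal.ofReal D * ‖f x‖ₑ) := by
          refine lintegral_mono_ae ?_
          filter_upwards [hae] with x hx
          refine (hpow _ r 2 h1 h2).trans ?_
          gcongr
          rw [ENNReal.rpow_two, sq]
          gcongr
      _ = (∫⁻ x, ‖f x‖ₑ) + ENNReal.ofReal D * ∫⁻ x, ‖f x‖ₑ := by
          rw [lintegral_add_left' hm, lintegral_const_mul'' _ hm]
      _ ≤ _ := by gcongr <;> exact hL1 f hf.1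
  · have hq1 : 1 < q.toReal := by
      rw [← ENNReal.toReal_one]
      exact (ENNReal.toReal_lt_toReal ENNReal.one_ne_top hq').2 hq
    refine ⟨min q.toReal 2, (ENNReal.ofReal R + ENNReal.ofReal D ^ q.toReal).toNNReal,
      lt_min hq1 (by norm_num), min_le_right _ _, fun f hf r h1 h2 => ?_⟩
    rw [ENNReal.coe_toNNReal (by finiteness)]
    have hm := hf.1.1.aestronglyMeasurable.enorm
    have hfq : ∫⁻ x, ‖f x‖ₑ ^ q.toReal ≤ ENNReal.ofReal D ^ q.toReal := by
      have h3 := hf.2.2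
      rw [eLpNorm_eq_lintegral_rpow_enorm_toReal (by positivity) hq', one_div,
        ENNReal.rpow_inv_le_iff (by linarith)] at h3
      exact h3
    calc ∫⁻ x, ‖f x‖ₑ ^ r ≤ ∫⁻ x, (‖f x‖ₑ + ‖f x‖ₑ ^ q.toReal) :=
          lintegral_mono fun x => hpow _ r _ h1 (h2.trans (min_le_left _ _))
      _ = (∫⁻ x, ‖f x‖ₑ) + ∫⁻ x, ‖f x‖ₑ ^ q.toReal := lintegral_add_left' hm _
      _ ≤ _ := by
          gcongr
          exact hL1 f hf.1

/-- The maximal function over the boxes with the bandwidths in the family. -/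
def famMax (F : Family) (A : ℝ) (G : (Fin d → ℝ) → ℝ≥0∞) (x : Fin d → ℝ) : ℝ≥0∞ :=
  ⨆ k ∈ {k : Fin d → ℤ | expVec k ∈ F.bandwidths d}, avgOver volume (expBox A k) G x

theorem expBox_const {A : ℝ} (hA : 0 < A) (k : ℤ) :
    expBox (d := d) A (fun _ => k) = Metric.closedBall 0 (A * Real.exp k) := by
  ext x
  rw [mem_closedBall_zero_iff, pi_norm_le_iff_of_nonneg (by positivity)]
  simp only [expBox, Set.mem_Icc, Pi.le_def, ← forall_and, Real.norm_eq_abs, abs_le]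

/-- This is the source of t(ℍ): general boxes need the strong maximal function, with d - 1
logarithms, while equal bandwidths give cubes, the balls of the sup norm, for which the weak (1,1)
inequality has none. -/
theorem exists_measure_lt_famMax_le (hd : 1 ≤ d) {A : ℝ} (hA : 0 < A) {q₀ : ℝ} (hq : 1 < q₀)
    (hq2 : q₀ ≤ 2) : ∃ C : ℝ≥0, ∀ (F : Family) (G : (Fin d → ℝ) → ℝ≥0∞), Measurable G →
      ∀ B : ℝ≥0∞, (∀ r, 1 ≤ r → r ≤ q₀ → ∫⁻ x, G x ^ r ≤ B) → ∀ v : ℝ, 0 < v →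
      volume {x | ENNReal.ofReal v < famMax F A G x}
        ≤ C * B * ENNReal.ofReal (v⁻¹ * (1 + |Real.log v|) ^ F.logExponent d) := by
  obtain ⟨d, rfl⟩ : ∃ d', d = d' + 1 := ⟨d - 1, by omega⟩
  obtain ⟨C, hC⟩ := measure_lt_maxOver_expBox_le_log hA d hq hq2
  refine ⟨max C (5 ^ (d + 1)), fun F G hG B hB v hv => ?_⟩
  cases F with
  | full =>
    refine (measure_mono ?_).trans ((hC hG B (fun r h1 h2 => hB r h1.le h2) v hv).trans ?_)
    · intro x hx
      rw [Set.mem_ofPred_eq] at hx ⊢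
      refine hx.trans_le ?_
      exact iSup₂_le fun k _ => avgOver_le_maxOver _ _ _ _ _
    · gcongr
      · exact_mod_cast le_max_left _ _
      · simp
      · exact le_rfl
  | isotropic =>
    have h1 := measure_lt_maxOver_closedBall_le (μ := (volume : Measure (Fin (d + 1) → ℝ)))
      (ρ := fun k : ℤ => A * Real.exp k) (fun k => by positivity) G
      (t := ENNReal.ofReal v) (by simpa using hv) ENNReal.ofReal_ne_top
    refine (measure_mono ?_).trans (h1.trans ?_)
    · intro x hx
      rw [Set.mem_ofPred_eq] at hx ⊢
      refine hx.trans_le ?_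
      refine iSup₂_le fun k hk => ?_
      obtain ⟨i, hi⟩ := hk
      have hki : k = fun _ => i := funext fun j => by
        have := hi j
        rw [expVec, Real.exp_eq_exp] at this
        exact_mod_cast this
      rw [hki, expBox_const hA]
      exact avgOver_le_maxOver volume (fun k : ℤ => Metric.closedBall 0 (A * Real.exp k)) G x i
    · have h2 : ∫⁻ x, G x ≤ B := by simpa using hB 1 le_rfl hq.le
      rw [Module.finrank_fin_fun, ← ENNReal.ofReal_inv_of_pos hv, mul_right_comm]
      simp only [Family.logExponent, pow_zero, mul_one]
      gcongr
      exact_mod_cast le_max_right _ _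

namespace Model

variable {S : Model d}

/-- The smoothed function is dominated by averages over boxes. -/
theorem exists_smooth_le (hKcont : Continuous S.K) (hKsupp : HasCompactSupport S.K) :
    ∃ (A : ℝ) (c : ℝ≥0), 0 < A ∧ ∀ (f : (Fin d → ℝ) → ℝ) (k : Fin d → ℤ) (x : Fin d → ℝ),
      ENNReal.ofReal |S.smooth f (expVec k) x| ≤ c * avgOver volume (expBox A k) (fun t => ‖f t‖ₑ) x
      := by
  obtain ⟨A₀, hA₀⟩ := hKsupp.isCompact.isBounded.subset_closedBall 0
  obtain ⟨b, hb⟩ := hKsupp.exists_bound_of_continuous hKcont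
  set A := max A₀ 1
  have hA : 0 < A := lt_max_of_lt_right one_pos
  have hb0 : 0 ≤ b := (norm_nonneg _).trans (hb 0)
  have hzero : ∀ t : Fin d → ℝ, (∃ j, A < |t j|) → S.K t = 0 := by
    rintro t ⟨j, hj⟩
    by_contra h
    have h1 := hA₀ (subset_tsupport _ (Function.mem_support.2 h))
    rw [mem_closedBall_zero_iff] at h1
    have h2 := norm_le_pi_norm t j
    rw [Real.norm_eq_abs] at h2
    linarith [le_max_left A₀ 1]
  refine ⟨A, (b * (2 * A) ^ d).toNNReal, hA, fun f k x => ?_⟩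
  set V := ∏ j, expVec k j with hV
  have hV0 : 0 < V := Finset.prod_pos fun j _ => expVec_pos k j
  have hvol : volume (expBox A k) = ENNReal.ofReal ((2 * A) ^ d * V) := by
    rw [expBox, Real.volume_Icc_pi, ← ENNReal.ofReal_prod_of_nonneg]
    · congr 1
      have : ∀ j, A * Real.exp (k j) - -(A * Real.exp (k j)) = 2 * A * expVec k j := fun j => by
        unfold expVec
        ring
      simp only [this, Finset.prod_mul_distrib, Finset.prod_const, Finset.card_univ,
        Fintype.card_fin, hV]
      ring
    · intro j _
      have : 0 < A * Real.exp (k j) := by positivity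
      linarith
  have hker : ∀ s : Fin d → ℝ, ‖S.scaledK (expVec k) s‖ₑ
      ≤ (expBox A k).indicator (fun _ => ENNReal.ofReal (V⁻¹ * b)) s := by
    intro s
    by_cases hs : s ∈ expBox A k
    · rw [Set.indicator_of_mem hs, ← ofReal_norm]
      refine ENNReal.ofReal_le_ofReal ?_
      rw [scaledK, norm_mul, norm_inv, Real.norm_of_nonneg hV0.le]
      gcongr
      exact hb _
    · have h1 : ∃ j, A < |s j / expVec k j| := by
        by_contra hcon
        push Not at hcon
        refine hs (forall_and.1 fun j => abs_le.1 ?_)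
        · have h2 := hcon j
          rw [abs_div, abs_of_pos (expVec_pos k j), div_le_iff₀ (expVec_pos k j)] at h2
          exact h2
      rw [scaledK, hzero _ h1]
      simp
  calc ENNReal.ofReal |S.smooth f (expVec k) x| = ‖S.smooth f (expVec k) x‖ₑ := by
        rw [← ofReal_norm, Real.norm_eq_abs]
    _ ≤ ∫⁻ t, ‖S.scaledK (expVec k) (t - x) * f t‖ₑ := enorm_integral_le_lintegral_enorm _
    _ = ∫⁻ s, ‖S.scaledK (expVec k) s * f (x + s)‖ₑ := by
        rw [← lintegral_add_left_eq_self _ x]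
        simp
    _ ≤ ∫⁻ s, (expBox A k).indicator (fun s => ENNReal.ofReal (V⁻¹ * b) * ‖f (x + s)‖ₑ) s := by
        refine lintegral_mono fun s => ?_
        rw [enorm_mul]
        refine (mul_le_mul_left (hker s) _).trans ?_
        by_cases hs : s ∈ expBox A k
        · simp [Set.indicator_of_mem hs]
        · simp [Set.indicator_of_notMem hs]
    _ = ENNReal.ofReal (V⁻¹ * b) * ∫⁻ s in expBox A k, ‖f (x + s)‖ₑ := by
        rw [lintegral_indicator (measurableSet_expBox A k),
          lintegral_const_mul' _ _ ENNReal.ofReal_ne_top]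
    _ = _ := by
        rw [avgOver, hvol, ← ENNReal.ofReal_inv_of_pos (by positivity), ← mul_assoc]
        congr 1
        rw [← ENNReal.ofReal_coe_nnreal, Real.coe_toNNReal _ (by positivity),
          ← ENNReal.ofReal_mul (by positivity)]
        congr 1
        field_simp

end Model

end ConvModel

end

/-! ### The oracle error at small levels -/

noncomputable section

theorem avgOver_congr_ae {d : ℕ} (B : Set (Fin d → ℝ)) {G G' : (Fin d → ℝ) → ℝ≥0∞}
    (h : G =ᵐ[volume] G') (x : Fin d → ℝ) : avgOver volume B G x = avgOver volume B G' x := by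
  unfold avgOver
  congr 1
  refine lintegral_congr_ae (ae_restrict_of_ae ?_)
  exact (measurePreserving_add_left volume x).quasiMeasurePreserving.ae h

theorem lintegral_Ioi_div_rpow {r w y : ℝ} (hw : r < w) (hy : 0 < y) :
    ∫⁻ t in Set.Ioi y, ENNReal.ofReal ((t / y) ^ (-w)) * ENNReal.ofReal (t ^ (r - 1))
      = ENNReal.ofReal ((w - r)⁻¹) * ENNReal.ofReal (y ^ r) := by
  calc _ = ∫⁻ t in Set.Ioi y, ENNReal.ofReal (y ^ w) * ENNReal.ofReal (t ^ (r - 1 - w)) := by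
        refine setLIntegral_congr_fun measurableSet_Ioi fun t ht => ?_
        have ht0 : 0 < t := hy.trans ht
        change ENNReal.ofReal ((t / y) ^ (-w)) * ENNReal.ofReal (t ^ (r - 1))
          = ENNReal.ofReal (y ^ w) * ENNReal.ofReal (t ^ (r - 1 - w))
        rw [← ENNReal.ofReal_mul (by positivity), ← ENNReal.ofReal_mul (by positivity)]
        congr 1
        rw [Real.div_rpow ht0.le hy.le, Real.rpow_neg hy.le, Real.rpow_sub ht0 (r - 1) w,
          Real.rpow_neg ht0.le]
        field_simp
    _ = _ := by
        rw [lintegral_const_mul _ (by fun_prop), lintegral_Ioi_rpow hy (by linarith),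
          ← ENNReal.ofReal_mul (by positivity),
          ← ENNReal.ofReal_mul (inv_nonneg.2 (by linarith))]
        congr 1
        have e : r - 1 - w + 1 = r - w := by ring
        have hd : r - w ≠ 0 := by linarith
        have hd' : w - r ≠ 0 := by linarith
        rw [e, Real.rpow_sub hy]
        have := Real.rpow_pos_of_pos hy w
        field_simp
        ring

theorem ENNReal.le_mul_iInf₂ {ι : Type*} {s : Set ι} {a C : ℝ≥0∞} {g : ι → ℝ≥0∞} (hC : C ≠ 0)
    (hC' : C ≠ ∞) (h : ∀ i ∈ s, a ≤ C * g i) : a ≤ C * ⨅ i ∈ s, g i := by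
  rw [mul_comm, ← ENNReal.div_le_iff hC hC']
  refine le_iInf₂ fun i hi => ?_
  rw [ENNReal.div_le_iff hC hC', mul_comm]
  exact h i hi

namespace ConvModel

variable {d : ℕ}

namespace Model

variable {S : Model d} {p : ℝ} {P : Measure (Fin d → ℝ)} {M : (Fin d → ℝ) → (Fin d → ℝ) → ℝ}
  {n : ℕ} {F : Family} {f : (Fin d → ℝ) → ℝ}

theorem measurable_smooth (hK : Measurable S.K) (hf : AEStronglyMeasurable f volume)
    (h : Fin d → ℝ) : Measurable fun x => S.smooth f h x := by
  have h1 : ∀ x, S.smooth f h x = ∫ t, S.scaledK h (t - x) * hf.mk f t := fun x => by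
    refine integral_congr_ae ?_
    filter_upwards [hf.ae_eq_mk] with t ht
    rw [ht]
  simp only [h1]
  have hKs : Measurable (S.scaledK h) := by
    unfold scaledK
    exact (hK.comp (by fun_prop)).const_mul _
  have h2 : Measurable fun w : (Fin d → ℝ) × (Fin d → ℝ) =>
      S.scaledK h (w.2 - w.1) * hf.mk f w.2 :=
    (hKs.comp (by fun_prop : Measurable fun w : (Fin d → ℝ) × (Fin d → ℝ) => w.2 - w.1)).mul
      (hf.stronglyMeasurable_mk.measurable.comp measurable_snd)
  exact h2.stronglyMeasurable.integral_prod_right'.measurable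

theorem aemeasurable_totalBias (hK : Measurable S.K) (hf : AEStronglyMeasurable f volume)
    (F : Family) (h : Fin d → ℝ) : AEMeasurable (S.totalBias F f h) volume := by
  have h1 : Measurable (S.biasStar F f h) :=
    Measurable.biSup _ (countable_bandwidths F) fun η _ =>
      ((measurable_smooth hK hf (h ⊔ η)).sub (measurable_smooth hK hf η)).abs.ennreal_ofReal
  have h2 : AEMeasurable (S.bias f h) volume := by
    have := ((measurable_smooth hK hf h).aemeasurable.sub hf.aemeasurable).norm.ennreal_ofReal
    exact this
  exact (h1.aemeasurable.const_mul 2).add h2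

theorem measurable_UStar [SFinite P] (hM : ∀ h ∈ grid d, S.IsSolution h fun y => M y h)
    (h : Fin d → ℝ) : Measurable (S.UStar p F P M n h) := by
  refine Measurable.biSup _ ((countable_bandwidths F).mono fun η hη => hη.1) fun η hη => ?_
  have h1 := measurable_integral_translate (P := P)
    ((hM η (F.bandwidths_subset hη.1)).measurable.pow_const 2)
  unfold U bernsteinBound
  fun_prop

theorem aemeasurable_oracle [SFinite P] (hK : Measurable S.K)
    (hf : AEStronglyMeasurable f volume) (hM : ∀ h ∈ grid d, S.IsSolution h fun y => M y h) :
    AEMeasurable (S.oracle p F P M n f) volume :=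
  AEMeasurable.biInf _ (countable_bandwidths F) fun h _ =>
    (aemeasurable_totalBias hK hf F h).add ((measurable_UStar hM h).const_mul _).aemeasurable

/-- ℬ_h contains five smoothed functions, 2·2 in the doubled supremum and one in |S_h - f|, each
dominated by the maximal function. -/
theorem totalBias_le {A : ℝ} {c : ℝ≥0} (hc : ∀ (k : Fin d → ℤ) (x : Fin d → ℝ),
      ENNReal.ofReal |S.smooth f (expVec k) x| ≤ c * avgOver volume (expBox A k) (fun t => ‖f t‖ₑ) x)
    {h : Fin d → ℝ} (hh : h ∈ F.bandwidths d) (x : Fin d → ℝ) :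
    S.totalBias F f h x ≤ 5 * c * famMax F A (fun t => ‖f t‖ₑ) x + ‖f x‖ₑ := by
  have h1 : ∀ η ∈ F.bandwidths d, ENNReal.ofReal |S.smooth f η x|
      ≤ c * famMax F A (fun t => ‖f t‖ₑ) x := fun η hη => by
    obtain ⟨k, rfl⟩ := exists_expVec (F.bandwidths_subset hη)
    refine (hc k x).trans ?_
    gcongr
    exact le_iSup₂ (f := fun k (_ : k ∈ {k : Fin d → ℤ | expVec k ∈ F.bandwidths d}) =>
      avgOver volume (expBox A k) (fun t => ‖f t‖ₑ) x) k hη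
  have hsub : ∀ a b : ℝ, ENNReal.ofReal |a - b| ≤ ENNReal.ofReal |a| + ENNReal.ofReal |b| :=
    fun a b => (ENNReal.ofReal_le_ofReal (abs_sub a b)).trans ENNReal.ofReal_add_le
  set m := famMax F A (fun t => ‖f t‖ₑ) x
  have h2 : S.biasStar F f h x ≤ c * m + c * m := iSup₂_le fun η hη =>
    (hsub _ _).trans (add_le_add (h1 _ (Family.sup_mem hh hη)) (h1 _ hη))
  have h3 : S.bias f h x ≤ c * m + ‖f x‖ₑ := by
    refine (hsub _ _).trans (add_le_add (h1 _ hh) ?_)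
    rw [← ofReal_norm, Real.norm_eq_abs]
  calc S.totalBias F f h x ≤ 2 * (c * m + c * m) + (c * m + ‖f x‖ₑ) := by
        unfold totalBias
        gcongr
    _ = _ := by ring

theorem Gn_add_le_exp (hnoise : S.NoiseAssumption) (hn : 3 ≤ n) (k : Fin d → ℤ)
    (m : Fin d → ℕ) : S.Gn n (expVec fun j => k j + m j)
      ≤ 2 * Real.exp (-((∑ j, (m j : ℝ)) / 2)) * S.Gn n (expVec k) := by
  rw [Gn_eq, Gn_eq]
  exact div_add_le (by linarith [one_le_logSize hn (expVec k)]) (by positivity)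
    (S.wt_pos (expVec_pos k)) (logSize_add_le hn k m) (S.wt_add_ge hnoise k m)

theorem UStar_le (hnoise : S.NoiseAssumption) (hp : 1 < p) (hn : 3 ≤ n) [IsProbabilityMeasure P]
    (hP : P ≪ volume) (hg : Integrable S.g volume) (hKint : Integrable S.K volume)
    (hkernel : S.KernelAssumption) (hM : ∀ h ∈ grid d, S.IsSolution h fun y => M y h)
    (k : Fin d → ℤ) (x : Fin d → ℝ) : S.UStar p F P M n (expVec k) x
      ≤ ENNReal.ofReal (6 * S.lamConst p * S.Minf * n * S.Gn n (expVec k)) := by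
  refine iSup₂_le fun η ⟨hηF, hη⟩ => ENNReal.ofReal_le_ofReal ?_
  obtain ⟨l, rfl⟩ := exists_expVec (F.bandwidths_subset hηF)
  obtain ⟨m, rfl⟩ := exists_eq_add_natCast (expVec_le_iff.1 hη)
  have hG := S.Gn_add_le hnoise hn k m
  set l : Fin d → ℤ := fun j => k j + m j
  have hsolk := hM _ (expVec_mem_grid l)
  have hb := (hsolk.bounds hg hKint hnoise hkernel (expVec_pos l)).1
  have hw := S.wt_pos (expVec_pos l)
  have hMi := S.one_le_Minf
  have hlam6 := S.six_le_lamN hnoise hp hn (expVec l)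
  have hc := S.lamConst_pos hnoise hp
  have hs : ∫ t, M (t - x) (expVec l) ^ 2 ∂P ≤ (S.Minf / S.wt (expVec l)) ^ 2 := by
    have h1 : ∀ᵐ t, |M (t - x) (expVec l)| ≤ S.Minf / S.wt (expVec l) :=
      (measurePreserving_sub_right volume x).quasiMeasurePreserving.ae hb
    have := integral_mono_of_nonneg (μ := P) (f := fun t => M (t - x) (expVec l) ^ 2)
      (g := fun _ => (S.Minf / S.wt (expVec l)) ^ 2)
      (Filter.Eventually.of_forall fun _ => sq_nonneg _) (integrable_const _) (by
        filter_upwards [hP.ae_le h1] with t ht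
        exact sq_le_sq' (by linarith [(abs_le.1 ht).1]) (abs_le.1 ht).2)
    simpa using this
  have hn1 : (n : ℝ) ^ (-(1 / 2) : ℝ) ≤ 1 :=
    Real.rpow_le_one_of_one_le_of_nonpos (by exact_mod_cast (by omega : 1 ≤ n)) (by norm_num)
  calc S.U p P M n x (expVec l)
      ≤ 3 * S.lamN p n (expVec l) * (S.Minf / S.wt (expVec l) * (n : ℝ) ^ (-(1 / 2) : ℝ)) :=
        bernsteinBound_le (by linarith) (by positivity) (by omega) hs
    _ ≤ 3 * (S.lamConst p * logSize n (expVec l)) * (S.Minf / S.wt (expVec l) * 1) := by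
        have := one_le_logSize hn (expVec l)
        gcongr
        exact S.lamN_le hnoise hp hn _
    _ = 3 * S.lamConst p * S.Minf * n * S.Gn n (expVec l) := by
        rw [Gn_eq]
        field_simp
    _ ≤ 3 * S.lamConst p * S.Minf * n * (2 * S.Gn n (expVec k)) := by gcongr
    _ = _ := by ring

/-- Evaluate the infimum at h = (e^N, …, e^N) and let N → ∞: U*_h tends to 0 since G_n(h) does,
while the bias bound does not depend on h. -/
theorem oracle_le (hd : 1 ≤ d) (hnoise : S.NoiseAssumption) (hp : 1 < p) (hn : 3 ≤ n)
    [IsProbabilityMeasure P] (hP : P ≪ volume) (hg : Integrable S.g volume)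
    (hKint : Integrable S.K volume) (hkernel : S.KernelAssumption)
    (hM : ∀ h ∈ grid d, S.IsSolution h fun y => M y h) {A : ℝ} {c : ℝ≥0}
    (hc : ∀ (k : Fin d → ℤ) (x : Fin d → ℝ), ENNReal.ofReal |S.smooth f (expVec k) x|
      ≤ c * avgOver volume (expBox A k) (fun t => ‖f t‖ₑ) x) (x : Fin d → ℝ) :
    S.oracle p F P M n f x ≤ 5 * c * famMax F A (fun t => ‖f t‖ₑ) x + ‖f x‖ₑ := by
  set y := 5 * c * famMax F A (fun t => ‖f t‖ₑ) x + ‖f x‖ₑ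
  set c' := 6 * S.lamConst p * S.Minf * n with hc'
  have hc'0 : 0 ≤ c' := by
    have := S.lamConst_pos hnoise hp
    have := S.one_le_Minf
    positivity
  have hbound : ∀ N : ℕ, S.oracle p F P M n f x ≤ y + 60 * ENNReal.ofReal
      (c' * (2 * Real.exp (-((N : ℝ) / 2)) * S.Gn n (expVec fun _ : Fin d => 0))) := by
    intro N
    have hmem : expVec (fun _ : Fin d => (0 : ℤ) + (N : ℤ)) ∈ F.bandwidths d := by
      cases F with
      | full => exact expVec_mem_grid _
      | isotropic => exact ⟨0 + N, fun j => rfl⟩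
    refine (iInf₂_le _ hmem).trans ?_
    have hG0 := S.Gn_nonneg hn (fun _ : Fin d => 0)
    have hG := Gn_add_le_exp hnoise hn (fun _ : Fin d => 0) (fun _ => N)
    have hU := UStar_le (F := F) hnoise hp hn hP hg hKint hkernel hM
      (fun _ : Fin d => (0 : ℤ) + (N : ℤ)) x
    have hsum : (N : ℝ) ≤ ∑ _j : Fin d, (N : ℝ) := by
      rw [Finset.sum_const, Finset.card_univ, Fintype.card_fin, nsmul_eq_mul]
      have : (1 : ℝ) ≤ d := by exact_mod_cast hd
      nlinarith [Nat.cast_nonneg (α := ℝ) N]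
    refine add_le_add (totalBias_le hc hmem x) ?_
    gcongr
    refine hU.trans (ENNReal.ofReal_le_ofReal ?_)
    gcongr
    refine hG.trans ?_
    gcongr
  have hlim : Filter.Tendsto (fun N : ℕ => y + 60 * ENNReal.ofReal
      (c' * (2 * Real.exp (-((N : ℝ) / 2)) * S.Gn n (expVec fun _ : Fin d => 0)))) Filter.atTop
      (nhds (y + 60 * ENNReal.ofReal (c' * (2 * 0 * S.Gn n (expVec fun _ : Fin d => 0))))) := by
    have he : Filter.Tendsto (fun N : ℕ => Real.exp (-((N : ℝ) / 2))) Filter.atTop (nhds 0) :=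
      Real.tendsto_exp_neg_atTop_nhds_zero.comp
        (tendsto_natCast_atTop_atTop.atTop_div_const (by norm_num))
    refine tendsto_const_nhds.add (ENNReal.Tendsto.const_mul ?_ (Or.inr (by norm_num)))
    exact ENNReal.tendsto_ofReal (((he.const_mul 2).mul_const _).const_mul _)
  have := ge_of_tendsto' hlim hbound
  simpa using this

theorem setOf_lt_oracle_subset {c₀ K₀ : ℝ} (hc₀ : 0 ≤ c₀) (hK₀ : 60 * c₀ + 1 ≤ K₀)
    {h : Fin d → ℝ} (hh : h ∈ F.bandwidths d) {t : ℝ} (ht : 0 < t) :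
    {x | ENNReal.ofReal (K₀ * t) < S.oracle p F P M n f x}
      ⊆ {x | ENNReal.ofReal t < S.totalBias F f h x}
        ∪ {x | ENNReal.ofReal (c₀ * t) < S.UStar p F P M n h x} := by
  intro x hx
  by_contra hcon
  rw [Set.mem_union, not_or, Set.mem_ofPred_eq, Set.mem_ofPred_eq, not_lt, not_lt] at hcon
  rw [Set.mem_ofPred_eq] at hx
  refine hx.not_ge ((iInf₂_le _ hh).trans ?_)
  calc _ ≤ ENNReal.ofReal t + 60 * ENNReal.ofReal (c₀ * t) := by
        gcongr
        exacts [hcon.1, hcon.2]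
    _ = ENNReal.ofReal (t + 60 * (c₀ * t)) := by
        rw [ENNReal.ofReal_add ht.le (by positivity), ENNReal.ofReal_mul (by norm_num : (0:ℝ) ≤ 60),
          ENNReal.ofReal_ofNat]
    _ ≤ _ := ENNReal.ofReal_le_ofReal (by nlinarith)

theorem setOf_lt_totalBias_subset_levelSet (h : Fin d → ℝ) {s t : ℝ} (hst : s ≤ 2 * t) :
    {x | ENNReal.ofReal t < S.totalBias F f h x} ⊆ S.levelSet F f h s := fun x hx => by
  rw [Set.mem_ofPred_eq] at hx
  exact (ENNReal.ofReal_le_ofReal (by linarith)).trans hx.le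

theorem a_nonneg (S : Model d) (p D : ℝ) : 0 ≤ S.a p D := by
  have : 0 ≤ S.c₁ D * √(S.c₃ p) :=
    mul_nonneg (mul_nonneg (zero_le_one.trans (le_max_right _ _)) (Real.sqrt_nonneg _))
      (Real.sqrt_nonneg _)
  exact inv_nonneg.2 (mul_nonneg (by norm_num) (le_max_of_le_left this))

theorem Fn_pos (S : Model d) (hn : 3 ≤ n) (k : Fin d → ℤ) : 0 < S.Fn n (expVec k) := by
  have h1 := S.Fn_sq hn k
  have h2 : 0 < logSize n (expVec k) / (n * S.wtSq (expVec k)) :=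
    div_pos (by linarith [one_le_logSize hn (expVec k)])
      (mul_pos (by positivity) (S.wtSq_pos (expVec_pos k)))
  refine lt_of_le_of_ne (S.Fn_nonneg n k) fun h => ?_
  rw [← h1, ← h] at h2
  simp at h2

/-- The contribution of the small levels. -/
theorem exists_lintegral_small_levels_le (hd : 1 ≤ d) (hnoise : S.NoiseAssumption)
    (hkernel : S.KernelAssumption) (hg : Integrable S.g volume) (hKcont : Continuous S.K)
    (hKint : Integrable S.K volume) (hKsupp : HasCompactSupport S.K) (hp : 1 < p) {q : ℝ≥0∞}
    (hq : 1 < q) (R D : ℝ) :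
    ∃ (K₁ : ℝ) (C : ℝ≥0), 0 < K₁ ∧ ∀ (P : Measure (Fin d → ℝ)) [IsProbabilityMeasure P],
      P ≪ volume → ∀ (F : Family) (n : ℕ), 3 ≤ n → ∀ M : (Fin d → ℝ) → (Fin d → ℝ) → ℝ,
      (∀ h ∈ grid d, S.IsSolution h fun y => M y h) → ∀ f ∈ lpBall d 1 R ∩ lpBall d q D,
      ∀ K₀, K₁ ≤ K₀ → ∀ y : ℝ, 0 < y → ∫⁻ t in Set.Ioc 0 y,
        volume {x | ENNReal.ofReal (K₀ * t) < S.oracle p F P M n f x}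
          * ENNReal.ofReal (t ^ (p - 1)) ≤ C * ENNReal.ofReal (F.ell d p y) := by
  obtain ⟨A, c, hA, hc⟩ := exists_smooth_le (S := S) hKcont hKsupp
  obtain ⟨q₀, B, hq₀, hq₀2, hB⟩ := exists_moment_bound (d := d) hq R D
  obtain ⟨C, hC⟩ := exists_measure_lt_famMax_le hd hA hq₀ hq₀2
  obtain ⟨E₁, hE₁⟩ := exists_lintegral_Ioc_log_le hp (Family.full.logExponent d)
  obtain ⟨E₂, hE₂⟩ := exists_lintegral_Ioc_log_le hp (Family.isotropic.logExponent d)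
  refine ⟨5 * c + 1, (C * B + B) * max E₁ E₂, by positivity,
    fun P _ hP F n hn M hM f hf K₀ hK₀ y hy => ?_⟩
  have hE : ∫⁻ v in Set.Ioc 0 y, ENNReal.ofReal (v⁻¹ * (1 + |Real.log v|) ^ F.logExponent d)
      * ENNReal.ofReal (v ^ (p - 1)) ≤ (max E₁ E₂ : ℝ≥0) * ENNReal.ofReal (F.ell d p y) := by
    cases F with
    | full =>
      refine (hE₁ y hy).trans ?_
      rw [Family.ell]
      gcongr
      exact le_max_left _ _
    | isotropic =>
      refine (hE₂ y hy).trans ?_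
      rw [Family.ell]
      gcongr
      exact le_max_right _ _
  have hf1 := hf.1.1.aestronglyMeasurable
  -- Averages over boxes ignore null sets, so f may be replaced by a Borel version inside the
  -- maximal function.
  set G : (Fin d → ℝ) → ℝ≥0∞ := fun t => ‖hf1.mk f t‖ₑ with hG
  have hGm : Measurable G := hf1.stronglyMeasurable_mk.measurable.enorm
  have hGf : (fun t => ‖f t‖ₑ) =ᵐ[volume] G := by
    filter_upwards [hf1.ae_eq_mk] with t ht
    rw [hG, ht]
  have hGB : ∀ r, 1 ≤ r → r ≤ q₀ → ∫⁻ x, G x ^ r ≤ B := fun r h1 h2 => by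
    refine le_trans (le_of_eq (lintegral_congr_ae ?_)) (hB f hf r h1 h2)
    filter_upwards [hGf] with x hx
    rw [hx]
  have hmax : ∀ x, famMax F A (fun t => ‖f t‖ₑ) x = famMax F A G x := fun x => by
    unfold famMax
    simp only [avgOver_congr_ae _ hGf]
  have hkey : ∀ t : ℝ, 0 < t → volume {x | ENNReal.ofReal (K₀ * t) < S.oracle p F P M n f x}
      ≤ ((C * B + B : ℝ≥0) : ℝ≥0∞)
        * ENNReal.ofReal (t⁻¹ * (1 + |Real.log t|) ^ F.logExponent d) := by
    intro t ht
    have hsub : {x | ENNReal.ofReal (K₀ * t) < S.oracle p F P M n f x}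
        ⊆ {x | ENNReal.ofReal t < famMax F A G x} ∪ {x | ENNReal.ofReal t ≤ ‖f x‖ₑ} := by
      intro x hx
      by_contra hcon
      rw [Set.mem_union, not_or, Set.mem_ofPred_eq, Set.mem_ofPred_eq, not_lt, not_le] at hcon
      rw [Set.mem_ofPred_eq] at hx
      refine hx.not_ge ((oracle_le hd hnoise hp hn hP hg hKint hkernel hM (hc f) x).trans ?_)
      rw [hmax]
      calc _ ≤ 5 * c * ENNReal.ofReal t + ENNReal.ofReal t := by
            gcongr
            exacts [hcon.1, hcon.2.le]
        _ = ENNReal.ofReal ((5 * c + 1) * t) := by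
            rw [add_mul, one_mul, ENNReal.ofReal_add (by positivity) ht.le,
              ENNReal.ofReal_mul (by positivity), ENNReal.ofReal_mul (by norm_num),
              ENNReal.ofReal_ofNat, ENNReal.ofReal_coe_nnreal]
        _ ≤ _ := ENNReal.ofReal_le_ofReal (by gcongr)
    refine (measure_mono hsub).trans ((measure_union_le _ _).trans ?_)
    rw [ENNReal.coe_add, add_mul, ENNReal.coe_mul]
    refine add_le_add (hC F G hGm B hGB t ht) ?_
    have h1 := meas_ge_le_lintegral_div (μ := volume) hf1.enorm
      (ε := ENNReal.ofReal t) (by simpa using ht) ENNReal.ofReal_ne_top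
    refine h1.trans ?_
    have h2 : ∫⁻ x, ‖f x‖ₑ ≤ B := by simpa using hB f hf 1 le_rfl hq₀.le
    rw [div_eq_mul_inv, ← ENNReal.ofReal_inv_of_pos ht]
    gcongr
    have h3 : 1 ≤ (1 + |Real.log t|) ^ F.logExponent d := one_le_pow₀ (by simp)
    have h4 : 0 < t⁻¹ := by positivity
    nlinarith
  calc _ ≤ ∫⁻ t in Set.Ioc 0 y, ((C * B + B : ℝ≥0) : ℝ≥0∞)
        * (ENNReal.ofReal (t⁻¹ * (1 + |Real.log t|) ^ F.logExponent d)
          * ENNReal.ofReal (t ^ (p - 1))) := by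
        refine setLIntegral_mono' measurableSet_Ioc fun t ht => ?_
        rw [← mul_assoc]
        gcongr
        exact hkey t ht.1
    _ ≤ ((C * B + B : ℝ≥0) : ℝ≥0∞) * ((max E₁ E₂ : ℝ≥0) * ENNReal.ofReal (F.ell d p y)) := by
        rw [lintegral_const_mul' _ _ ENNReal.coe_ne_top]
        gcongr
    _ = _ := by
        rw [ENNReal.coe_mul, mul_assoc]

end Model

end ConvModel

end

/-! ### Integration of the oracle error over all levels -/

noncomputable section

namespace ConvModel

variable {d : ℕ}

namespace Model

variable {S : Model d} {p : ℝ} {M : (Fin d → ℝ) → (Fin d → ℝ) → ℝ}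
  {n : ℕ} {F : Family} {f : (Fin d → ℝ) → ℝ}

/-- Rewriting avz^{-1/2} as at(z(t/v)²)^{-1/2} lets a bandwidth admissible at v be used at any other
level t with an adjusted z. Positivity of a comes from F_n > 0. -/
theorem Fn_sq_le_of_mem_hSetZ (hn : 3 ≤ n) {D v z t : ℝ} (hv : 0 < v) (hz : 0 < z) (ht : 0 < t)
    {k : Fin d → ℤ} (hk : expVec k ∈ S.hSetZ p D F n v z) :
    0 < S.a p D ∧
      S.Fn n (expVec k) ^ 2 ≤ (S.a p D * t) ^ 2 / (z * (t / v) ^ (2 : ℝ)) := by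
  have hF := S.Fn_pos hn k
  have h1 := hk.2
  have h2 : 0 < S.a p D * v * z ^ (-(1 / 2) : ℝ) := hF.trans_le h1
  have h3 := S.a_nonneg p D
  have h4 : S.a p D ≠ 0 := fun h => by simp [h] at h2
  refine ⟨lt_of_le_of_ne h3 (Ne.symm h4), ?_⟩
  have h5 : (z ^ (-(1 / 2) : ℝ)) ^ 2 = z⁻¹ := by
    rw [← Real.rpow_natCast, ← Real.rpow_mul hz.le, ← Real.rpow_neg_one]
    norm_num
  calc S.Fn n (expVec k) ^ 2 ≤ (S.a p D * v * z ^ (-(1 / 2) : ℝ)) ^ 2 := by gcongr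
    _ = _ := by
        rw [mul_pow, h5, Real.rpow_two]
        field_simp

/-- The contribution of the intermediate and of the large levels, for the oracle error built on a
measurable density `ρ` with a given tail. -/
theorem exists_measure_levels_le (hnoise : S.NoiseAssumption)
    (hkernel : S.KernelAssumption) (hg : Integrable S.g volume)
    (hKint : Integrable S.K volume) (hp : 1 < p) {u : ℝ≥0∞} (hu : 1 ≤ u) (D κ : ℝ) (hκ : 1 ≤ κ)
    (Cw : ℝ≥0) :
    ∃ (c₀ : ℝ) (C : ℝ≥0), 0 ≤ c₀ ∧ ∀ ρ : (Fin d → ℝ) → ℝ≥0∞, Measurable ρ →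
      IsProbabilityMeasure (volume.withDensity ρ) →
      (∀ z : ℝ, 1 ≤ z → volume.withDensity ρ {t | ENNReal.ofReal (κ * z) < ρ t}
        ≤ Cw * ENNReal.ofReal z * negPow z u) → ∀ (F : Family) (n : ℕ), 3 ≤ n →
      ∀ M : (Fin d → ℝ) → (Fin d → ℝ) → ℝ, (∀ h ∈ grid d, S.IsSolution h fun y => M y h) →
      (∀ v : ℝ, 0 < v → ∀ h ∈ S.hSet p D F n v,
        volume {x | ENNReal.ofReal (c₀ * v) < S.UStar p F (volume.withDensity ρ) M n h x}
          ≤ C * ENNReal.ofReal ((v ^ 2)⁻¹ * S.Fn n h ^ 2)) ∧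
      (∀ v : ℝ, 0 < v → ∀ z : ℝ, 2 ≤ z → ∀ h ∈ S.hSetZ p D F n v z, ∀ t, v ≤ t →
        volume {x | ENNReal.ofReal (c₀ * t) < S.UStar p F (volume.withDensity ρ) M n h x}
          ≤ C * negPow (z * (t / v) ^ (2 : ℝ)) u) := by
  set κ₁ := √(1 + 4 * S.lamConst p * S.solConst * κ)
  set κ₂ := S.linConst p
  set C₁ : ℝ≥0∞ := ENNReal.ofReal (4 * S.lamConst p * S.solConst) * geomConst d with hC₁
  have hC₁top : C₁ ≠ ∞ := ENNReal.mul_ne_top ENNReal.ofReal_ne_top (geomConst_lt_top d).ne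
  have hκ₂ : 0 ≤ κ₂ := by
    have := S.lamConst_pos hnoise hp
    have := S.one_le_Minf
    show 0 ≤ S.linConst p
    unfold linConst
    positivity
  have ha := S.a_nonneg p D
  have hκ₁ : 0 ≤ κ₁ := Real.sqrt_nonneg _
  -- The first entry serves s = v, the second s = a·t; in both, the linear term is bounded through
  -- G_n ≤ av.
  set c₀ := max (1 + κ₂ * S.a p D) ((κ₁ + κ₂) * S.a p D)
  refine ⟨c₀, (C₁ + C₁ * Cw).toNNReal, le_max_of_le_right (by positivity),
    fun ρ hρ hprob htail F n hn M hM => ⟨fun v hv h hh => ?_, fun v hv z hz h hh t hvt => ?_⟩⟩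
  · obtain ⟨k, rfl⟩ := exists_expVec (F.bandwidths_subset hh.1)
    have h1 := S.measure_lt_UStar_le hnoise hp hn (withDensity_absolutelyContinuous volume ρ) hg
      hKint hkernel hM F k hv
    rw [ENNReal.coe_toNNReal (by finiteness)]
    refine (measure_mono fun x hx => ?_).trans (h1.trans ?_)
    · rw [Set.mem_ofPred_eq] at hx ⊢
      refine (ENNReal.ofReal_le_ofReal ?_).trans_lt hx
      calc v + κ₂ * S.Gn n (expVec k) ≤ v + κ₂ * (S.a p D * v) := by
            gcongr
            exact hh.2
        _ = (1 + κ₂ * S.a p D) * v := by ring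
        _ ≤ c₀ * v := by
            gcongr
            exact le_max_left _ _
    · rw [div_eq_inv_mul]
      gcongr
      exact le_self_add
  · obtain ⟨k, rfl⟩ := exists_expVec (F.bandwidths_subset hh.1.1)
    have ht : 0 < t := hv.trans_le hvt
    obtain ⟨ha0, hFn⟩ := Fn_sq_le_of_mem_hSetZ hn hv (by linarith) ht hh
    have h1t : 1 ≤ t / v := (one_le_div hv).2 hvt
    have hz1 : 1 ≤ z * (t / v) ^ (2 : ℝ) :=
      one_le_mul_of_one_le_of_one_le (by linarith) (Real.one_le_rpow h1t (by norm_num))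
    have h1 := S.measure_lt_UStar_le_negPow hnoise hp hn hρ hg hKint hkernel hM hu hκ htail F k
      (mul_pos ha0 ht) hz1 hFn
    rw [ENNReal.coe_toNNReal (by finiteness)]
    refine (measure_mono fun x hx => ?_).trans (h1.trans ?_)
    · rw [Set.mem_ofPred_eq] at hx ⊢
      refine (ENNReal.ofReal_le_ofReal ?_).trans_lt hx
      calc κ₁ * (S.a p D * t) + κ₂ * S.Gn n (expVec k)
          ≤ κ₁ * (S.a p D * t) + κ₂ * (S.a p D * t) := by
            gcongr
            exact hh.1.2.trans (by gcongr)
        _ = ((κ₁ + κ₂) * S.a p D) * t := by ring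
        _ ≤ c₀ * t := by
            gcongr
            exact le_max_right _ _
    · gcongr
      exact le_add_self

/-- The layer-cake integral, with levels rescaled by K₀, is cut at v̲ and v̄. The three pieces give
l_ℍ(v̲), the integral of the minimum of the two Λ's, and Λ_p(v̄, f, u). -/
theorem exists_lintegral_oracle_rpow_le (hd : 1 ≤ d) (hnoise : S.NoiseAssumption)
    (hkernel : S.KernelAssumption) (hg : Integrable S.g volume) (hKcont : Continuous S.K)
    (hKint : Integrable S.K volume) (hKsupp : HasCompactSupport S.K) (hp : 1 < p) {q u : ℝ≥0∞}
    (hq : 1 < q) (hpu : ENNReal.ofReal (p / 2) < u) (hqu : q ≤ u) (R D : ℝ) :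
    ∃ C : ℝ≥0, ∀ (F : Family) (n : ℕ), 3 ≤ n → ∀ M : (Fin d → ℝ) → (Fin d → ℝ) → ℝ,
      (∀ h ∈ grid d, S.IsSolution h fun y => M y h) → ∀ f ∈ S.classFu u R D ∩ lpBall d q D,
      ∀ vlo vup : ℝ, 0 < vlo → vlo ≤ vup →
      ∫⁻ x, S.oracle p F (volume.withDensity fun x => ENNReal.ofReal (S.obsDensity f x)) M n f x ^ p
        ≤ C * (ENNReal.ofReal (F.ell d p vlo)
            + (∫⁻ v in Set.Icc vlo vup, ENNReal.ofReal (v ^ (p - 1))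
                * min (S.Lam p D F n f v) (S.LamU p D F n f u v))
            + S.LamP p D F n f u vup) := by
  have hu1 : 1 < u := hq.trans_le hqu
  have hp0 : 0 < p := by linarith
  obtain ⟨κ, Cw, hκ, htail⟩ := exists_tail_le (d := d) hu1 D
  obtain ⟨c₀, C₂, hc₀, hlev⟩ := exists_measure_levels_le hnoise hkernel hg hKint hp hu1.le D κ hκ Cw
  obtain ⟨K₁, C₃, hK₁, hsmall⟩ := exists_lintegral_small_levels_le hd hnoise hkernel hg hKcont hKint
    hKsupp hp hq R D
  -- A finite exponent between p/2 and u treats u = ∞ together with finite u in the tail integral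
  -- above v̄.
  obtain ⟨w, hw0, hpw, hwu⟩ : ∃ w : ℝ, 0 ≤ w ∧ p < 2 * w ∧ ENNReal.ofReal w ≤ u := by
    obtain ⟨w, hw1, hw2⟩ := exists_between hpu
    have hwtop : w ≠ ∞ := (hw2.trans_le le_top).ne
    refine ⟨w.toReal, ENNReal.toReal_nonneg, ?_, (ENNReal.ofReal_toReal hwtop).le.trans hw2.le⟩
    have := (ENNReal.ofReal_lt_iff_lt_toReal (by linarith) hwtop).1 hw1
    linarith
  set K₀ := max (60 * c₀ + 1) K₁
  have hK₀1 : 60 * c₀ + 1 ≤ K₀ := le_max_left _ _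
  have hK₀ : 0 < K₀ := by linarith
  set C₄ : ℝ≥0∞ := 1 + C₂ with hC₄
  have hC₄0 : C₄ ≠ 0 := by simp [hC₄]
  have hC₄' : C₄ ≠ ∞ := by finiteness
  set C₅ : ℝ≥0∞ := 1 + ENNReal.ofReal p * (C₂ * ENNReal.ofReal ((2 * w - p)⁻¹)) with hC₅
  have hC₅0 : C₅ ≠ 0 := by simp [hC₅]
  have hC₅' : C₅ ≠ ∞ := by finiteness
  set Ctot : ℝ≥0∞ := ENNReal.ofReal K₀ ^ p * (ENNReal.ofReal p * C₃ + ENNReal.ofReal p * C₄ + C₅)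
  have hCtot : Ctot ≠ ∞ := by finiteness
  refine ⟨Ctot.toNNReal, fun F n hn M hM f hf vlo vup hvlo hvup => ?_⟩
  rw [ENNReal.coe_toNNReal hCtot]
  have hvup0 : 0 < vup := hvlo.trans_le hvup
  obtain ⟨⟨⟨hfR, hdens⟩, hweak⟩, hfq⟩ := hf
  -- a measurable version of the density of the observations
  have hbm : AEMeasurable (fun x => ENNReal.ofReal (S.obsDensity f x)) volume :=
    hdens.1.aestronglyMeasurable.aemeasurable.ennreal_ofReal
  set ρ := hbm.mk _ with hρdef
  have hρ : Measurable ρ := hbm.measurable_mk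
  have hPρ : (volume.withDensity fun x => ENNReal.ofReal (S.obsDensity f x))
      = volume.withDensity ρ := withDensity_congr_ae hbm.ae_eq_mk
  have hprob : IsProbabilityMeasure (volume.withDensity ρ) := by
    rw [← hPρ]
    refine ⟨?_⟩
    rw [withDensity_apply _ MeasurableSet.univ, Measure.restrict_univ,
      ← ofReal_integral_eq_lintegral_ofReal hdens.1 hdens.2.1, hdens.2.2, ENNReal.ofReal_one]
  rw [hPρ]
  have hfm := hfR.1.aestronglyMeasurable
  obtain ⟨hlev1, hlev2⟩ := hlev ρ hρ hprob
    (htail _ ρ hweak hρ (hbm.ae_eq_mk.symm)) F n hn M hM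
  set P := volume.withDensity ρ
  set T := S.oracle p F P M n f
  have hT : AEMeasurable T volume := aemeasurable_oracle hKcont.measurable hfm hM
  set N : ℝ → ℝ≥0∞ := fun t => volume {x | ENNReal.ofReal (K₀ * t) < T x} with hN
  have hlayer : ∫⁻ x, T x ^ p = ENNReal.ofReal K₀ ^ p * (ENNReal.ofReal p
      * ∫⁻ t in Set.Ioi 0, N t * ENNReal.ofReal (t ^ (p - 1))) := by
    have hK₀' : ENNReal.ofReal K₀ ≠ 0 := by simpa using hK₀
    have h1 := lintegral_rpow_eq_layer_of_aemeasurable (hT.const_mul (ENNReal.ofReal K₀)⁻¹) hp0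
    have h2 : ∀ t : ℝ, {x | ENNReal.ofReal t < (ENNReal.ofReal K₀)⁻¹ * T x}
        = {x | ENNReal.ofReal (K₀ * t) < T x} := fun t => by
      ext x
      rw [Set.mem_ofPred_eq, Set.mem_ofPred_eq, mul_comm _ (T x), ← div_eq_mul_inv,
        ENNReal.lt_div_iff_mul_lt (Or.inl hK₀') (Or.inl ENNReal.ofReal_ne_top), mul_comm K₀,
        ENNReal.ofReal_mul' hK₀.le]
    simp only [h2] at h1
    rw [← h1]
    simp only [ENNReal.mul_rpow_of_nonneg _ _ hp0.le]
    rw [lintegral_const_mul'' _ (hT.pow_const p), ← mul_assoc, ← ENNReal.mul_rpow_of_nonneg _ _ hp0.le,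
      ENNReal.mul_inv_cancel hK₀' ENNReal.ofReal_ne_top, ENNReal.one_rpow, one_mul]
  have hNle : ∀ t, 0 < t → ∀ h ∈ F.bandwidths d, N t
      ≤ volume {x | ENNReal.ofReal t < S.totalBias F f h x}
        + volume {x | ENNReal.ofReal (c₀ * t) < S.UStar p F P M n h x} := fun t ht h hh =>
    (measure_mono (setOf_lt_oracle_subset hc₀ hK₀1 hh ht)).trans (measure_union_le _ _)
  have hlow : ∫⁻ t in Set.Ioc 0 vlo, N t * ENNReal.ofReal (t ^ (p - 1))
      ≤ C₃ * ENNReal.ofReal (F.ell d p vlo) :=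
    hsmall P (withDensity_absolutelyContinuous volume ρ) F n hn M hM f ⟨hfR, hfq⟩ K₀
      (le_max_right _ _) vlo hvlo
  have hmid : ∫⁻ t in Set.Ioc vlo vup, N t * ENNReal.ofReal (t ^ (p - 1))
      ≤ C₄ * ∫⁻ v in Set.Icc vlo vup, ENNReal.ofReal (v ^ (p - 1))
                * min (S.Lam p D F n f v) (S.LamU p D F n f u v) := by
    rw [← lintegral_const_mul' _ _ hC₄']
    refine (setLIntegral_mono' measurableSet_Ioc fun v hv => ?_).trans
      (lintegral_mono_set Set.Ioc_subset_Icc_self)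
    have hv0 : 0 < v := hvlo.trans hv.1
    have hA : ∀ h, volume {x | ENNReal.ofReal v < S.totalBias F f h x}
        ≤ volume (S.levelSet F f h v) := fun h =>
      measure_mono (setOf_lt_totalBias_subset_levelSet h (by linarith))
    have h1 : N v ≤ C₄ * S.Lam p D F n f v := by
      refine ENNReal.le_mul_iInf₂ hC₄0 hC₄' fun h hh => ?_
      refine (hNle v hv0 h hh.1).trans ?_
      rw [hC₄, mul_add]
      refine add_le_add ((hA h).trans (le_mul_of_one_le_left' le_self_add))
        ((hlev1 v hv0 h hh).trans ?_)
      gcongr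
      exact le_add_self
    have h2 : N v ≤ C₄ * S.LamU p D F n f u v := by
      refine ENNReal.le_mul_iInf₂ hC₄0 hC₄' fun z hz => ?_
      refine ENNReal.le_mul_iInf₂ hC₄0 hC₄' fun h hh => ?_
      refine (hNle v hv0 h hh.1.1).trans ?_
      have h3 := hlev2 v hv0 z hz h hh v le_rfl
      rw [div_self hv0.ne', Real.one_rpow, mul_one] at h3
      rw [hC₄, mul_add]
      refine add_le_add ((hA h).trans (le_mul_of_one_le_left' le_self_add)) (h3.trans ?_)
      gcongr
      exact le_add_self
    calc N v * ENNReal.ofReal (v ^ (p - 1))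
        ≤ C₄ * min (S.Lam p D F n f v) (S.LamU p D F n f u v) * ENNReal.ofReal (v ^ (p - 1)) := by
          gcongr
          rcases min_choice (S.Lam p D F n f v) (S.LamU p D F n f u v) with h | h <;> rw [h]
          exacts [h1, h2]
      _ = _ := by ring
  -- One pair (z, h) admissible at v̄ is kept for all t > v̄. The bias part integrates back to the
  -- integral of ℬ_h^p over the level set at v̄, and the majorant part converges because 2w > p.
  have hup : ENNReal.ofReal p * ∫⁻ t in Set.Ioi vup, N t * ENNReal.ofReal (t ^ (p - 1))
      ≤ C₅ * S.LamP p D F n f u vup := by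
    refine ENNReal.le_mul_iInf₂ hC₅0 hC₅' fun z hz => ?_
    refine ENNReal.le_mul_iInf₂ hC₅0 hC₅' fun h hh => ?_
    have hz0 : 0 < z := lt_of_lt_of_le (by norm_num) hz
    set A := S.levelSet F f h vup
    have hbias : AEMeasurable (S.totalBias F f h) volume :=
      aemeasurable_totalBias hKcont.measurable hfm F h
    have hstep : ∀ t, vup < t → N t * ENNReal.ofReal (t ^ (p - 1))
        ≤ (volume.restrict A) {x | ENNReal.ofReal t < S.totalBias F f h x}
            * ENNReal.ofReal (t ^ (p - 1))
          + C₂ * negPow z u * (ENNReal.ofReal ((t / vup) ^ (-(2 * w)))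
            * ENNReal.ofReal (t ^ (p - 1))) := by
      intro t ht
      have ht0 : 0 < t := hvup0.trans ht
      rw [← mul_assoc, ← add_mul]
      gcongr
      refine (hNle t ht0 h hh.1.1).trans (add_le_add ?_ ((hlev2 vup hvup0 z hz h hh t ht.le).trans ?_))
      · rw [Measure.restrict_eq_self _ (setOf_lt_totalBias_subset_levelSet h (by linarith))]
      · have h1t : 1 ≤ t / vup := (one_le_div hvup0).2 ht.le
        have h4 := negPow_mul_le hwu hz0 (Real.one_le_rpow h1t (by norm_num : (0 : ℝ) ≤ 2))
        have e : ((t / vup) ^ (2 : ℝ)) ^ (-w) = (t / vup) ^ (-(2 * w)) := by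
          rw [← Real.rpow_mul (by positivity)]
          congr 1
          ring
        rw [e] at h4
        rw [mul_assoc, mul_comm (negPow z u)]
        gcongr
    have hmeas2 : Measurable fun t : ℝ => C₂ * negPow z u
        * (ENNReal.ofReal ((t / vup) ^ (-(2 * w))) * ENNReal.ofReal (t ^ (p - 1))) := by fun_prop
    have hbiasint : ENNReal.ofReal p * ∫⁻ t in Set.Ioi vup,
        (volume.restrict A) {x | ENNReal.ofReal t < S.totalBias F f h x}
            * ENNReal.ofReal (t ^ (p - 1)) ≤ ∫⁻ x in A, S.totalBias F f h x ^ p := by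
      rw [lintegral_rpow_eq_layer_of_aemeasurable hbias.restrict hp0]
      gcongr
    calc _ ≤ ENNReal.ofReal p * ((∫⁻ t in Set.Ioi vup,
            (volume.restrict A) {x | ENNReal.ofReal t < S.totalBias F f h x}
            * ENNReal.ofReal (t ^ (p - 1))) + ∫⁻ t in Set.Ioi vup, C₂ * negPow z u
            * (ENNReal.ofReal ((t / vup) ^ (-(2 * w))) * ENNReal.ofReal (t ^ (p - 1)))) := by
          rw [← lintegral_add_right _ hmeas2]
          gcongr _ * ?_
          exact setLIntegral_mono' measurableSet_Ioi hstep
      _ ≤ (∫⁻ x in A, S.totalBias F f h x ^ p) + ENNReal.ofReal p * (C₂ * negPow z u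
            * (ENNReal.ofReal ((2 * w - p)⁻¹) * ENNReal.ofReal (vup ^ p))) := by
          rw [mul_add, lintegral_const_mul _ (by fun_prop), lintegral_Ioi_div_rpow hpw hvup0]
          gcongr
      _ = 1 * (∫⁻ x in A, S.totalBias F f h x ^ p) + ENNReal.ofReal p * (C₂
            * ENNReal.ofReal ((2 * w - p)⁻¹)) * (ENNReal.ofReal (vup ^ p) * negPow z u) := by ring
      _ ≤ _ := by
          rw [hC₅, mul_add]
          gcongr
          exacts [le_self_add, le_add_self]
  have hsplit : Set.Ioi (0 : ℝ) = (Set.Ioc 0 vlo ∪ Set.Ioc vlo vup) ∪ Set.Ioi vup := by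
    rw [Set.Ioc_union_Ioc_eq_Ioc hvlo.le hvup, Set.Ioc_union_Ioi_eq_Ioi hvup0.le]
  set I := ∫⁻ v in Set.Icc vlo vup, ENNReal.ofReal (v ^ (p - 1))
                * min (S.Lam p D F n f v) (S.LamU p D F n f u v)
  set L := S.LamP p D F n f u vup
  set E := ENNReal.ofReal (F.ell d p vlo)
  rw [hlayer, hsplit]
  calc _ ≤ ENNReal.ofReal K₀ ^ p * (ENNReal.ofReal p
        * ((∫⁻ t in Set.Ioc 0 vlo, N t * ENNReal.ofReal (t ^ (p - 1)))
        + (∫⁻ t in Set.Ioc vlo vup, N t * ENNReal.ofReal (t ^ (p - 1)))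
        + ∫⁻ t in Set.Ioi vup, N t * ENNReal.ofReal (t ^ (p - 1)))) := by
        gcongr
        refine (lintegral_union_le _ _ _).trans ?_
        gcongr
        exact lintegral_union_le _ _ _
    _ = ENNReal.ofReal K₀ ^ p * (ENNReal.ofReal p
        * (∫⁻ t in Set.Ioc 0 vlo, N t * ENNReal.ofReal (t ^ (p - 1)))
        + ENNReal.ofReal p * (∫⁻ t in Set.Ioc vlo vup, N t * ENNReal.ofReal (t ^ (p - 1)))
        + ENNReal.ofReal p * ∫⁻ t in Set.Ioi vup, N t * ENNReal.ofReal (t ^ (p - 1))) := by ring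
    _ ≤ ENNReal.ofReal K₀ ^ p * (ENNReal.ofReal p * (C₃ * E) + ENNReal.ofReal p * (C₄ * I)
        + C₅ * L) := by gcongr
    _ ≤ ENNReal.ofReal K₀ ^ p * ((ENNReal.ofReal p * C₃ + ENNReal.ofReal p * C₄ + C₅) * E
        + (ENNReal.ofReal p * C₃ + ENNReal.ofReal p * C₄ + C₅) * I
        + (ENNReal.ofReal p * C₃ + ENNReal.ofReal p * C₄ + C₅) * L) := by
        rw [← mul_assoc (ENNReal.ofReal p), ← mul_assoc (ENNReal.ofReal p)]
        gcongr
        · exact le_self_add.trans le_self_add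
        · exact le_add_self.trans le_self_add
        · exact le_add_self
    _ = _ := by ring

end Model

end ConvModel

/-! ### The risk bound -/

open ConvModel ConvModel.Model

theorem theorem2 {d : ℕ} (hd : 1 ≤ d) (S : ConvModel.Model d)
    (hα : S.α ∈ Set.Icc (0 : ℝ) 1) (hg : Integrable S.g volume)
    (hKcont : Continuous S.K) (hKint : Integrable S.K volume) (hKone : ∫ x, S.K x = 1)
    (hKsupp : HasCompactSupport S.K)
    (hnoise : S.NoiseAssumption) (hkernel : S.KernelAssumption)
    (p : ℝ) (hp : 1 < p) :
    ∃ Cp : ℝ≥0, ∀ (R D : ℝ) (q u : ℝ≥0∞), 1 < R → 0 < D → 1 < q →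
      ENNReal.ofReal (p / 2) < u → q ≤ u →
      ∃ C : ℝ≥0, ∀ (F : ConvModel.Family) (n : ℕ), 3 ≤ n →
        ∀ M : (Fin d → ℝ) → (Fin d → ℝ) → ℝ,
          (∀ h ∈ ConvModel.grid d, S.IsSolution h fun y => M y h) →
        ∀ τ : (Fin d → ℝ) → ℝ, Measurable τ → (∀ x, 0 ≤ τ x) →
          eLpNorm τ (ENNReal.ofReal p) volume ≤ ENNReal.ofReal ((n : ℝ) ^ (-(1 / 2) : ℝ)) →
        ∀ sel : (Fin n → Fin d → ℝ) → (Fin d → ℝ) → (Fin d → ℝ),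
          S.IsSelection p F M τ sel →
        ∀ f ∈ S.classFu u R D ∩ ConvModel.lpBall d q D,
        ∀ vlo vup : ℝ, 0 < vlo → vlo ≤ vup →
          S.risk p n (fun Z x => ConvModel.Model.fhat M Z x (sel Z x)) f
            ≤ C * (ENNReal.ofReal (F.ell d p vlo)
                  + (∫⁻ v in Set.Icc vlo vup, ENNReal.ofReal (v ^ (p - 1))
                      * min (S.Lam p D F n f v) (S.LamU p D F n f u v))
                  + S.LamP p D F n f u vup) ^ (1 / p)
              + Cp * ENNReal.ofReal ((n : ℝ) ^ (-(1 / 2) : ℝ)) := by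
  have hp0 : 0 < p := by linarith
  have hip : 0 ≤ 1 / p := by positivity
  obtain ⟨C₁, hC₁⟩ := S.lintegral_noise_rpow_le hg hKint hnoise hkernel hp
  -- 3^p splits the p-th power of the three-term oracle inequality, 65 is its noise coefficient, and
  -- 1 stands for the tolerance τ. The constant is fixed before R, D, q and u are introduced.
  set Cn : ℝ≥0∞ := 3 ^ p * (65 ^ p * C₁ + 1) with hCn
  have hCntop : Cn ^ (1 / p) ≠ ∞ := by finiteness
  refine ⟨(Cn ^ (1 / p)).toNNReal, fun R D q u hR hD hq hpu hqu => ?_⟩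
  obtain ⟨C₂, hC₂⟩ := exists_lintegral_oracle_rpow_le hd hnoise hkernel hg hKcont hKint hKsupp hp
    hq hpu hqu R D
  have hCtop : ((3 : ℝ≥0∞) ^ p * C₂) ^ (1 / p) ≠ ∞ := by finiteness
  refine ⟨(((3 : ℝ≥0∞) ^ p * C₂) ^ (1 / p)).toNNReal,
    fun F n hn M hM τ hτ hτ0 hτn sel hsel f hf vlo vup hvlo hvup => ?_⟩
  rw [ENNReal.coe_toNNReal hCntop, ENNReal.coe_toNNReal hCtop]
  have hO := hC₂ F n hn M hM f hf vlo vup hvlo hvup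
  set B := ENNReal.ofReal (F.ell d p vlo) + (∫⁻ v in Set.Icc vlo vup, ENNReal.ofReal (v ^ (p - 1))
    * min (S.Lam p D F n f v) (S.LamU p D F n f u v)) + S.LamP p D F n f u vup
  set P : Measure (Fin d → ℝ) :=
    volume.withDensity fun x => ENNReal.ofReal (S.obsDensity f x) with hPdef
  obtain ⟨⟨⟨hfR, hdens⟩, hweak⟩, hfq⟩ := hf
  have hprob : IsProbabilityMeasure P := by
    refine ⟨?_⟩
    rw [hPdef, withDensity_apply _ MeasurableSet.univ, Measure.restrict_univ,
      ← ofReal_integral_eq_lintegral_ofReal hdens.1 hdens.2.1, hdens.2.2, ENNReal.ofReal_one]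
  have hP : P ≪ volume := withDensity_absolutelyContinuous _ _
  have hfint : Integrable f volume := memLp_one_iff_integrable.1 hfR.1
  have hmean : ∀ h ∈ grid d, ∀ x, ∫ t, M (t - x) h ∂P = S.smooth f h x := fun h hh x => by
    obtain ⟨k, rfl⟩ := exists_expVec hh
    have hsolk := hM _ hh
    have hb := (hsolk.bounds hg hKint hnoise hkernel (expVec_pos k)).1
    rw [← hsolk.integral_mul_obsDensity hg hb hfint x, hPdef,
      integral_withDensity_eq_integral_toReal_smul₀
        hdens.1.aestronglyMeasurable.aemeasurable.ennreal_ofReal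
        (Filter.Eventually.of_forall fun _ => ENNReal.ofReal_lt_top)]
    refine integral_congr_ae ?_
    filter_upwards [hdens.2.1] with t ht
    rw [ENNReal.toReal_ofReal ht, smul_eq_mul, mul_comm]
  have hnoiseint := hC₁ P hP n hn M hM
  set T := S.oracle p F P M n f
  set r := ENNReal.ofReal ((n : ℝ) ^ (-(1 / 2) : ℝ)) with hr
  have hrp : ENNReal.ofReal ((n : ℝ) ^ (-(p / 2))) = r ^ p := by
    rw [hr, ENNReal.ofReal_rpow_of_nonneg (by positivity) hp0.le, ← Real.rpow_mul (by positivity)]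
    congr 2
    ring
  have hτint : ∫⁻ x, ENNReal.ofReal (τ x) ^ p ≤ r ^ p := by
    rw [eLpNorm_eq_lintegral_rpow_enorm_toReal (by simpa using hp0) ENNReal.ofReal_ne_top,
      ENNReal.toReal_ofReal hp0.le, one_div, ENNReal.rpow_inv_le_iff hp0] at hτn
    refine le_trans (le_of_eq (lintegral_congr fun x => ?_)) hτn
    rw [← ofReal_norm, Real.norm_of_nonneg (hτ0 x)]
  have hpoint : ∀ Z, eLpNorm (fun x => fhat M Z x (sel Z x) - f x) (ENNReal.ofReal p) volume ^ p
      ≤ 3 ^ p * (∫⁻ x, T x ^ p) + 3 ^ p * r ^ p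
        + 3 ^ p * 65 ^ p * ∫⁻ x, S.noise p P M n (x, Z) ^ p := fun Z => by
    have hζ : Measurable fun x => S.noise p P M n (x, Z) :=
      (measurable_noise hM).comp measurable_prodMk_right
    rw [eLpNorm_eq_lintegral_rpow_enorm_toReal (by simpa using hp0) ENNReal.ofReal_ne_top,
      ENNReal.toReal_ofReal hp0.le, ← ENNReal.rpow_mul, one_div, inv_mul_cancel₀ hp0.ne',
      ENNReal.rpow_one]
    calc ∫⁻ x, ‖fhat M Z x (sel Z x) - f x‖ₑ ^ p
        ≤ ∫⁻ x, 3 ^ p * (T x ^ p + (65 * S.noise p P M n (x, Z)) ^ p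
            + ENNReal.ofReal (τ x) ^ p) := by
          refine lintegral_mono fun x => ?_
          refine le_trans ?_ (ENNReal.add_add_rpow_le _ _ _ hp0.le)
          gcongr
          rw [← ofReal_norm, Real.norm_eq_abs]
          exact ofReal_abs_fhat_sub_le_oracle hnoise hp hn hmean hsel Z x
      _ = 3 ^ p * ((∫⁻ x, T x ^ p) + 65 ^ p * (∫⁻ x, S.noise p P M n (x, Z) ^ p)
            + ∫⁻ x, ENNReal.ofReal (τ x) ^ p) := by
          simp only [ENNReal.mul_rpow_of_nonneg _ _ hp0.le]
          rw [lintegral_const_mul' _ _ (by finiteness),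
            lintegral_add_right _ (hτ.ennreal_ofReal.pow_const p),
            lintegral_add_right _ ((hζ.pow_const p).const_mul _),
            lintegral_const_mul _ (hζ.pow_const p)]
      _ ≤ 3 ^ p * ((∫⁻ x, T x ^ p) + 65 ^ p * (∫⁻ x, S.noise p P M n (x, Z) ^ p) + r ^ p) := by
          gcongr
      _ = _ := by ring
  have hrisk : ∫⁻ Z, eLpNorm (fun x => fhat M Z x (sel Z x) - f x) (ENNReal.ofReal p) volume ^ p
      ∂(S.sampleLaw n f) ≤ 3 ^ p * C₂ * B + Cn * r ^ p := by
    -- The majorant no longer involves the selected bandwidth: the oracle term is deterministic and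
    -- the noise is a supremum over the whole grid.
    calc _ ≤ ∫⁻ Z, (3 ^ p * (∫⁻ x, T x ^ p) + 3 ^ p * r ^ p
          + 3 ^ p * 65 ^ p * ∫⁻ x, S.noise p P M n (x, Z) ^ p) ∂(Measure.pi fun _ => P) :=
          lintegral_mono hpoint
      _ = 3 ^ p * (∫⁻ x, T x ^ p) + 3 ^ p * r ^ p + 3 ^ p * 65 ^ p
          * ∫⁻ Z, (∫⁻ x, S.noise p P M n (x, Z) ^ p) ∂(Measure.pi fun _ => P) := by
          rw [lintegral_add_left measurable_const, lintegral_const, measure_univ, mul_one,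
            lintegral_const_mul' _ _ (by finiteness)]
      _ ≤ 3 ^ p * (C₂ * B) + 3 ^ p * r ^ p + 3 ^ p * 65 ^ p * (C₁ * r ^ p) := by
          rw [← hrp]
          gcongr
      _ = _ := by
          rw [hCn]
          ring
  calc S.risk p n (fun Z x => fhat M Z x (sel Z x)) f
      ≤ (3 ^ p * C₂ * B + Cn * r ^ p) ^ (1 / p) := ENNReal.rpow_le_rpow hrisk hip
    -- Subadditivity of y ↦ y^{1/p} for p ≥ 1 keeps the n^{-1/2} term apart from the constant that
    -- depends on R, D, q and u.
    _ ≤ (3 ^ p * C₂ * B) ^ (1 / p) + (Cn * r ^ p) ^ (1 / p) :=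
        ENNReal.rpow_add_le_add_rpow _ _ hip (by rw [div_le_one hp0]; exact hp.le)
    _ = _ := by
        rw [ENNReal.mul_rpow_of_nonneg _ _ hip, ENNReal.mul_rpow_of_nonneg Cn _ hip,
          ← ENNReal.rpow_mul, mul_one_div_cancel hp0.ne', ENNReal.rpow_one]

end
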